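/- Let $S^2=\mathbb{C}\cup\{\infty\}$ be the Riemann sphere and let $y:S^2\to S^6\subset\mathbb{R}^7$ be a smooth conformal immersion. Let $\langle\cdot,\cdot\rangle$ be the complex bilinear extension of the Lorentz metric $-x_0y_0+\sum_{j=1}^{7}x_jy_j$ of $\mathbb{R}^8_1$. With respect to a local complex coordinate $z$ let $Y=e^{-\omega}(1,y)$, $e^{2\omega}=2\langle y_z,y_{\bar z}\rangle$, be the canonical lift of $y$, let $V_{\mathbb{C}}=\mathrm{Span}_{\mathbb{C}}\{Y,Y_z,Y_{\bar z},Y_{z\bar z}\}$, let $V^\perp_{\mathbb{C}}$ be its orthogonal complement (the complexified normal bundle) and let $D$ be the normal connection, i.e. $D_z\psi$ and $D_{\bar z}\psi$ are the orthogonal projections of $\psi_z$ and $\psi_{\bar z}$ to $V_{\mathbb{C}}^\perp$. The Hopf differential $\kappa\in\Gamma(V_{\mathbb{C}}^\perp)$ and the Schwarzian $s$ are defined by $Y_{zz}=-\frac{s}{2}Y+\kappa$. The surface $y$ is called *Willmore* if $D_{\bar z}D_{\bar z}\kappa+\frac{\bar s}{2}\kappa=0$; *S-Willmore* if it is Willmore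 and $D_{\bar z}\kappa$ and $\kappa$ are linearly dependent at every point; *totally isotropic* if $\langle\partial_z^mY,\partial_z^nY\rangle=0$ for all integers $m,n\ge 1$; and *full* in $S^6$ if its image is contained in no affine hyperplane of $\mathbb{R}^7$ (each condition being required in all local complex coordinates where it involves $z$). **Theorem 2.1.** Let $y:S^2\to S^6$ be a Willmore two-sphere with isotropic Hopf differential, i.e. $\langle\kappa,\kappa\rangle=0$. If $y$ is not S-Willmore, then $y$ is totally isotropic and full in $S^6$. Moreover, for every local complex coordinate $z$ and every point of its domain there are, on a neighbourhood of this point, smooth sections $E_1,E_2$ of $V_{\mathbb{C}}^\perp$ such that $\{E_1,E_2,\bar E_1,\bar E_2\}$ is a frame of $V_{\mathbb{C}}^\perp$ and, for $i,j=1,2$, $$\kappa,\ D_z\kappa,\ D_{\bar z}\kappa\in\mathrm{Span}_{\mathbb{C}}\{E_1,E_2\},\qquad \langle E_i,E_j\rangle=0,\quad \langle E_i,\bar E_j\rangle=\delta_{ij},$$ $$D_zE_i,\ D_{\bar z}E_i\in\mathrm{Span}_{\mathbb{C}}\{E_1,E_2\},\qquad D_z\bar E_i,\ D_{\bar z}\bar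 E_i\in\mathrm{Span}_{\mathbb{C}}\{\bar E_1,\bar E_2\}.$$ That is, the normal connection is block diagonal under the frame $\{E_1,E_2,\bar E_1,\bar E_2\}$. -/

import Mathlib

open scoped Manifold ContDiff

noncomputable section

namespace WillmoreSurface

/-! ## The Riemann sphere `ℂ ∪ {∞}` as a complex manifold -/

/-- The involution `z ↦ 1 / z` of `ℂ ∪ {∞}`, exchanging `0` and `∞`. -/
def sphereInv : OnePoint ℂ → OnePoint ℂ
  | none => ((0 : ℂ) : OnePoint ℂ)
  | some z => if z = 0 then OnePoint.infty else ((z⁻¹ : ℂ) : OnePoint ℂ)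

theorem sphereInv_infty : sphereInv OnePoint.infty = ((0 : ℂ) : OnePoint ℂ) := rfl

theorem sphereInv_coe (z : ℂ) :
    sphereInv (z : OnePoint ℂ) = if z = 0 then OnePoint.infty else ((z⁻¹ : ℂ) : OnePoint ℂ) := rfl

theorem sphereInv_sphereInv (p : OnePoint ℂ) : sphereInv (sphereInv p) = p := by
  induction p using OnePoint.rec with
  | infty => simp [sphereInv_infty, sphereInv_coe]
  | coe z =>
    by_cases hz : z = 0
    · simp [sphereInv_coe, hz, sphereInv_infty]
    · simp [sphereInv_coe, hz]

theorem continuous_sphereInv : Continuous sphereInv := by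
  rw [continuous_iff_continuousAt]
  intro p
  induction p using OnePoint.rec with
  | infty =>
    rw [OnePoint.continuousAt_infty', sphereInv_infty]
    have h1 : Filter.Tendsto (fun z : ℂ => z⁻¹) (Filter.coclosedCompact ℂ) (nhds 0) := by
      rw [Filter.coclosedCompact_eq_cocompact, ← Metric.cobounded_eq_cocompact]
      exact Filter.tendsto_inv₀_cobounded
    refine ((OnePoint.continuous_coe.tendsto (0 : ℂ)).comp h1).congr' ?_
    have h2 : ({0}ᶜ : Set ℂ) ∈ Filter.coclosedCompact ℂ := by
      rw [Filter.coclosedCompact_eq_cocompact]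
      exact isCompact_singleton.compl_mem_cocompact
    filter_upwards [h2] with z hz
    have hz' : z ≠ 0 := hz
    simp [sphereInv_coe, hz']
  | coe z =>
    rw [OnePoint.continuousAt_coe]
    by_cases hz : z = 0
    · subst hz
      have h0 : (sphereInv ∘ (fun z : ℂ => (z : OnePoint ℂ))) 0 = OnePoint.infty := by
        simp [sphereInv_coe]
      rw [← continuousWithinAt_compl_self]
      unfold ContinuousWithinAt
      rw [h0]
      have h1 : Filter.Tendsto (fun z : ℂ => z⁻¹) (nhdsWithin 0 {0}ᶜ)
          (Filter.coclosedCompact ℂ) := by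
        rw [Filter.coclosedCompact_eq_cocompact, ← Metric.cobounded_eq_cocompact]
        exact Filter.tendsto_inv₀_nhdsNE_zero
      have h2 : Filter.Tendsto ((↑) : ℂ → OnePoint ℂ) (Filter.coclosedCompact ℂ)
          (nhds OnePoint.infty) := OnePoint.tendsto_coe_infty
      refine (h2.comp h1).congr' ?_
      filter_upwards [self_mem_nhdsWithin] with w hw
      have hw' : w ≠ 0 := hw
      simp [sphereInv_coe, hw']
    · have h1 : ContinuousAt (fun w : ℂ => ((w⁻¹ : ℂ) : OnePoint ℂ)) z :=
        OnePoint.continuous_coe.continuousAt.comp (continuousAt_inv₀ hz)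
      refine h1.congr ?_
      filter_upwards [isOpen_compl_singleton.mem_nhds (show z ∈ ({0}ᶜ : Set ℂ) from hz)] with w hw
      have hw' : w ≠ 0 := hw
      simp [sphereInv_coe, hw']

/-- `z ↦ 1 / z` as a homeomorphism of `ℂ ∪ {∞}`. -/
def sphereInvHomeo : OnePoint ℂ ≃ₜ OnePoint ℂ where
  toFun := sphereInv
  invFun := sphereInv
  left_inv := sphereInv_sphereInv
  right_inv := sphereInv_sphereInv
  continuous_toFun := continuous_sphereInv
  continuous_invFun := continuous_sphereInv

/-- The coordinate `z` on `ℂ ⊆ ℂ ∪ {∞}`. -/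
def chartZero : OpenPartialHomeomorph (OnePoint ℂ) ℂ :=
  (OnePoint.isOpenEmbedding_coe.toOpenPartialHomeomorph ((↑) : ℂ → OnePoint ℂ)).symm

/-- The coordinate `1 / z` on `(ℂ ∪ {∞}) \ {0}`. -/
def chartInfty : OpenPartialHomeomorph (OnePoint ℂ) ℂ :=
  sphereInvHomeo.toOpenPartialHomeomorph.trans chartZero

open Classical in
/-- The two standard coordinates `z` and `1 / z` on the Riemann sphere. -/
instance : ChartedSpace ℂ (OnePoint ℂ) where
  atlas := {chartZero, chartInfty}
  chartAt p := if p = OnePoint.infty then chartInfty else chartZero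
  mem_chart_source p := by
    induction p using OnePoint.rec with
    | infty => simp [chartInfty, chartZero, sphereInvHomeo, sphereInv_infty]
    | coe z => simp [chartZero]
  chart_mem_atlas p := by
    split_ifs <;> simp

theorem sphereTransition {z : ℂ} (hz : z ≠ 0) :
    chartZero (sphereInv (z : OnePoint ℂ)) = z⁻¹ := by
  have h := chartZero.right_inv (x := z⁻¹) (by simp [chartZero])
  have h' : chartZero.symm z⁻¹ = ((z⁻¹ : ℂ) : OnePoint ℂ) := by simp [chartZero]
  rw [h'] at h
  rw [sphereInv_coe, if_neg hz, h]

/-- The Riemann sphere is a Riemann surface. -/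
instance : IsManifold 𝓘(ℂ) ω (OnePoint ℂ) := by
  have hsymm : ∀ z : ℂ, chartZero.symm z = (z : OnePoint ℂ) := fun z => by simp [chartZero]
  have hInf : ∀ p, chartInfty p = chartZero (sphereInv p) := fun p => rfl
  have hInfs : ∀ z, chartInfty.symm z = sphereInv (chartZero.symm z) := fun z => rfl
  have hsrc : ∀ p, p ∈ chartZero.source ↔ p ≠ OnePoint.infty := fun p => by
    induction p using OnePoint.rec with
    | infty => simp [chartZero]
    | coe z => simp [chartZero]
  have hsrcI : ∀ p, p ∈ chartInfty.source ↔ sphereInv p ≠ OnePoint.infty := fun p => by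
    rw [← hsrc]; simp [chartInfty, sphereInvHomeo]
  have hne : ∀ z : ℂ, sphereInv (z : OnePoint ℂ) ≠ OnePoint.infty → z ≠ 0 := by
    intro z h h0
    exact h (by simp [sphereInv_coe, h0])
  have hinv : ∀ s : Set ℂ, (∀ z ∈ s, z ≠ 0) → ContDiffOn ℂ ω (fun z : ℂ => z⁻¹) s :=
    fun s hs z hz => (contDiffAt_inv ℂ (hs z hz)).contDiffWithinAt
  have hid : ∀ (e : OpenPartialHomeomorph (OnePoint ℂ) ℂ) (s : Set ℂ), s ⊆ e.target →
      ContDiffOn ℂ ω (fun z => e (e.symm z)) s :=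
    fun e s hs => contDiffOn_id.congr fun z hz => e.right_inv (hs hz)
  refine isManifold_of_contDiffOn 𝓘(ℂ) ω (OnePoint ℂ) ?_
  rintro e e' (rfl | rfl) (rfl | rfl) <;>
    simp only [modelWithCornersSelf_coe, modelWithCornersSelf_coe_symm, Function.id_comp,
      Function.comp_id, Set.preimage_id, Set.range_id, Set.inter_univ, CompTriple.comp_eq,
      OpenPartialHomeomorph.coe_trans, OpenPartialHomeomorph.trans_source]
  · exact hid chartZero _ Set.inter_subset_left
  · have key : ∀ z ∈ chartZero.symm.source ∩ chartZero.symm ⁻¹' chartInfty.source, z ≠ 0 := by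
      rintro z ⟨-, hz⟩
      rw [Set.mem_preimage, hsymm, hsrcI] at hz
      exact hne z hz
    refine (hinv _ key).congr fun z hz => ?_
    rw [Function.comp_apply, hInf, hsymm, sphereTransition (key z hz)]
  · have key : ∀ z ∈ chartInfty.symm.source ∩ chartInfty.symm ⁻¹' chartZero.source, z ≠ 0 := by
      rintro z ⟨-, hz⟩
      rw [Set.mem_preimage, hInfs, hsymm, hsrc] at hz
      exact hne z hz
    refine (hinv _ key).congr fun z hz => ?_
    rw [Function.comp_apply, hInfs, hsymm, sphereTransition (key z hz)]
  · exact hid chartInfty _ Set.inter_subset_left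

/-! ## The complexified Lorentz space and Wirtinger derivatives -/

/-- The complex bilinear extension of the Lorentz metric `-x₀y₀ + x₁y₁ + ⋯ + xₘyₘ`. -/
def lorentz {m : ℕ} (x y : Fin (m + 1) → ℂ) : ℂ :=
  -(x 0 * y 0) + ∑ i : Fin m, x i.succ * y i.succ

/-- `∂f/∂z = (f_u - i f_v) / 2`, where `z = u + i v`. -/
def dZ {k : ℕ} (f : ℂ → Fin k → ℂ) (z : ℂ) : Fin k → ℂ :=
  (1 / 2 : ℂ) • (fderiv ℝ f z 1 - Complex.I • fderiv ℝ f z Complex.I)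

/-- `∂f/∂z̄ = (f_u + i f_v) / 2`, where `z = u + i v`. -/
def dZbar {k : ℕ} (f : ℂ → Fin k → ℂ) (z : ℂ) : Fin k → ℂ :=
  (1 / 2 : ℂ) • (fderiv ℝ f z 1 + Complex.I • fderiv ℝ f z Complex.I)

/-! ## The canonical lift, the normal bundle and the normal connection

Here `y` is a conformal immersion of an open subset of `ℂ` into the unit sphere of `ℝᵐ`, and `Y`
is its canonical lift, so that on the domain `⟨Y, Y⟩ = ⟨Y, Y_z⟩ = ⟨Y_z, Y_z⟩ = 0` and
`⟨Y_z, Y_z̄⟩ = 1/2`. -/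

/-- A map to `ℝᵐ` regarded as a map to `ℂᵐ`. -/
def complexify {m : ℕ} (y : ℂ → EuclideanSpace ℝ (Fin m)) (z : ℂ) : Fin m → ℂ :=
  fun i => (y z i : ℂ)

/-- The conformal factor `e^{2ω} = 2⟨y_z, y_z̄⟩`. -/
def conformalFactor {m : ℕ} (y : ℂ → EuclideanSpace ℝ (Fin m)) (z : ℂ) : ℝ :=
  (2 * ∑ i : Fin m, dZ (complexify y) z i * dZbar (complexify y) z i).re

/-- The canonical lift `Y = e^{-ω} (1, y)` into the forward light cone. -/
def canonicalLift {m : ℕ} (y : ℂ → EuclideanSpace ℝ (Fin m)) (z : ℂ) : Fin (m + 1) → ℂ :=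
  (((√(conformalFactor y z))⁻¹ : ℝ) : ℂ) • Matrix.vecCons 1 (complexify y z)

/-- The fibre at `z` of `V_ℂ`, the complex span of `Y, Y_z, Y_z̄, Y_{zz̄}`. -/
def tangentialSpace {m : ℕ} (Y : ℂ → Fin (m + 1) → ℂ) (z : ℂ) :
    Submodule ℂ (Fin (m + 1) → ℂ) :=
  Submodule.span ℂ {Y z, dZ Y z, dZbar Y z, dZ (dZbar Y) z}

/-- The fibre at `z` of the complexified normal bundle `V_ℂ^⊥`. -/
def normalSpace {m : ℕ} (Y : ℂ → Fin (m + 1) → ℂ) (z : ℂ) :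
    Submodule ℂ (Fin (m + 1) → ℂ) where
  carrier := {v | ∀ w ∈ tangentialSpace Y z, lorentz v w = 0}
  zero_mem' := fun w _ => by simp [lorentz]
  add_mem' := by
    intro a b ha hb w hw
    have h : lorentz (a + b) w = lorentz a w + lorentz b w := by
      simp only [lorentz, Pi.add_apply, add_mul, Finset.sum_add_distrib]; ring
    rw [h, ha w hw, hb w hw, add_zero]
  smul_mem' := by
    intro c a ha w hw
    have h : lorentz (c • a) w = c * lorentz a w := by
      simp only [lorentz, Pi.smul_apply, smul_eq_mul, mul_add, Finset.mul_sum, mul_assoc, mul_neg]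
    rw [h, ha w hw, mul_zero]

/-- The section `N` of `V_ℂ` with `⟨N, Y⟩ = -1` and
`⟨N, Y_z⟩ = ⟨N, Y_z̄⟩ = ⟨N, N⟩ = 0`. -/
def sectionN {m : ℕ} (Y : ℂ → Fin (m + 1) → ℂ) (z : ℂ) : Fin (m + 1) → ℂ :=
  (2 : ℂ) • dZ (dZbar Y) z + (2 * lorentz (dZ (dZbar Y) z) (dZ (dZbar Y) z)) • Y z

/-- The orthogonal projection onto `V_ℂ^⊥`, written in the frame `Y, Y_z, Y_z̄, N` of `V_ℂ`. -/
def normalPart {m : ℕ} (Y : ℂ → Fin (m + 1) → ℂ) (z : ℂ) (v : Fin (m + 1) → ℂ) :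
    Fin (m + 1) → ℂ :=
  v + lorentz v (sectionN Y z) • Y z + lorentz v (Y z) • sectionN Y z
    - (2 * lorentz v (dZbar Y z)) • dZ Y z - (2 * lorentz v (dZ Y z)) • dZbar Y z

/-- The normal connection `D_z`. -/
def normalDZ {m : ℕ} (Y ψ : ℂ → Fin (m + 1) → ℂ) (z : ℂ) : Fin (m + 1) → ℂ :=
  normalPart Y z (dZ ψ z)

/-- The normal connection `D_z̄`. -/
def normalDZbar {m : ℕ} (Y ψ : ℂ → Fin (m + 1) → ℂ) (z : ℂ) : Fin (m + 1) → ℂ :=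
  normalPart Y z (dZbar ψ z)

/-- The conformal Hopf differential `κ`, the normal part of `Y_zz`. -/
def hopf {m : ℕ} (Y : ℂ → Fin (m + 1) → ℂ) (z : ℂ) : Fin (m + 1) → ℂ :=
  normalPart Y z (dZ (dZ Y) z)

/-- The Schwarzian `s`, determined by `Y_zz = -(s/2) Y + κ`. -/
def schwarzian {m : ℕ} (Y : ℂ → Fin (m + 1) → ℂ) (z : ℂ) : ℂ :=
  2 * lorentz (dZ (dZ Y) z) (sectionN Y z)

/-! ## Surfaces in spheres -/

section Surfaces

variable {M : Type*} [TopologicalSpace M] [ChartedSpace ℂ M] {m : ℕ}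

/-- The canonical lift of `y` with respect to the complex coordinate `e` of `M`, as a function of
`z ∈ e.target`. -/
def liftIn (y : M → Metric.sphere (0 : EuclideanSpace ℝ (Fin m)) 1)
    (e : OpenPartialHomeomorph M ℂ) : ℂ → Fin (m + 1) → ℂ :=
  canonicalLift fun z => (y (e.symm z) : EuclideanSpace ℝ (Fin m))

/-- `y` is a smooth conformal immersion. -/
def IsConformalImmersion (y : M → Metric.sphere (0 : EuclideanSpace ℝ (Fin m)) 1) : Prop :=
  ContMDiff 𝓘(ℝ, ℂ) 𝓘(ℝ, EuclideanSpace ℝ (Fin m)) ∞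
      (fun p => (y p : EuclideanSpace ℝ (Fin m))) ∧
    ∀ e ∈ IsManifold.maximalAtlas 𝓘(ℂ) ω M, ∀ z ∈ e.target,
      ConformalAt (fun w => (y (e.symm w) : EuclideanSpace ℝ (Fin m))) z

/-- `y` is a Willmore surface: a conformal immersion with `D_z̄ D_z̄ κ + (s̄/2) κ = 0` with respect
to every complex coordinate. -/
def IsWillmore (y : M → Metric.sphere (0 : EuclideanSpace ℝ (Fin m)) 1) : Prop :=
  IsConformalImmersion y ∧
    ∀ e ∈ IsManifold.maximalAtlas 𝓘(ℂ) ω M, ∀ z ∈ e.target,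
      normalDZbar (liftIn y e) (normalDZbar (liftIn y e) (hopf (liftIn y e))) z
        + (star (schwarzian (liftIn y e) z) / 2) • hopf (liftIn y e) z = 0

/-- The Hopf differential is isotropic: `⟨κ, κ⟩ = 0`. -/
def HasIsotropicHopf (y : M → Metric.sphere (0 : EuclideanSpace ℝ (Fin m)) 1) : Prop :=
  ∀ e ∈ IsManifold.maximalAtlas 𝓘(ℂ) ω M, ∀ z ∈ e.target,
    lorentz (hopf (liftIn y e) z) (hopf (liftIn y e) z) = 0

/-- `y` is an S-Willmore surface: it is Willmore, and `D_z̄ κ` is everywhere parallel to `κ`. -/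
def IsSWillmore (y : M → Metric.sphere (0 : EuclideanSpace ℝ (Fin m)) 1) : Prop :=
  IsWillmore y ∧
    ∀ e ∈ IsManifold.maximalAtlas 𝓘(ℂ) ω M, ∀ z ∈ e.target,
      ¬ LinearIndependent ℂ
        ![hopf (liftIn y e) z, normalDZbar (liftIn y e) (hopf (liftIn y e)) z]

/-- `y` is totally isotropic: `⟨∂_z^j Y, ∂_z^k Y⟩ = 0` for all positive `j` and `k`. -/
def IsTotallyIsotropic (y : M → Metric.sphere (0 : EuclideanSpace ℝ (Fin m)) 1) : Prop :=
  ∀ e ∈ IsManifold.maximalAtlas 𝓘(ℂ) ω M, ∀ z ∈ e.target, ∀ j k : ℕ, 0 < j → 0 < k →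
    lorentz (dZ^[j] (liftIn y e) z) (dZ^[k] (liftIn y e) z) = 0

/-- `y` is full: its image lies in no proper round subsphere, that is, in no affine hyperplane of
the Euclidean space. -/
def IsFull (y : M → Metric.sphere (0 : EuclideanSpace ℝ (Fin m)) 1) : Prop :=
  affineSpan ℝ (Set.range fun p => (y p : EuclideanSpace ℝ (Fin m))) = ⊤

end Surfaces

/-- `{E₁, E₂}` is a smooth isotropic frame, over the open set `U`, of the normal bundle of the
surface with canonical lift `Y`, adapted to `κ` and to the normal connection. -/
structure IsAdaptedIsotropicFrame {m : ℕ} (Y : ℂ → Fin (m + 1) → ℂ) (U : Set ℂ)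
    (E : Fin 2 → ℂ → Fin (m + 1) → ℂ) : Prop where
  smooth : ∀ i, ContDiffOn ℝ ∞ (E i) U
  /-- `E₁, E₂, Ē₁, Ē₂` span the complexified normal bundle (they are linearly independent by the
  two following fields). -/
  span_eq : ∀ z ∈ U, Submodule.span ℂ
    (Set.range (fun i => E i z) ∪ Set.range (fun i => star (E i z))) = normalSpace Y z
  isotropic : ∀ z ∈ U, ∀ i j, lorentz (E i z) (E j z) = 0
  unitary : ∀ z ∈ U, ∀ i j, lorentz (E i z) (star (E j z)) = if i = j then 1 else 0
  hopf_mem : ∀ z ∈ U, hopf Y z ∈ Submodule.span ℂ (Set.range fun i => E i z)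
  normalDZ_hopf_mem : ∀ z ∈ U,
    normalDZ Y (hopf Y) z ∈ Submodule.span ℂ (Set.range fun i => E i z)
  normalDZbar_hopf_mem : ∀ z ∈ U,
    normalDZbar Y (hopf Y) z ∈ Submodule.span ℂ (Set.range fun i => E i z)
  normalDZ_mem : ∀ z ∈ U, ∀ i,
    normalDZ Y (E i) z ∈ Submodule.span ℂ (Set.range fun j => E j z)
  normalDZbar_mem : ∀ z ∈ U, ∀ i,
    normalDZbar Y (E i) z ∈ Submodule.span ℂ (Set.range fun j => E j z)
  /-- The other diagonal block of the normal connection. -/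
  normalDZ_conj_mem : ∀ z ∈ U, ∀ i,
    normalDZ Y (fun w => star (E i w)) z ∈ Submodule.span ℂ (Set.range fun j => star (E j z))
  normalDZbar_conj_mem : ∀ z ∈ U, ∀ i,
    normalDZbar Y (fun w => star (E i w)) z ∈ Submodule.span ℂ (Set.range fun j => star (E j z))

end WillmoreSurface

end

/-!
Work with the canonical lift `Y` in one complex coordinate. Differentiating `⟨κ, κ⟩ = 0` and using
the Willmore equation `D_z̄ D_z̄ κ = -(s̄/2) κ`, one finds that `κ` and `D_z̄ κ` are isotropic and
mutually orthogonal, and that `D_z κ` is orthogonal to `κ`. The only product left is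
`⟨D_z κ, D_z̄ κ⟩`. The Ricci equation (`IsLift.ricci`) shows that it is holomorphic
(`IsIsotropicWillmoreLift.pdzbar_quartic`), and under a change of coordinate it transforms as the
coefficient of a quartic differential (`IsCoordinateChange.quartic_eq`). On the sphere such a
differential vanishes, by Liouville's theorem (`IsWillmore.quartic_eq_zero`).

Hence, where `κ` and `D_z̄ κ` are independent, the plane `L` that they span is isotropic and the
first derivatives of its sections are orthogonal to it. In `S⁶` the normal bundle has rank four, so
that `L` is a maximal isotropic plane; it is therefore parallel and contains `D_z κ`. A unitary
frame of `L` is the frame that is looked for, and the frame `Ē₁, Ē₂` of `L̄` is obtained by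
conjugation.

The remaining difficulty is to extend `L` smoothly over the points where `κ ∧ D_z̄ κ` vanishes. By
the Willmore equation this bivector is `D_z̄`-parallel, so that in the ambient space it solves a
linear equation `∂f/∂z̄ = M f` (`IsIsotropicWillmoreLift.pdzbar_hopfWedge`). A solution of such an
equation either vanishes near a given point `x` or equals `(z - x)ⁿ g` with `g` smooth and
`g x ≠ 0` (`eventually_eq_zero_or_exists_order`): a solution vanishing at `x` is divisible by
`z - x` and the quotient solves the same equation, while an `L²` estimate for `∂/∂z̄` excludes
infinite divisibility of a solution that is not zero near `x`. As the sphere is connected and `y`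
is not S-Willmore, the first alternative never occurs (`IsWillmore.exists_order_hopfWedge`), and
two columns of the bivector `g` span the extension of `L`
(`IsIsotropicWillmoreLift.exists_preFrame`).

Given such a frame, `Y, Y_z, E₁, E₂` span an isotropic bundle of rank four which is preserved by
`∂/∂z`, and all `∂_z^j Y` with `j ≥ 1` lie in it; this is total isotropy
(`IsAdaptedIsotropicFrame.lorentz_iterate_dZ`). If the image of `y` lies in a hyperplane, a real
constant vector `v` is orthogonal to `Y`, hence also to `κ` and `D_z̄ κ`, to `L` and to `L̄`; as `v`
is itself normal, it vanishes (`IsAdaptedIsotropicFrame.eq_zero_of_lorentz_eq_zero`).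
-/

noncomputable section

namespace WillmoreSurface

/-! ### Wirtinger derivatives -/

section Wirtinger

variable {E F G : Type*} [NormedAddCommGroup E] [NormedSpace ℂ E]
  [NormedAddCommGroup F] [NormedSpace ℂ F] [NormedAddCommGroup G] [NormedSpace ℂ G]

/-- The Wirtinger derivative `∂f/∂z` of a map into a complex normed space. -/
def pdz (f : ℂ → E) (z : ℂ) : E :=
  (1 / 2 : ℂ) • (fderiv ℝ f z 1 - Complex.I • fderiv ℝ f z Complex.I)

/-- The Wirtinger derivative `∂f/∂z̄` of a map into a complex normed space. -/
def pdzbar (f : ℂ → E) (z : ℂ) : E :=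
  (1 / 2 : ℂ) • (fderiv ℝ f z 1 + Complex.I • fderiv ℝ f z Complex.I)

theorem fderiv_apply_eq_pdz_add_pdzbar (f : ℂ → E) (z w : ℂ) :
    fderiv ℝ f z w = w • pdz f z + star w • pdzbar f z := by
  have hw : w = (w.re : ℝ) • (1 : ℂ) + (w.im : ℝ) • Complex.I := by
    simp [Complex.re_add_im]
  have h1 : fderiv ℝ f z w = (w.re : ℂ) • fderiv ℝ f z 1 + (w.im : ℂ) • fderiv ℝ f z Complex.I := by
    conv_lhs => rw [hw]
    rw [map_add, map_smul, map_smul, Complex.coe_smul, Complex.coe_smul]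
  have hs : star w = (w.re : ℂ) - w.im * Complex.I := by
    apply Complex.ext <;> simp
  have hw' : w = (w.re : ℂ) + w.im * Complex.I := (Complex.re_add_im w).symm
  have h2 : w • pdz f z + star w • pdzbar f z
      = ((w + star w) / 2) • fderiv ℝ f z 1
        + (Complex.I * (star w - w) / 2) • fderiv ℝ f z Complex.I := by
    unfold pdz pdzbar
    module
  rw [h2, h1]
  congr 2
  · rw [hs]; nth_rewrite 2 [hw']; ring
  · rw [show star w - w = -2 * (w.im * Complex.I) by rw [hs]; linear_combination -hw']
    linear_combination (w.im : ℂ) * Complex.I_sq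

theorem pdz_eq_of_hasFDerivAt {f : ℂ → E} {z : ℂ} {L : ℂ →L[ℝ] E} {a b : E}
    (h : HasFDerivAt f L z) (hL : ∀ w, L w = w • a + star w • b) :
    pdz f z = a := by
  unfold pdz
  rw [h.fderiv, hL, hL]
  simp [smul_smul, smul_add]
  module

theorem pdzbar_eq_of_hasFDerivAt {f : ℂ → E} {z : ℂ} {L : ℂ →L[ℝ] E} {a b : E}
    (h : HasFDerivAt f L z) (hL : ∀ w, L w = w • a + star w • b) :
    pdzbar f z = b := by
  unfold pdzbar
  rw [h.fderiv, hL, hL]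
  simp [smul_smul, smul_add]
  module

theorem pdz_congr {f g : ℂ → E} {z : ℂ} (h : f =ᶠ[nhds z] g) : pdz f z = pdz g z := by
  unfold pdz; rw [h.fderiv_eq]

theorem pdzbar_congr {f g : ℂ → E} {z : ℂ} (h : f =ᶠ[nhds z] g) : pdzbar f z = pdzbar g z := by
  unfold pdzbar; rw [h.fderiv_eq]

theorem pdz_congr_on {f g : ℂ → E} {Ω : Set ℂ} (hΩ : IsOpen Ω) (h : Set.EqOn f g Ω) :
    Set.EqOn (pdz f) (pdz g) Ω :=
  fun _ hz => pdz_congr (h.eventuallyEq_of_mem (hΩ.mem_nhds hz))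

theorem pdzbar_congr_on {f g : ℂ → E} {Ω : Set ℂ} (hΩ : IsOpen Ω) (h : Set.EqOn f g Ω) :
    Set.EqOn (pdzbar f) (pdzbar g) Ω :=
  fun _ hz => pdzbar_congr (h.eventuallyEq_of_mem (hΩ.mem_nhds hz))

theorem pdzbar_eventuallyEq {f g : ℂ → E} {z : ℂ} (h : f =ᶠ[nhds z] g) :
    pdzbar f =ᶠ[nhds z] pdzbar g :=
  h.eventuallyEq_nhds.mono fun _ hw => pdzbar_congr hw

@[simp] theorem pdz_const (c : E) (z : ℂ) : pdz (fun _ => c) z = 0 := by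
  simp [pdz]

@[simp] theorem pdzbar_const (c : E) (z : ℂ) : pdzbar (fun _ => c) z = 0 := by
  simp [pdzbar]

theorem pdz_add {f g : ℂ → E} {z : ℂ} (hf : DifferentiableAt ℝ f z)
    (hg : DifferentiableAt ℝ g z) : pdz (fun w => f w + g w) z = pdz f z + pdz g z := by
  unfold pdz; rw [fderiv_fun_add hf hg]; simp; module

theorem pdzbar_add {f g : ℂ → E} {z : ℂ} (hf : DifferentiableAt ℝ f z)
    (hg : DifferentiableAt ℝ g z) : pdzbar (fun w => f w + g w) z = pdzbar f z + pdzbar g z := by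
  unfold pdzbar; rw [fderiv_fun_add hf hg]; simp; module

theorem pdz_sub {f g : ℂ → E} {z : ℂ} (hf : DifferentiableAt ℝ f z)
    (hg : DifferentiableAt ℝ g z) : pdz (fun w => f w - g w) z = pdz f z - pdz g z := by
  unfold pdz; rw [fderiv_fun_sub hf hg]; simp; module

theorem pdzbar_sub {f g : ℂ → E} {z : ℂ} (hf : DifferentiableAt ℝ f z)
    (hg : DifferentiableAt ℝ g z) : pdzbar (fun w => f w - g w) z = pdzbar f z - pdzbar g z := by
  unfold pdzbar; rw [fderiv_fun_sub hf hg]; simp; module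

theorem pdzbar_clm {f : ℂ → E} {z : ℂ} (L : E →L[ℂ] F) (hf : DifferentiableAt ℝ f z) :
    pdzbar (fun w => L (f w)) z = L (pdzbar f z) := by
  have h := (L.restrictScalars ℝ).hasFDerivAt.comp z hf.hasFDerivAt
  refine pdzbar_eq_of_hasFDerivAt (a := L (pdz f z)) h fun w => ?_
  simp [fderiv_apply_eq_pdz_add_pdzbar]

theorem pdz_bilin {f : ℂ → E} {g : ℂ → F} {z : ℂ} (B : E →L[ℂ] F →L[ℂ] G)
    (hf : DifferentiableAt ℝ f z) (hg : DifferentiableAt ℝ g z) :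
    pdz (fun w => B (f w) (g w)) z = B (pdz f z) (g z) + B (f z) (pdz g z) := by
  have h := (B.bilinearRestrictScalars ℝ).hasFDerivAt_of_bilinear hf.hasFDerivAt hg.hasFDerivAt
  refine pdz_eq_of_hasFDerivAt (b := B (pdzbar f z) (g z) + B (f z) (pdzbar g z)) h fun w => ?_
  simp [fderiv_apply_eq_pdz_add_pdzbar, ContinuousLinearMap.precompR,
    ContinuousLinearMap.precompL]
  module

theorem pdzbar_bilin {f : ℂ → E} {g : ℂ → F} {z : ℂ} (B : E →L[ℂ] F →L[ℂ] G)
    (hf : DifferentiableAt ℝ f z) (hg : DifferentiableAt ℝ g z) :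
    pdzbar (fun w => B (f w) (g w)) z = B (pdzbar f z) (g z) + B (f z) (pdzbar g z) := by
  have h := (B.bilinearRestrictScalars ℝ).hasFDerivAt_of_bilinear hf.hasFDerivAt hg.hasFDerivAt
  refine pdzbar_eq_of_hasFDerivAt (a := B (pdz f z) (g z) + B (f z) (pdz g z)) h fun w => ?_
  simp [fderiv_apply_eq_pdz_add_pdzbar, ContinuousLinearMap.precompR,
    ContinuousLinearMap.precompL]
  module

theorem pdz_smul {c : ℂ → ℂ} {f : ℂ → E} {z : ℂ} (hc : DifferentiableAt ℝ c z)
    (hf : DifferentiableAt ℝ f z) :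
    pdz (fun w => c w • f w) z = pdz c z • f z + c z • pdz f z :=
  pdz_bilin (ContinuousLinearMap.lsmul ℂ ℂ) hc hf

theorem pdzbar_smul {c : ℂ → ℂ} {f : ℂ → E} {z : ℂ} (hc : DifferentiableAt ℝ c z)
    (hf : DifferentiableAt ℝ f z) :
    pdzbar (fun w => c w • f w) z = pdzbar c z • f z + c z • pdzbar f z :=
  pdzbar_bilin (ContinuousLinearMap.lsmul ℂ ℂ) hc hf

theorem pdzbar_mul {c f : ℂ → ℂ} {z : ℂ} (hc : DifferentiableAt ℝ c z)
    (hf : DifferentiableAt ℝ f z) :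
    pdzbar (fun w => c w * f w) z = pdzbar c z * f z + c z * pdzbar f z :=
  pdzbar_smul hc hf

theorem pdzbar_holomorphic {f : ℂ → E} {z : ℂ} (hf : DifferentiableAt ℂ f z) :
    pdzbar f z = 0 := by
  refine pdzbar_eq_of_hasFDerivAt (a := deriv f z) (hf.hasFDerivAt.restrictScalars ℝ) fun w => ?_
  simp

/-- A real differentiable map satisfying the Cauchy–Riemann equation is holomorphic. -/
theorem hasDerivAt_of_pdzbar_eq_zero {f : ℂ → E} {z : ℂ} (hf : DifferentiableAt ℝ f z)
    (h : pdzbar f z = 0) : HasDerivAt f (pdz f z) z := by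
  rw [hasDerivAt_iff_hasFDerivAt]
  refine hasFDerivAt_of_restrictScalars ℝ hf.hasFDerivAt ?_
  ext1 w
  rw [fderiv_apply_eq_pdz_add_pdzbar, h]
  simp

theorem pdz_comp_holomorphic {f : ℂ → E} {φ : ℂ → ℂ} {z : ℂ}
    (hf : DifferentiableAt ℝ f (φ z)) (hφ : DifferentiableAt ℂ φ z) :
    pdz (fun w => f (φ w)) z = deriv φ z • pdz f (φ z) := by
  have h := hf.hasFDerivAt.comp z (hφ.hasFDerivAt.restrictScalars ℝ)
  refine pdz_eq_of_hasFDerivAt (b := star (deriv φ z) • pdzbar f (φ z)) h fun w => ?_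
  simp [fderiv_apply_eq_pdz_add_pdzbar, smul_smul]

theorem pdzbar_comp_holomorphic {f : ℂ → E} {φ : ℂ → ℂ} {z : ℂ}
    (hf : DifferentiableAt ℝ f (φ z)) (hφ : DifferentiableAt ℂ φ z) :
    pdzbar (fun w => f (φ w)) z = star (deriv φ z) • pdzbar f (φ z) := by
  have h := hf.hasFDerivAt.comp z (hφ.hasFDerivAt.restrictScalars ℝ)
  refine pdzbar_eq_of_hasFDerivAt (a := deriv φ z • pdz f (φ z)) h fun w => ?_
  simp [fderiv_apply_eq_pdz_add_pdzbar, smul_smul]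

theorem contDiffOn_pdz {f : ℂ → E} {Ω : Set ℂ} (hΩ : IsOpen Ω) (hf : ContDiffOn ℝ ∞ f Ω) :
    ContDiffOn ℝ ∞ (pdz f) Ω := by
  have h : ContDiffOn ℝ ∞ (fderiv ℝ f) Ω := hf.fderiv_of_isOpen hΩ (by simp)
  unfold pdz
  exact ((h.clm_apply contDiffOn_const).sub
    ((h.clm_apply contDiffOn_const).const_smul Complex.I)).const_smul (1 / 2 : ℂ)

theorem contDiffOn_pdzbar {f : ℂ → E} {Ω : Set ℂ} (hΩ : IsOpen Ω) (hf : ContDiffOn ℝ ∞ f Ω) :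
    ContDiffOn ℝ ∞ (pdzbar f) Ω := by
  have h : ContDiffOn ℝ ∞ (fderiv ℝ f) Ω := hf.fderiv_of_isOpen hΩ (by simp)
  unfold pdzbar
  exact ((h.clm_apply contDiffOn_const).add
    ((h.clm_apply contDiffOn_const).const_smul Complex.I)).const_smul (1 / 2 : ℂ)

theorem contDiff_pdz {f : ℂ → E} (hf : ContDiff ℝ ∞ f) : ContDiff ℝ ∞ (pdz f) :=
  contDiffOn_univ.1 (contDiffOn_pdz isOpen_univ hf.contDiffOn)

theorem contDiff_pdzbar {f : ℂ → E} (hf : ContDiff ℝ ∞ f) : ContDiff ℝ ∞ (pdzbar f) :=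
  contDiffOn_univ.1 (contDiffOn_pdzbar isOpen_univ hf.contDiffOn)

theorem pdz_pdzbar_comm {f : ℂ → E} {Ω : Set ℂ} (hΩ : IsOpen Ω) (hf : ContDiffOn ℝ ∞ f Ω)
    {z : ℂ} (hz : z ∈ Ω) : pdz (pdzbar f) z = pdzbar (pdz f) z := by
  have hfz : ContDiffAt ℝ ∞ f z := hf.contDiffAt (hΩ.mem_nhds hz)
  have h : DifferentiableAt ℝ (fderiv ℝ f) z :=
    ((hf.fderiv_of_isOpen hΩ (m := ∞) (by simp)).contDiffAt (hΩ.mem_nhds hz)).differentiableAt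
      (by simp)
  have hsym : IsSymmSndFDerivAt ℝ f z := hfz.isSymmSndFDerivAt (by
    rw [minSmoothness_of_isRCLikeNormedField]
    exact WithTop.coe_le_coe.2 (le_top (α := ℕ∞)))
  have e1 : ∀ v w : ℂ, fderiv ℝ (fun x => fderiv ℝ f x v) z w = fderiv ℝ (fderiv ℝ f) z w v := by
    intro v w
    rw [fderiv_clm_apply h (by fun_prop)]
    simp
  have d : ∀ v : ℂ, DifferentiableAt ℝ (fun x => fderiv ℝ f x v) z := fun v =>
    h.clm_apply (by fun_prop)
  have d' : DifferentiableAt ℝ (fun x => Complex.I • fderiv ℝ f x Complex.I) z :=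
    (d Complex.I).const_smul _
  have e2 : pdz (pdzbar f) z = (1 / 2 : ℂ) • (pdz (fun x => fderiv ℝ f x 1) z
      + Complex.I • pdz (fun x => fderiv ℝ f x Complex.I) z) := by
    have := pdz_smul (c := fun _ => (1 / 2 : ℂ)) (f := fun x => fderiv ℝ f x 1
      + Complex.I • fderiv ℝ f x Complex.I) (z := z) (by fun_prop)
      ((d 1).add d')
    rw [pdz_const, zero_smul, zero_add, pdz_add (d 1) d',
      pdz_smul (c := fun _ => Complex.I) (by fun_prop) (d Complex.I),
      pdz_const, zero_smul, zero_add] at this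
    exact this
  have e3 : pdzbar (pdz f) z = (1 / 2 : ℂ) • (pdzbar (fun x => fderiv ℝ f x 1) z
      - Complex.I • pdzbar (fun x => fderiv ℝ f x Complex.I) z) := by
    have := pdzbar_smul (c := fun _ => (1 / 2 : ℂ)) (f := fun x => fderiv ℝ f x 1
      - Complex.I • fderiv ℝ f x Complex.I) (z := z) (by fun_prop)
      ((d 1).sub d')
    rw [pdzbar_const, zero_smul, zero_add, pdzbar_sub (d 1) d',
      pdzbar_smul (c := fun _ => Complex.I) (by fun_prop) (d Complex.I),
      pdzbar_const, zero_smul, zero_add] at this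
    exact this
  rw [e2, e3]
  simp only [pdz, pdzbar, e1]
  rw [hsym 1 Complex.I]
  module

theorem pdz_star {k : ℕ} {f : ℂ → Fin k → ℂ} {z : ℂ} (hf : DifferentiableAt ℝ f z) :
    pdz (fun w => star (f w)) z = star (pdzbar f z) := by
  have h := (starL' ℝ (A := Fin k → ℂ)).toContinuousLinearMap.hasFDerivAt.comp z hf.hasFDerivAt
  refine pdz_eq_of_hasFDerivAt (b := star (pdz f z)) h fun w => ?_
  simp [fderiv_apply_eq_pdz_add_pdzbar]
  rw [add_comm]

theorem pdzbar_star {k : ℕ} {f : ℂ → Fin k → ℂ} {z : ℂ} (hf : DifferentiableAt ℝ f z) :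
    pdzbar (fun w => star (f w)) z = star (pdz f z) := by
  have h := (starL' ℝ (A := Fin k → ℂ)).toContinuousLinearMap.hasFDerivAt.comp z hf.hasFDerivAt
  refine pdzbar_eq_of_hasFDerivAt (a := star (pdzbar f z)) h fun w => ?_
  simp [fderiv_apply_eq_pdz_add_pdzbar]
  rw [add_comm]

end Wirtinger

/-! ### Division by the coordinate -/

theorem eq_of_eventually_eq_punctured {X : Type*} [TopologicalSpace X] [T2Space X] {f g : ℂ → X}
    {x : ℂ} (hf : ContinuousAt f x) (hg : ContinuousAt g x)
    (h : ∀ᶠ z in nhdsWithin x {x}ᶜ, f z = g z) : f x = g x :=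
  tendsto_nhds_unique (hf.tendsto.mono_left nhdsWithin_le_nhds)
    ((hg.tendsto.mono_left nhdsWithin_le_nhds).congr' (h.mono fun _ hz => hz.symm))

/-- Differentiation under the integral sign replaces `F` by its derivative and `k` by `k + 1`, so
that the induction on the order of differentiability has to cover all `k` and all targets. -/
theorem contDiff_integral_pow_smul_aux (n : ℕ) :
    ∀ {E : Type} [NormedAddCommGroup E] [NormedSpace ℝ E] (k : ℕ) {F : ℂ → E},
      ContDiff ℝ ∞ F → ContDiff ℝ n (fun z => ∫ t in (0 : ℝ)..1, t ^ k • F (t • z)) := by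
  have key : ∀ {E : Type} [NormedAddCommGroup E] [NormedSpace ℝ E] (k : ℕ) {F : ℂ → E},
      ContDiff ℝ ∞ F → ∀ z, HasFDerivAt (fun z => ∫ t in (0 : ℝ)..1, t ^ k • F (t • z))
        (∫ t in (0 : ℝ)..1, t ^ (k + 1) • fderiv ℝ F (t • z)) z := by
    intro E _ _ k F hF z
    have hF' : Continuous (fderiv ℝ F) := hF.continuous_fderiv (by simp)
    obtain ⟨C, hC⟩ := (isCompact_closedBall (0 : ℂ) (‖z‖ + 1)).exists_bound_of_continuousOn
      hF'.continuousOn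
    refine (intervalIntegral.hasFDerivAt_integral_of_dominated_of_fderiv_le
      (F := fun z (t : ℝ) => t ^ k • F (t • z))
      (F' := fun z (t : ℝ) => t ^ (k + 1) • fderiv ℝ F (t • z))
      (bound := fun _ => C) (Metric.ball_mem_nhds z one_pos) ?_ ?_ ?_ ?_ ?_ ?_)
    · refine Filter.Eventually.of_forall fun w => Continuous.aestronglyMeasurable ?_
      have := hF.continuous
      fun_prop
    · refine Continuous.intervalIntegrable ?_ _ _
      have := hF.continuous
      fun_prop
    · have : SecondCountableTopologyEither ℝ (ℂ →L[ℝ] E) :=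
        secondCountableTopologyEither_of_left _ _
      have h0 : Continuous fun t : ℝ => t ^ (k + 1) • fderiv ℝ F (t • z) := by fun_prop
      exact h0.aestronglyMeasurable
    · refine Filter.Eventually.of_forall fun t ht w hw => ?_
      rw [Set.uIoc_of_le zero_le_one] at ht
      have h1 : t • w ∈ Metric.closedBall (0 : ℂ) (‖z‖ + 1) := by
        rw [mem_closedBall_zero_iff, norm_smul, Real.norm_of_nonneg ht.1.le]
        have : ‖w‖ ≤ ‖z‖ + 1 := by
          have := norm_sub_norm_le w z
          rw [Metric.mem_ball, dist_eq_norm] at hw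
          linarith
        nlinarith [norm_nonneg w, ht.2, ht.1]
      rw [norm_smul, Real.norm_of_nonneg (by have := ht.1; positivity)]
      have h2 := hC _ h1
      have h3 : t ^ (k + 1) ≤ 1 := pow_le_one₀ ht.1.le ht.2
      nlinarith [norm_nonneg (fderiv ℝ F (t • w))]
    · exact intervalIntegrable_const
    · refine Filter.Eventually.of_forall fun t ht w hw => ?_
      have h1 : HasFDerivAt (fun w : ℂ => t • w) (t • ContinuousLinearMap.id ℝ ℂ) w :=
        (hasFDerivAt_id w).const_smul t
      have h2 := (((hF.differentiable (by simp)) (t • w)).hasFDerivAt.comp w h1).const_smul (t ^ k)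
      convert! h2 using 1
      ext v
      simp [pow_succ, smul_smul]
  induction n with
  | zero =>
    intro E _ _ k F hF
    rw [Nat.cast_zero, contDiff_zero]
    exact continuous_iff_continuousAt.2 fun z => (key k hF z).continuousAt
  | succ n ih =>
    intro E _ _ k F hF
    rw [Nat.cast_succ, contDiff_succ_iff_hasFDerivAt]
    exact ⟨_, ih (k + 1) (hF.fderiv_right (m := ∞) (by simp)), key k hF⟩

theorem contDiff_integral_comp_smul {E : Type} [NormedAddCommGroup E] [NormedSpace ℝ E]
    {F : ℂ → E} (hF : ContDiff ℝ ∞ F) :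
    ContDiff ℝ ∞ (fun z => ∫ t in (0 : ℝ)..1, F (t • z)) := by
  rw [contDiff_infty]
  intro n
  simpa using contDiff_integral_pow_smul_aux n 0 hF

section Division

variable {E : Type} [NormedAddCommGroup E] [NormedSpace ℂ E]

/-- Hadamard's lemma in the coordinates `z` and `z̄`. -/
theorem exists_hadamard [CompleteSpace E] {F : ℂ → E} (hF : ContDiff ℝ ∞ F) :
    ∃ a b : ℂ → E, ContDiff ℝ ∞ a ∧ ContDiff ℝ ∞ b ∧
      ∀ z, F z = F 0 + (z • a z + star z • b z) := by
  refine ⟨_, _, contDiff_integral_comp_smul (contDiff_pdz hF),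
    contDiff_integral_comp_smul (contDiff_pdzbar hF), fun z => ?_⟩
  have hd : ∀ t : ℝ, HasDerivAt (fun t : ℝ => F (t • z)) (fderiv ℝ F (t • z) z) t := by
    intro t
    have h1 : HasDerivAt (fun t : ℝ => t • z) z t := by
      simpa using (hasDerivAt_id t).smul_const z
    exact ((hF.differentiable (by simp)) (t • z)).hasFDerivAt.comp_hasDerivAt t h1
  have hF' : Continuous (fderiv ℝ F) := hF.continuous_fderiv (by simp)
  have h := intervalIntegral.integral_eq_sub_of_hasDerivAt (a := (0 : ℝ)) (b := 1)
    (fun t _ => hd t) (Continuous.intervalIntegrable (by fun_prop) _ _)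
  have c1 := (contDiff_pdz hF).continuous
  have c2 := (contDiff_pdzbar hF).continuous
  simp only [fderiv_apply_eq_pdz_add_pdzbar] at h
  rw [intervalIntegral.integral_add (Continuous.intervalIntegrable (by fun_prop) _ _)
    (Continuous.intervalIntegrable (by fun_prop) _ _), intervalIntegral.integral_smul,
    intervalIntegral.integral_smul] at h
  rw [h]
  simp

theorem contDiff_iterate_pdzbar {F : ℂ → E} (hF : ContDiff ℝ ∞ F) (k : ℕ) :
    ContDiff ℝ ∞ (pdzbar^[k] F) := by
  induction k with
  | zero => exact hF
  | succ k ih => rw [Function.iterate_succ_apply']; exact contDiff_pdzbar ih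

theorem iterate_pdzbar_add {F G : ℂ → E} (hF : ContDiff ℝ ∞ F) (hG : ContDiff ℝ ∞ G) (k : ℕ) :
    pdzbar^[k] (fun z => F z + G z) = fun z => pdzbar^[k] F z + pdzbar^[k] G z := by
  induction k with
  | zero => rfl
  | succ k ih =>
    simp only [Function.iterate_succ_apply', ih]
    funext z
    exact pdzbar_add ((contDiff_iterate_pdzbar hF k).differentiable (by simp) z)
      ((contDiff_iterate_pdzbar hG k).differentiable (by simp) z)

theorem iterate_pdzbar_id_smul {a : ℂ → E} (ha : ContDiff ℝ ∞ a) (k : ℕ) :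
    pdzbar^[k] (fun z => z • a z) = fun z => z • pdzbar^[k] a z := by
  induction k with
  | zero => rfl
  | succ k ih =>
    simp only [Function.iterate_succ_apply', ih]
    funext z
    rw [pdzbar_smul (c := fun z => z) (by fun_prop)
      ((contDiff_iterate_pdzbar ha k).differentiable (by simp) z),
      pdzbar_holomorphic (f := fun z : ℂ => z) (by fun_prop)]
    simp

theorem contDiff_star_pow (k : ℕ) : ContDiff ℝ ∞ (fun z : ℂ => star z ^ k) :=
  (Complex.conjCLE.contDiff (n := ∞)).pow k

theorem pdzbar_star_pow (k : ℕ) (z : ℂ) :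
    pdzbar (fun z : ℂ => star z ^ (k + 1)) z = (k + 1) * star z ^ k := by
  have h : HasFDerivAt (fun z : ℂ => star z) (Complex.conjCLE : ℂ →L[ℝ] ℂ) z :=
    Complex.conjCLE.hasFDerivAt
  refine pdzbar_eq_of_hasFDerivAt (a := 0) (h.pow (k + 1)) fun w => ?_
  simp [mul_comm]

theorem iterate_pdzbar_star_pow_smul {b : ℂ → E} (hb : ContDiff ℝ ∞ b) (k : ℕ) :
    pdzbar^[k] (fun z => star z ^ k • b z) 0 = (k.factorial : ℂ) • b 0 := by
  induction k generalizing b with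
  | zero => simp
  | succ k ih =>
    have h1 : pdzbar (fun z => star z ^ (k + 1) • b z)
        = fun z => star z ^ k • (((k : ℂ) + 1) • b z + star z • pdzbar b z) := by
      funext z
      rw [pdzbar_smul ((contDiff_star_pow _).differentiable (by simp) z)
        (hb.differentiable (by simp) z), pdzbar_star_pow, pow_succ]
      module
    rw [Function.iterate_succ_apply, h1, ih]
    · simp [Nat.factorial_succ, smul_smul, mul_comm]
    · have := contDiff_star_pow 1
      simp only [pow_one] at this
      exact (hb.const_smul _).add (this.smul (contDiff_pdzbar hb))

/-- Hadamard's lemma iterated: modulo `z` the Taylor expansion of `F` at `0` only contains powers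
of `z̄`, whose coefficients are the derivatives `∂^j F/∂z̄^j` at `0`. -/
theorem exists_decomposition [CompleteSpace E] {F : ℂ → E} (hF : ContDiff ℝ ∞ F)
    (h0 : ∀ j, pdzbar^[j] F 0 = 0) (k : ℕ) : ∃ a b : ℂ → E, ContDiff ℝ ∞ a ∧ ContDiff ℝ ∞ b ∧
      ∀ z, F z = z • a z + star z ^ k • b z := by
  induction k with
  | zero => exact ⟨0, F, contDiff_const, hF, fun z => by simp⟩
  | succ k ih =>
    obtain ⟨a, b, ha, hb, hab⟩ := ih
    have hb0 : b 0 = 0 := by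
      have h1 := h0 k
      have ha' : ContDiff ℝ ∞ fun z : ℂ => z • a z := contDiff_id.smul ha
      have hb' : ContDiff ℝ ∞ fun z : ℂ => star z ^ k • b z := (contDiff_star_pow k).smul hb
      rw [show F = fun z => z • a z + star z ^ k • b z from funext hab,
        iterate_pdzbar_add ha' hb',
        iterate_pdzbar_id_smul ha] at h1
      simp only [zero_smul, zero_add] at h1
      rw [iterate_pdzbar_star_pow_smul hb] at h1
      exact (smul_eq_zero.1 h1).resolve_left (by exact_mod_cast k.factorial_ne_zero)
    obtain ⟨a', b', ha', hb', hab'⟩ := exists_hadamard hb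
    refine ⟨fun z => a z + star z ^ k • a' z, b', ha.add ((contDiff_star_pow k).smul ha'), hb',
      fun z => ?_⟩
    rw [hab, hab' z, hb0, pow_succ]
    module

/-- The function `z̄ᵏ / zʲ`, which is `0` at the origin, is of class `Cʳ` as soon as its degree
`k - j` exceeds `r`. -/
theorem contDiff_star_pow_div_pow (r : ℕ) : ∀ j k : ℕ, j + r + 1 ≤ k →
    ContDiff ℝ r (fun z : ℂ => star z ^ k / z ^ j) := by
  have key : ∀ j k : ℕ, j + 2 ≤ k → ∀ z : ℂ, HasFDerivAt (fun z : ℂ => star z ^ k / z ^ j)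
      ((-(j : ℂ) * (star z ^ k / z ^ (j + 1))) • (ContinuousLinearMap.id ℝ ℂ)
        + ((k : ℂ) * (star z ^ (k - 1) / z ^ j)) • (Complex.conjCLE : ℂ →L[ℝ] ℂ)) z := by
    intro j k hjk z
    obtain ⟨l, rfl⟩ := Nat.exists_eq_add_of_le hjk
    by_cases hz : z = 0
    · subst hz
      have h1 : ((-(j : ℂ) * (star (0 : ℂ) ^ (j + 2 + l) / 0 ^ (j + 1)))
          • (ContinuousLinearMap.id ℝ ℂ) + (((j + 2 + l : ℕ) : ℂ)
          * (star (0 : ℂ) ^ (j + 2 + l - 1) / 0 ^ j)) • (Complex.conjCLE : ℂ →L[ℝ] ℂ)) = 0 := by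
        rw [star_zero, zero_pow (by omega), zero_pow (show j + 2 + l - 1 ≠ 0 by omega), zero_div,
          zero_div, mul_zero, mul_zero]
        ext w
        simp
      rw [h1]
      refine HasFDerivAt.of_isLittleO ?_
      have h2 : (fun z : ℂ => star z ^ (j + 2 + l) / z ^ j) =O[nhds 0] fun z => ‖z‖ ^ (2 + l) := by
        refine Asymptotics.IsBigO.of_bound 1 (Filter.Eventually.of_forall fun w => ?_)
        rw [norm_div, norm_pow, norm_pow, norm_star, one_mul, norm_pow, norm_norm]
        by_cases hw : w = 0
        · simp [hw]
        · have : ‖w‖ ≠ 0 := norm_ne_zero_iff.2 hw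
          apply le_of_eq
          field_simp
          ring
      have h3 : (fun z : ℂ => ‖z‖ ^ (2 + l)) =o[nhds 0] fun z => z := by
        have := (Asymptotics.isLittleO_pow_id (𝕜 := ℝ) (n := 2 + l) (by omega))
        have h4 := this.comp_tendsto (k := fun z : ℂ => ‖z‖) (l' := nhds 0)
          (by simpa using (continuous_norm (E := ℂ)).tendsto 0)
        exact h4.of_norm_right
      have h5 : star (0 : ℂ) ^ (j + 2 + l) / (0 : ℂ) ^ j = 0 := by
        rw [star_zero, zero_pow (by omega), zero_div]
      simp only [h5, sub_zero, zero_apply]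
      exact h2.trans_isLittleO h3
    · have h : HasFDerivAt (fun z : ℂ => star z) (Complex.conjCLE : ℂ →L[ℝ] ℂ) z :=
        Complex.conjCLE.hasFDerivAt
      have h1 := (h.pow (j + 2 + l)).mul
        (((hasDerivAt_pow j z).inv (pow_ne_zero j hz)).hasFDerivAt.restrictScalars ℝ)
      have h2 : (fun z : ℂ => star z ^ (j + 2 + l) / z ^ j)
          = (fun z : ℂ => star z ^ (j + 2 + l)) * (fun z : ℂ => z ^ j)⁻¹ := by
        funext w; simp [div_eq_mul_inv]
      rw [h2]
      convert! h1 using 1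
      ext w
      rcases j with _ | j
      · simp
      · simp
        field_simp
        ring
  induction r with
  | zero =>
    intro j k hjk
    rw [Nat.cast_zero, contDiff_zero, continuous_iff_continuousAt]
    intro z
    by_cases hz : z = 0
    · subst hz
      obtain ⟨l, rfl⟩ := Nat.exists_eq_add_of_le hjk
      unfold ContinuousAt
      have h5 : star (0 : ℂ) ^ (j + 0 + 1 + l) / (0 : ℂ) ^ j = 0 := by
        rw [star_zero, zero_pow (by omega), zero_div]
      change Filter.Tendsto _ _ (nhds (star (0 : ℂ) ^ (j + 0 + 1 + l) / (0 : ℂ) ^ j))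
      rw [h5]
      refine squeeze_zero_norm (a := fun z : ℂ => ‖z‖ ^ (1 + l)) (fun w => ?_) ?_
      · rw [norm_div, norm_pow, norm_pow, norm_star]
        by_cases hw : w = 0
        · simp [hw]
        · have : ‖w‖ ≠ 0 := norm_ne_zero_iff.2 hw
          apply le_of_eq
          field_simp
          ring
      · have : Continuous fun z : ℂ => ‖z‖ ^ (1 + l) := by fun_prop
        simpa using this.tendsto 0
    · exact ((contDiff_star_pow k).continuous.continuousAt).div (by fun_prop) (pow_ne_zero j hz)
  | succ r ih =>
    intro j k hjk
    rw [Nat.cast_succ, contDiff_succ_iff_hasFDerivAt]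
    refine ⟨_, ?_, key j k (by omega)⟩
    exact ((contDiff_const.mul (ih (j + 1) k (by omega))).smul contDiff_const).add
      ((contDiff_const.mul (ih j (k - 1) (by omega))).smul contDiff_const)

/-- A smooth map all of whose derivatives `∂^j/∂z̄^j` vanish at `0` is smoothly divisible
by `z`: the quotient is `a + (z̄ᵏ / z) b` for every `k`, hence of class `Cʳ` for every `r`. -/
theorem exists_eq_id_smul [CompleteSpace E] {F : ℂ → E} (hF : ContDiff ℝ ∞ F)
    (h0 : ∀ j, pdzbar^[j] F 0 = 0) :
    ∃ g : ℂ → E, ContDiff ℝ ∞ g ∧ ∀ z, F z = z • g z := by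
  choose a b ha hb hab using exists_decomposition hF h0
  let g : ℕ → ℂ → E := fun k z => a k z + (star z ^ k / z ^ 1) • b k z
  have hg : ∀ n : ℕ, ContDiff ℝ n (g (n + 2)) := fun n =>
    ((ha _).of_le (by exact_mod_cast le_top)).add
      ((contDiff_star_pow_div_pow n 1 (n + 2) (by omega)).smul
        ((hb _).of_le (by exact_mod_cast le_top)))
  have hFg : ∀ k z, F z = z • g (k + 2) z := by
    intro k z
    rw [hab (k + 2)]
    by_cases hz : z = 0
    · simp [hz]
    · simp only [g, smul_add, smul_smul]
      congr 2
      field_simp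
  have heq : ∀ n, g (n + 2) = g 2 := by
    intro n
    refine Continuous.ext_on (dense_compl_singleton (0 : ℂ)) (hg n).continuous (hg 0).continuous
      fun z hz => ?_
    have h1 := (hFg n z).symm.trans (hFg 0 z)
    exact smul_right_injective E (r := z) hz h1
  refine ⟨g 2, contDiff_infty.2 fun n => ?_, hFg 0⟩
  rw [← heq n]
  exact hg n

theorem exists_eq_sub_smul [CompleteSpace E] {F : ℂ → E} (hF : ContDiff ℝ ∞ F) {x : ℂ}
    (h0 : ∀ j, pdzbar^[j] F x = 0) :
    ∃ g : ℂ → E, ContDiff ℝ ∞ g ∧ ∀ z, F z = (z - x) • g z := by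
  have hshift : ∀ j, pdzbar^[j] (fun z => F (z + x)) = fun z => pdzbar^[j] F (z + x) := by
    intro j
    induction j with
    | zero => rfl
    | succ j ih =>
      simp only [Function.iterate_succ_apply', ih]
      funext z
      rw [pdzbar_comp_holomorphic (φ := fun z => z + x)
        ((contDiff_iterate_pdzbar hF j).differentiable (by simp) _) (by fun_prop)]
      simp
  obtain ⟨g, hg, hFg⟩ := exists_eq_id_smul (F := fun z => F (z + x))
    (hF.comp (contDiff_id.add contDiff_const)) (fun j => by rw [hshift]; simpa using h0 j)
  refine ⟨fun z => g (z - x), hg.comp (contDiff_id.sub contDiff_const), fun z => ?_⟩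
  simpa using hFg (z - x)

theorem contDiff_bump_smul {E : Type*} [NormedAddCommGroup E] [NormedSpace ℝ E] {f : ℂ → E}
    {Ω : Set ℂ} (hΩ : IsOpen Ω) (hf : ContDiffOn ℝ ∞ f Ω) {x : ℂ} (χ : ContDiffBump x)
    (hχ : Metric.closedBall x χ.rOut ⊆ Ω) : ContDiff ℝ ∞ (fun z => χ z • f z) := by
  rw [contDiff_iff_contDiffAt]
  intro z
  by_cases hz : z ∈ Ω
  · exact χ.contDiff.contDiffAt.smul (hf.contDiffAt (hΩ.mem_nhds hz))
  · refine (contDiffAt_const (c := (0 : E))).congr_of_eventuallyEq ?_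
    have : z ∈ (tsupport χ)ᶜ := by
      rw [χ.tsupport_eq]
      exact fun h => hz (hχ h)
    filter_upwards [(isClosed_tsupport χ).isOpen_compl.mem_nhds this] with w hw
    rw [image_eq_zero_of_notMem_tsupport hw, zero_smul]

/-- A smooth solution of a linear equation `∂f/∂z̄ = M f` that vanishes at `x` is divisible by
`z - x`, and the quotient solves the same equation. Indeed the equation expresses all the
derivatives `∂^j f/∂z̄^j` linearly through `f`, so that they all vanish at `x`. -/
theorem exists_division [CompleteSpace E] {f : ℂ → E} {M : ℂ → E →L[ℂ] E} {Ω : Set ℂ}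
    (hΩ : IsOpen Ω)
    (hf : ContDiffOn ℝ ∞ f Ω) (hM : ContDiffOn ℝ ∞ M Ω) (hfM : ∀ z ∈ Ω, pdzbar f z = M z (f z))
    {x : ℂ} (hx : x ∈ Ω) (hfx : f x = 0) :
    ∃ g : ℂ → E, ContDiffOn ℝ ∞ g Ω ∧ (∀ z ∈ Ω, f z = (z - x) • g z) ∧
      ∀ z ∈ Ω, pdzbar g z = M z (g z) := by
  obtain ⟨r, hr, hrΩ⟩ := Metric.isOpen_iff.1 hΩ x hx
  let χ : ContDiffBump x := ⟨r / 3, r / 2, by positivity, by linarith⟩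
  have hFs : ContDiff ℝ ∞ (fun z => χ z • f z) :=
    contDiff_bump_smul hΩ hf χ fun z hz => hrΩ (by
      change dist z x ≤ r / 2 at hz
      rw [Metric.mem_ball]
      linarith)
  have hfF : (fun z => χ z • f z) =ᶠ[nhds x] f := by
    filter_upwards [χ.eventuallyEq_one] with z hz
    rw [hz]
    simp
  have hiter : ∀ j, ∃ Mj : ℂ → E →L[ℂ] E, ContDiffOn ℝ ∞ Mj Ω ∧
      ∀ z ∈ Ω, pdzbar^[j] f z = Mj z (f z) := by
    intro j
    induction j with
    | zero => exact ⟨fun _ => ContinuousLinearMap.id ℂ E, contDiffOn_const, fun z _ => rfl⟩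
    | succ j ih =>
      obtain ⟨Mj, hMj, h⟩ := ih
      refine ⟨fun z => pdzbar Mj z + (Mj z).comp (M z), (contDiffOn_pdzbar hΩ hMj).add ?_,
        fun z hz => ?_⟩
      · exact ((ContinuousLinearMap.compL ℂ E E E).bilinearRestrictScalars
          ℝ).isBoundedBilinearMap.contDiff.comp_contDiffOn (hMj.prodMk hM)
      · have h1 := pdzbar_bilin (ContinuousLinearMap.id ℂ (E →L[ℂ] E))
          ((hMj.contDiffAt (hΩ.mem_nhds hz)).differentiableAt (by simp))
          ((hf.contDiffAt (hΩ.mem_nhds hz)).differentiableAt (by simp))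
        rw [Function.iterate_succ_apply', pdzbar_congr_on hΩ h hz]
        refine h1.trans ?_
        rw [hfM z hz]
        simp
  have hiterF : ∀ j, pdzbar^[j] (fun z => χ z • f z) =ᶠ[nhds x] pdzbar^[j] f := by
    intro j
    induction j with
    | zero => exact hfF
    | succ j ih =>
      rw [Function.iterate_succ_apply', Function.iterate_succ_apply']
      exact pdzbar_eventuallyEq ih
  obtain ⟨g₀, hg₀, hFg₀⟩ := exists_eq_sub_smul hFs (x := x) (fun j => by
    rw [(hiterF j).eq_of_nhds]
    obtain ⟨Mj, -, h⟩ := hiter j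
    rw [h x hx, hfx, map_zero])
  let g : ℂ → E := fun z => if z = x then g₀ x else (z - x)⁻¹ • f z
  have hgg₀ : g =ᶠ[nhds x] g₀ := by
    filter_upwards [hfF] with z hz
    by_cases hzx : z = x
    · simp [g, hzx]
    · have h1 : z - x ≠ 0 := sub_ne_zero.2 hzx
      simp only [g, if_neg hzx]
      rw [← hz, hFg₀ z, smul_smul, inv_mul_cancel₀ h1, one_smul]
  have hgs : ContDiffOn ℝ ∞ g Ω := by
    intro z hz
    refine ContDiffAt.contDiffWithinAt ?_
    by_cases hzx : z = x
    · subst hzx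
      exact hg₀.contDiffAt.congr_of_eventuallyEq hgg₀
    · have h1 : z - x ≠ 0 := sub_ne_zero.2 hzx
      have h2 : ContDiffAt ℝ ∞ (fun z => (z - x)⁻¹ • f z) z :=
        ((contDiffAt_id.sub contDiffAt_const).inv h1).smul (hf.contDiffAt (hΩ.mem_nhds hz))
      refine h2.congr_of_eventuallyEq ?_
      filter_upwards [isOpen_ne.mem_nhds hzx] with w hw
      exact if_neg hw
  have hfg : ∀ z ∈ Ω, f z = (z - x) • g z := by
    intro z hz
    by_cases hzx : z = x
    · simp [hzx, hfx]
    · have h1 : z - x ≠ 0 := sub_ne_zero.2 hzx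
      simp only [g, if_neg hzx]
      rw [smul_smul, mul_inv_cancel₀ h1, one_smul]
  have hoff : ∀ z ∈ Ω, z ≠ x → pdzbar g z = M z (g z) := by
    intro z hz hzx
    have h1 : z - x ≠ 0 := sub_ne_zero.2 hzx
    have h2 := hfM z hz
    rw [pdzbar_congr_on hΩ hfg hz, pdzbar_smul (c := fun z => z - x) (by fun_prop)
      ((hgs.contDiffAt (hΩ.mem_nhds hz)).differentiableAt (by simp)),
      pdzbar_holomorphic (f := fun z => z - x) (by fun_prop), zero_smul, zero_add, hfg z hz,
      map_smul] at h2
    exact smul_right_injective E h1 h2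
  refine ⟨g, hgs, hfg, fun z hz => ?_⟩
  by_cases hzx : z = x
  · subst hzx
    refine eq_of_eventually_eq_punctured
      ((contDiffOn_pdzbar hΩ hgs).continuousOn.continuousAt (hΩ.mem_nhds hz))
      ((hM.continuousOn.continuousAt (hΩ.mem_nhds hz)).clm_apply
        (hgs.continuousOn.continuousAt (hΩ.mem_nhds hz))) ?_
    filter_upwards [self_mem_nhdsWithin, nhdsWithin_le_nhds (hΩ.mem_nhds hz)] with w hw hwΩ
    exact hoff w hwΩ hw
  · exact hoff z hz hzx

end Division

/-! ### An `L²` estimate for `∂/∂z̄` and finite order of vanishing -/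

section DbarEstimate

open MeasureTheory

theorem contDiff_fderiv_apply {a : ℂ → ℝ} (ha : ContDiff ℝ ∞ a) (v : ℂ) :
    ContDiff ℝ ∞ (fun z => fderiv ℝ a z v) :=
  (ha.fderiv_right (m := ∞) (by simp)).clm_apply contDiff_const

theorem hasCompactSupport_fderiv_apply {a : ℂ → ℝ} (ha : HasCompactSupport a) (v : ℂ) :
    HasCompactSupport (fun z => fderiv ℝ a z v) :=
  ha.fderiv_apply (𝕜 := ℝ) v

/-- Two integrations by parts: the Jacobian of `(a, b)` has integral zero. -/
theorem integral_fderiv_one_mul_fderiv_I {a b : ℂ → ℝ} (ha : ContDiff ℝ ∞ a)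
    (hb : ContDiff ℝ ∞ b) (hbc : HasCompactSupport b) :
    ∫ z, fderiv ℝ a z 1 * fderiv ℝ b z Complex.I
      = ∫ z, fderiv ℝ a z Complex.I * fderiv ℝ b z 1 := by
  have ha' := fun v => contDiff_fderiv_apply ha v
  have hb' := fun v => contDiff_fderiv_apply hb v
  have hint : ∀ {f g : ℂ → ℝ}, ContDiff ℝ ∞ f → ContDiff ℝ ∞ g → HasCompactSupport g →
      Integrable (fun z => f z * g z) := fun hf hg hgc =>
    (hf.continuous.mul hg.continuous).integrable_of_hasCompactSupport hgc.mul_left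
  have hparts : ∀ v w : ℂ, ∫ z, fderiv ℝ a z v * fderiv ℝ b z w
      = -∫ z, fderiv ℝ (fun z => fderiv ℝ a z v) z w * b z := fun v w =>
    integral_mul_fderiv_eq_neg_fderiv_mul_of_integrable
      (hint (contDiff_fderiv_apply (ha' v) w) hb hbc)
      (hint (ha' v) (hb' w) (hasCompactSupport_fderiv_apply hbc w)) (hint (ha' v) hb hbc)
      (fun z _ => (ha' v).differentiable (by simp) z) (fun z _ => hb.differentiable (by simp) z)
  have hsymm : ∀ z, fderiv ℝ (fun z => fderiv ℝ a z 1) z Complex.I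
      = fderiv ℝ (fun z => fderiv ℝ a z Complex.I) z 1 := by
    intro z
    have h : DifferentiableAt ℝ (fderiv ℝ a) z :=
      (ha.fderiv_right (m := ∞) (by simp)).differentiable (by simp) z
    have hs : IsSymmSndFDerivAt ℝ a z := ha.contDiffAt.isSymmSndFDerivAt (by
      rw [minSmoothness_of_isRCLikeNormedField]
      exact WithTop.coe_le_coe.2 (le_top (α := ℕ∞)))
    rw [fderiv_clm_apply h (by fun_prop), fderiv_clm_apply h (by fun_prop)]
    simpa using hs Complex.I 1
  rw [hparts, hparts]
  simp only [hsymm]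

/-- The Poincaré inequality, with the constant `4 R²` on a disc of radius `R`. -/
theorem integral_sq_le_integral_fderiv_one_sq {a : ℂ → ℝ} (ha : ContDiff ℝ ∞ a)
    (hac : HasCompactSupport a) {x : ℂ} {R : ℝ} (hR : tsupport a ⊆ Metric.closedBall x R) :
    ∫ z, a z ^ 2 ≤ 4 * R ^ 2 * ∫ z, fderiv ℝ a z 1 ^ 2 := by
  have ha' := contDiff_fderiv_apply ha 1
  have hac' := hasCompactSupport_fderiv_apply hac 1
  have hre : ContDiff ℝ ∞ (fun z : ℂ => (z - x).re) :=
    Complex.reCLM.contDiff.comp (contDiff_id.sub contDiff_const)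
  have hre' : ∀ z, fderiv ℝ (fun z : ℂ => (z - x).re) z 1 = 1 := by
    intro z
    have h : HasFDerivAt (fun z : ℂ => (z - x).re) Complex.reCLM z :=
      Complex.reCLM.hasFDerivAt.comp z ((hasFDerivAt_id z).sub_const x)
    rw [h.fderiv]; simp
  have hsq : ∀ z, fderiv ℝ (fun z => a z ^ 2) z 1 = 2 * a z * fderiv ℝ a z 1 := by
    intro z
    have h := ((ha.differentiable (by simp) z).hasFDerivAt.pow 2)
    rw [h.fderiv]; simp
  have hsqc : HasCompactSupport (fun z => a z ^ 2) := by
    exact hac.comp_left (g := fun t : ℝ => t ^ 2) (by simp)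
  have hsqc' : HasCompactSupport (fun z => fderiv ℝ a z 1 ^ 2) := by
    exact hac'.comp_left (g := fun t : ℝ => t ^ 2) (by simp)
  have hint : ∀ {f g : ℂ → ℝ}, ContDiff ℝ ∞ f → ContDiff ℝ ∞ g → HasCompactSupport g →
      Integrable (fun z => f z * g z) := fun hf hg hgc =>
    (hf.continuous.mul hg.continuous).integrable_of_hasCompactSupport hgc.mul_left
  have i1 : Integrable (fun z => a z ^ 2) :=
    (ha.pow 2).continuous.integrable_of_hasCompactSupport hsqc
  have i2 : Integrable (fun z => fderiv ℝ a z 1 ^ 2) :=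
    (ha'.pow 2).continuous.integrable_of_hasCompactSupport hsqc'
  have i3 : Integrable (fun z => (z - x).re * fderiv ℝ (fun z => a z ^ 2) z 1) :=
    hint hre (contDiff_fderiv_apply (ha.pow 2) 1) (hasCompactSupport_fderiv_apply hsqc 1)
  have hparts := integral_mul_fderiv_eq_neg_fderiv_mul_of_integrable (μ := volume)
    (f := fun z : ℂ => (z - x).re) (g := fun z => a z ^ 2) (v := 1)
    (by simp only [hre', one_mul]; exact i1) i3 (hint hre (ha.pow 2) hsqc)
    (fun z _ => hre.differentiable (by simp) z) (fun z _ => (ha.pow 2).differentiable (by simp) z)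
  simp only [hre', one_mul] at hparts
  have hle : ∫ z, a z ^ 2 ≤ ∫ z, ((1 / 2) * a z ^ 2 + 2 * R ^ 2 * fderiv ℝ a z 1 ^ 2) := by
    have h1 : ∫ z, a z ^ 2 = ∫ z, -((z - x).re * fderiv ℝ (fun z => a z ^ 2) z 1) := by
      rw [integral_neg, hparts, neg_neg]
    rw [h1]
    refine integral_mono i3.neg ((i1.const_mul _).add (i2.const_mul _)) fun z => ?_
    simp only [hsq]
    by_cases hz : z ∈ tsupport a
    · have h2 : |(z - x).re| ≤ R := (Complex.abs_re_le_norm _).trans (by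
        simpa [dist_eq_norm] using hR hz)
      have h3 : (z - x).re ^ 2 ≤ R ^ 2 := sq_le_sq' (abs_le.1 h2).1 (abs_le.1 h2).2
      nlinarith [sq_nonneg (a z + 2 * (z - x).re * fderiv ℝ a z 1),
        mul_le_mul_of_nonneg_right h3 (sq_nonneg (fderiv ℝ a z 1))]
    · rw [image_eq_zero_of_notMem_tsupport hz]
      simp
      positivity
  rw [integral_add (i1.const_mul _) (i2.const_mul _), integral_const_mul, integral_const_mul] at hle
  linarith

/-- For compactly supported functions the `L²` norm of `∂v/∂z̄` controls that of `v`: as the cross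
terms integrate to zero, `4 ‖∂v/∂z̄‖²` has the same integral as `‖dv‖²`. -/
theorem integral_norm_sq_le_integral_pdzbar {v : ℂ → ℂ} (hv : ContDiff ℝ ∞ v)
    (hvc : HasCompactSupport v) {x : ℂ} {R : ℝ} (hR : tsupport v ⊆ Metric.closedBall x R) :
    ∫ z, ‖v z‖ ^ 2 ≤ 16 * R ^ 2 * ∫ z, ‖pdzbar v z‖ ^ 2 := by
  set a : ℂ → ℝ := fun z => (v z).re with ha_def
  set b : ℂ → ℝ := fun z => (v z).im with hb_def
  have ha : ContDiff ℝ ∞ a := Complex.reCLM.contDiff.comp hv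
  have hb : ContDiff ℝ ∞ b := Complex.imCLM.contDiff.comp hv
  have hac : HasCompactSupport a := hvc.comp_left Complex.zero_re
  have hbc : HasCompactSupport b := hvc.comp_left Complex.zero_im
  have hat : tsupport a ⊆ tsupport v :=
    closure_mono (Function.support_comp_subset Complex.zero_re v)
  have hbt : tsupport b ⊆ tsupport v :=
    closure_mono (Function.support_comp_subset Complex.zero_im v)
  have h1 := integral_sq_le_integral_fderiv_one_sq ha hac (hat.trans hR)
  have h2 := integral_sq_le_integral_fderiv_one_sq hb hbc (hbt.trans hR)
  have h3 := integral_fderiv_one_mul_fderiv_I ha hb hbc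
  have hfd : ∀ z w, fderiv ℝ v z w = (fderiv ℝ a z w : ℂ) + fderiv ℝ b z w * Complex.I := by
    intro z w
    have hvz := (hv.differentiable (by simp) z).hasFDerivAt
    have e1 : HasFDerivAt a (Complex.reCLM.comp (fderiv ℝ v z)) z :=
      Complex.reCLM.hasFDerivAt.comp z hvz
    have e2 : HasFDerivAt b (Complex.imCLM.comp (fderiv ℝ v z)) z :=
      Complex.imCLM.hasFDerivAt.comp z hvz
    rw [e1.fderiv, e2.fderiv]
    simp [Complex.re_add_im]
  have hnorm : ∀ z, ‖v z‖ ^ 2 = a z ^ 2 + b z ^ 2 := by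
    intro z
    rw [← Complex.normSq_eq_norm_sq, Complex.normSq_apply]
    ring
  have hbar : ∀ z, ‖pdzbar v z‖ ^ 2 = (1 / 4) * (fderiv ℝ a z 1 ^ 2 + fderiv ℝ b z 1 ^ 2
      + (fderiv ℝ a z Complex.I ^ 2 + fderiv ℝ b z Complex.I ^ 2))
      - (1 / 2) * (fderiv ℝ a z 1 * fderiv ℝ b z Complex.I)
      + (1 / 2) * (fderiv ℝ a z Complex.I * fderiv ℝ b z 1) := by
    intro z
    rw [← Complex.normSq_eq_norm_sq, Complex.normSq_apply, pdzbar, hfd, hfd]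
    simp
    ring
  have hint : ∀ {f g : ℂ → ℝ}, ContDiff ℝ ∞ f → ContDiff ℝ ∞ g → HasCompactSupport g →
      Integrable (fun z => f z * g z) := fun hf hg hgc =>
    (hf.continuous.mul hg.continuous).integrable_of_hasCompactSupport hgc.mul_left
  have hsq : ∀ {f : ℂ → ℝ}, ContDiff ℝ ∞ f → HasCompactSupport f →
      Integrable (fun z => f z ^ 2) := fun hf hfc => by
    simpa [pow_two] using hint hf hf hfc
  have A := fun w => hsq (contDiff_fderiv_apply ha w) (hasCompactSupport_fderiv_apply hac w)
  have B := fun w => hsq (contDiff_fderiv_apply hb w) (hasCompactSupport_fderiv_apply hbc w)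
  have AB := fun w w' => hint (contDiff_fderiv_apply ha w) (contDiff_fderiv_apply hb w')
    (hasCompactSupport_fderiv_apply hbc w')
  simp only [hnorm, hbar]
  rw [integral_add (hsq ha hac) (hsq hb hbc), integral_add, integral_sub, integral_const_mul,
    integral_const_mul, integral_const_mul, integral_add, integral_add, integral_add]
  · rw [h3]
    have p1 : 0 ≤ ∫ z, fderiv ℝ a z Complex.I ^ 2 := integral_nonneg fun z => sq_nonneg _
    have p2 : 0 ≤ ∫ z, fderiv ℝ b z Complex.I ^ 2 := integral_nonneg fun z => sq_nonneg _
    nlinarith [mul_nonneg (sq_nonneg R) p1, mul_nonneg (sq_nonneg R) p2]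
  · exact A _
  · exact B _
  · exact A _
  · exact B _
  · exact (A _).add (B _)
  · exact (A _).add (B _)
  · exact (((A _).add (B _)).add ((A _).add (B _))).const_mul _
  · exact (AB _ _).const_mul _
  · exact ((((A _).add (B _)).add ((A _).add (B _))).const_mul _).sub ((AB _ _).const_mul _)
  · exact (AB _ _).const_mul _

end DbarEstimate

section FiniteOrder

open MeasureTheory

variable {ι : Type} [Fintype ι]

/-- The pointwise estimate of `∂(χ g)/∂z̄`, where `f = (z - x)ⁿ g`. If the derivative falls on the
cutoff function `χ`, the term lives on `‖z - x‖ ≥ R / 2`, where `g` is at most `(2 / R)ⁿ` times `f`;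
if it falls on `g`, the equation bounds it by `K` times `χ g`. -/
theorem sum_norm_sq_pdzbar_cutoff_le {g : ℂ → ι → ℂ} {f : ℂ → ι → ℂ}
    {M : ℂ → (ι → ℂ) →L[ℂ] (ι → ℂ)}
    {Ω : Set ℂ} (hΩ : IsOpen Ω) (hg : ContDiffOn ℝ ∞ g Ω)
    (hgM : ∀ z ∈ Ω, pdzbar g z = M z (g z)) {x : ℂ} (χ : ContDiffBump x)
    (hχ : Metric.closedBall x χ.rOut ⊆ Ω) (hin : χ.rIn = χ.rOut / 2) {K : ℝ}
    (hM : ∀ z ∈ Metric.closedBall x χ.rOut, ‖M z‖ ≤ K)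
    {n : ℕ}
    (hfg : ∀ z ∈ Ω, f z = (z - x) ^ n • g z) (z : ℂ) :
    ∑ i, ‖pdzbar (fun z => χ z • g z) z i‖ ^ 2 ≤ 2 * ((2 / χ.rOut) ^ (2 * n) *
      (‖pdzbar (fun w => (χ w : ℂ)) z‖ ^ 2 * ∑ i, ‖f z i‖ ^ 2))
      + 2 * (Fintype.card ι * K ^ 2) * ∑ i, ‖(χ z • g z) i‖ ^ 2 := by
  have hR := χ.rOut_pos
  set R := χ.rOut with hRdef
  set v : ℂ → ι → ℂ := fun z => χ z • g z with hv
  have hχc : ContDiff ℝ ∞ (fun w => (χ w : ℂ)) := Complex.ofRealCLM.contDiff.comp χ.contDiff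
  change ∑ i, ‖pdzbar v z i‖ ^ 2 ≤ 2 * ((2 / R) ^ (2 * n) *
      (‖pdzbar (fun w => (χ w : ℂ)) z‖ ^ 2 * ∑ i, ‖f z i‖ ^ 2))
      + 2 * (Fintype.card ι * K ^ 2) * ∑ i, ‖v z i‖ ^ 2
  set N : ℝ := Fintype.card ι * K ^ 2 with hN
  by_cases hz : z ∈ Metric.closedBall x R
  · have hzΩ := hχ hz
    have e1 : pdzbar v z = pdzbar (fun w => (χ w : ℂ)) z • g z + M z (v z) := by
      have h1 : v = fun w => (χ w : ℂ) • g w := by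
        funext w; simp [hv]
      have h2 := pdzbar_smul (hχc.differentiable (by simp) z)
        ((hg.contDiffAt (hΩ.mem_nhds hzΩ)).differentiableAt (by simp))
      rw [← h1] at h2
      rw [h2, hgM z hzΩ, h1, map_smul]
    have e2 : ∀ i, ‖pdzbar v z i‖ ^ 2 ≤ 2 * (‖pdzbar (fun w => (χ w : ℂ)) z‖ ^ 2 * ‖g z i‖ ^ 2)
        + 2 * ‖M z (v z)‖ ^ 2 := by
      intro i
      have h1 : ‖pdzbar v z i‖ ≤ ‖pdzbar (fun w => (χ w : ℂ)) z‖ * ‖g z i‖ + ‖M z (v z)‖ := by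
        rw [e1, Pi.add_apply, Pi.smul_apply]
        exact (norm_add_le _ _).trans (add_le_add (norm_smul_le _ _) (norm_le_pi_norm _ i))
      have h2 := pow_le_pow_left₀ (norm_nonneg _) h1 2
      nlinarith [sq_nonneg (‖pdzbar (fun w => (χ w : ℂ)) z‖ * ‖g z i‖ - ‖M z (v z)‖)]
    have e3 : ‖v z‖ ^ 2 ≤ ∑ i, ‖v z i‖ ^ 2 := by
      have h1 : ‖v z‖ ≤ √(∑ i, ‖v z i‖ ^ 2) := by
        refine (pi_norm_le_iff_of_nonneg (Real.sqrt_nonneg _)).2 fun i => ?_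
        refine Real.le_sqrt_of_sq_le ?_
        exact Finset.single_le_sum (f := fun i => ‖v z i‖ ^ 2) (fun j _ => by positivity)
          (Finset.mem_univ i)
      have h2 := pow_le_pow_left₀ (norm_nonneg _) h1 2
      rwa [Real.sq_sqrt (Finset.sum_nonneg fun i _ => by positivity)] at h2
    have e4 : ‖M z (v z)‖ ^ 2 ≤ K ^ 2 * ∑ i, ‖v z i‖ ^ 2 := by
      have h1 : ‖M z (v z)‖ ≤ K * ‖v z‖ :=
        ((M z).le_opNorm _).trans (by gcongr; exact hM z hz)
      calc _ ≤ (K * ‖v z‖) ^ 2 := by gcongr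
        _ = K ^ 2 * ‖v z‖ ^ 2 := by ring
        _ ≤ _ := by gcongr
    have e5 : ‖pdzbar (fun w => (χ w : ℂ)) z‖ ^ 2 * ∑ i, ‖g z i‖ ^ 2 ≤ (2 / R) ^ (2 * n) *
        (‖pdzbar (fun w => (χ w : ℂ)) z‖ ^ 2 * ∑ i, ‖f z i‖ ^ 2) := by
      by_cases hzin : z ∈ Metric.ball x (R / 2)
      · have h0 : (fun w => (χ w : ℂ)) =ᶠ[nhds z] fun _ => 1 := by
          filter_upwards [Metric.isOpen_ball.mem_nhds hzin] with w hw
          rw [χ.one_of_mem_closedBall (by rw [hin]; exact Metric.ball_subset_closedBall hw),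
            Complex.ofReal_one]
        simp [pdzbar_congr h0]
      · have h1 : R / 2 ≤ ‖z - x‖ := by
          rw [Metric.mem_ball, dist_eq_norm, not_lt] at hzin
          exact hzin
        have h2 : ∀ i, ‖g z i‖ ^ 2 ≤ (2 / R) ^ (2 * n) * ‖f z i‖ ^ 2 := by
          intro i
          rw [hfg z hzΩ, Pi.smul_apply, norm_smul, norm_pow, mul_pow, ← pow_mul, mul_comm n 2,
            ← mul_assoc, ← mul_pow]
          have h3 : 1 ≤ 2 / R * ‖z - x‖ := by
            rw [div_mul_eq_mul_div, le_div_iff₀ hR]; linarith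
          exact le_mul_of_one_le_left (by positivity) (one_le_pow₀ h3)
        calc _ ≤ ‖pdzbar (fun w => (χ w : ℂ)) z‖ ^ 2 *
              ∑ i, (2 / R) ^ (2 * n) * ‖f z i‖ ^ 2 := by
              gcongr with i _; exact h2 i
          _ = _ := by rw [← Finset.mul_sum]; ring
    calc _ ≤ ∑ i, (2 * (‖pdzbar (fun w => (χ w : ℂ)) z‖ ^ 2 * ‖g z i‖ ^ 2)
          + 2 * ‖M z (v z)‖ ^ 2) := Finset.sum_le_sum fun i _ => e2 i
      _ = 2 * (‖pdzbar (fun w => (χ w : ℂ)) z‖ ^ 2 * ∑ i, ‖g z i‖ ^ 2)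
          + 2 * (Fintype.card ι * ‖M z (v z)‖ ^ 2) := by
        rw [Finset.sum_add_distrib, ← Finset.mul_sum, ← Finset.mul_sum, Finset.sum_const,
          Finset.card_univ, nsmul_eq_mul]
        ring
      _ ≤ 2 * ((2 / R) ^ (2 * n) *
            (‖pdzbar (fun w => (χ w : ℂ)) z‖ ^ 2 * ∑ i, ‖f z i‖ ^ 2))
          + 2 * (Fintype.card ι * (K ^ 2 * ∑ i, ‖v z i‖ ^ 2)) := by gcongr
      _ = _ := by rw [hN]; ring
  · have h0 : v =ᶠ[nhds z] fun _ => 0 := by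
      filter_upwards [Metric.isClosed_closedBall.isOpen_compl.mem_nhds hz] with w hw
      rw [Set.mem_compl_iff, Metric.mem_closedBall, not_le] at hw
      simp only [hv]
      rw [χ.zero_of_le_dist hw.le, zero_smul]
    have h1 : pdzbar v z = 0 := by rw [pdzbar_congr h0, pdzbar_const]
    rw [h1]
    simp only [Pi.zero_apply, norm_zero, ne_eq, OfNat.ofNat_ne_zero, not_false_eq_true, zero_pow,
      Finset.sum_const_zero]
    positivity

/-- The quotient `f / (z - x)ⁿ`, cut off by `χ`, has `L²` norm at most `(2 / R)ⁿ` times a constant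
that does not depend on `n`. The smallness of `R` allows one to absorb the term containing the
quotient itself. -/
theorem integral_cutoff_quotient_le {g : ℂ → ι → ℂ} {f : ℂ → ι → ℂ}
    {M : ℂ → (ι → ℂ) →L[ℂ] (ι → ℂ)}
    {Ω : Set ℂ} (hΩ : IsOpen Ω) (hf : ContDiffOn ℝ ∞ f Ω) (hg : ContDiffOn ℝ ∞ g Ω)
    (hgM : ∀ z ∈ Ω, pdzbar g z = M z (g z)) {x : ℂ} (χ : ContDiffBump x)
    (hχ : Metric.closedBall x χ.rOut ⊆ Ω) (hin : χ.rIn = χ.rOut / 2) {K : ℝ}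
    (hM : ∀ z ∈ Metric.closedBall x χ.rOut, ‖M z‖ ≤ K)
    (hK : 64 * χ.rOut ^ 2 * (Fintype.card ι * K ^ 2) ≤ 1) {n : ℕ}
    (hfg : ∀ z ∈ Ω, f z = (z - x) ^ n • g z) :
    ∫ z, ∑ i, ‖(χ z • g z) i‖ ^ 2 ≤ (2 / χ.rOut) ^ (2 * n) * (64 * χ.rOut ^ 2 *
      ∫ z, ‖pdzbar (fun w => (χ w : ℂ)) z‖ ^ 2 * ∑ i, ‖f z i‖ ^ 2) := by
  have hs := contDiff_bump_smul hΩ hg χ hχ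
  have hR := χ.rOut_pos
  set R := χ.rOut with hRdef
  set v : ℂ → ι → ℂ := fun z => χ z • g z with hv
  set N : ℝ := Fintype.card ι * K ^ 2 with hN
  have hχc : ContDiff ℝ ∞ (fun w => (χ w : ℂ)) := Complex.ofRealCLM.contDiff.comp χ.contDiff
  have hd : ∀ z i, pdzbar (fun z => v z i) z = pdzbar v z i := fun z i =>
    pdzbar_clm (ContinuousLinearMap.proj (R := ℂ) (φ := fun _ : ι => ℂ) i)
      (hs.differentiable (by simp) z)
  have hvi : ∀ i, ContDiff ℝ ∞ (fun z => v z i) := fun i => contDiff_pi.1 hs i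
  have hsupp : ∀ i, Function.support (fun z => v z i) ⊆ Function.support χ := by
    intro i z hz
    rw [Function.mem_support] at hz ⊢
    contrapose! hz
    simp [hv, hz]
  have hvc : ∀ i, HasCompactSupport (fun z => v z i) := fun i =>
    χ.hasCompactSupport.mono (hsupp i)
  have hvt : ∀ i, tsupport (fun z => v z i) ⊆ Metric.closedBall x R := fun i =>
    (closure_mono (hsupp i)).trans χ.tsupport_eq.subset
  have hsq : ∀ {u : ℂ → ℂ}, Continuous u → HasCompactSupport u →
      Integrable (fun z => ‖u z‖ ^ 2) := fun {u} hu huc => by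
    have h1 : Continuous fun z => ‖u z‖ ^ 2 := hu.norm.pow 2
    have h2 : HasCompactSupport fun z => ‖u z‖ ^ 2 :=
      huc.comp_left (g := fun w : ℂ => ‖w‖ ^ 2) (by simp)
    exact h1.integrable_of_hasCompactSupport h2
  have I1 : ∀ i, Integrable (fun z => ‖v z i‖ ^ 2) := fun i => hsq (hvi i).continuous (hvc i)
  have I2 : ∀ i, Integrable (fun z => ‖pdzbar v z i‖ ^ 2) := by
    intro i
    have hc : HasCompactSupport (pdzbar fun z => v z i) := by
      refine HasCompactSupport.intro (isCompact_closedBall x R) fun z hz => ?_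
      rw [pdzbar, fderiv_of_notMem_tsupport (𝕜 := ℝ) fun h => hz (hvt i h)]
      simp
    have := hsq (contDiff_pdzbar (hvi i)).continuous hc
    simpa only [hd] using this
  have I3 : Integrable (fun z => ‖pdzbar (fun w => (χ w : ℂ)) z‖ ^ 2 * ∑ i, ‖f z i‖ ^ 2) := by
    have hcont : ContinuousOn (fun z => ‖pdzbar (fun w => (χ w : ℂ)) z‖ ^ 2 * ∑ i, ‖f z i‖ ^ 2)
        (Metric.closedBall x R) := by
      refine ContinuousOn.mono ?_ hχ
      refine ((contDiff_pdzbar hχc).continuous.norm.pow 2).continuousOn.mul ?_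
      exact continuousOn_finsetSum _ fun i _ =>
        ((continuous_apply i).comp_continuousOn hf.continuousOn).norm.pow 2
    refine (integrableOn_iff_integrable_of_support_subset (fun z hz => ?_)).1
      (hcont.integrableOn_compact (isCompact_closedBall x R))
    by_contra hz'
    refine hz ?_
    have h0 : (fun w => (χ w : ℂ)) =ᶠ[nhds z] fun _ => 0 := by
      filter_upwards [Metric.isClosed_closedBall.isOpen_compl.mem_nhds hz'] with w hw
      rw [Set.mem_compl_iff, Metric.mem_closedBall, not_le] at hw
      rw [χ.zero_of_le_dist hw.le, Complex.ofReal_zero]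
    simp [pdzbar_congr h0]
  have hpt : ∀ z, ∑ i, ‖pdzbar v z i‖ ^ 2 ≤ 2 * ((2 / R) ^ (2 * n) *
      (‖pdzbar (fun w => (χ w : ℂ)) z‖ ^ 2 * ∑ i, ‖f z i‖ ^ 2)) + 2 * N * ∑ i, ‖v z i‖ ^ 2 :=
    sum_norm_sq_pdzbar_cutoff_le hΩ hg hgM χ hχ hin hM hfg
  have hstep : ∫ z, ∑ i, ‖v z i‖ ^ 2 ≤ 16 * R ^ 2 * ∫ z, ∑ i, ‖pdzbar v z i‖ ^ 2 := by
    rw [integral_finsetSum _ fun i _ => I1 i, integral_finsetSum _ fun i _ => I2 i,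
      Finset.mul_sum]
    refine Finset.sum_le_sum fun i _ => ?_
    have := integral_norm_sq_le_integral_pdzbar (hvi i) (hvc i) (hvt i)
    simpa only [hd] using this
  have hI1 : Integrable (fun z => ∑ i, ‖v z i‖ ^ 2) := integrable_finsetSum _ fun i _ => I1 i
  have hstep2 := integral_mono (integrable_finsetSum Finset.univ fun i _ => I2 i)
    (((I3.const_mul ((2 / R) ^ (2 * n))).const_mul 2).add (hI1.const_mul (2 * N))) hpt
  simp only [Pi.add_apply] at hstep2
  rw [integral_add ((I3.const_mul _).const_mul _) (hI1.const_mul _), integral_const_mul,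
    integral_const_mul, integral_const_mul] at hstep2
  have hA : 0 ≤ ∫ z, ∑ i, ‖v z i‖ ^ 2 := integral_nonneg fun z => by positivity
  set A := ∫ z, ∑ i, ‖v z i‖ ^ 2
  set B := ∫ z, ‖pdzbar (fun w => (χ w : ℂ)) z‖ ^ 2 * ∑ i, ‖f z i‖ ^ 2
  have h1 : A ≤ 16 * R ^ 2 * (2 * ((2 / R) ^ (2 * n) * B) + 2 * N * A) :=
    hstep.trans (by gcongr)
  have h2 : 64 * R ^ 2 * N * A ≤ A := by nlinarith
  nlinarith

/-- A solution of `∂f/∂z̄ = M f` that is divisible by every power of `z - x` vanishes near `x`: on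
the disc of radius `R / 4` the `L²` norm of `f` is at most `(R / 4)ⁿ` times that of the quotient,
hence at most a constant times `(1 / 2)ⁿ`. -/
theorem eventually_eq_zero_of_forall_divisible {f : ℂ → ι → ℂ} {M : ℂ → (ι → ℂ) →L[ℂ] (ι → ℂ)}
    {Ω : Set ℂ} (hΩ : IsOpen Ω) (hf : ContDiffOn ℝ ∞ f Ω) (hM : ContDiffOn ℝ ∞ M Ω)
    {x : ℂ} (hx : x ∈ Ω)
    (hdiv : ∀ n : ℕ, ∃ g : ℂ → ι → ℂ, ContDiffOn ℝ ∞ g Ω ∧ (∀ z ∈ Ω, f z = (z - x) ^ n • g z) ∧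
      ∀ z ∈ Ω, pdzbar g z = M z (g z)) : ∀ᶠ z in nhds x, f z = 0 := by
  obtain ⟨r, hr, hrΩ⟩ := Metric.nhds_basis_closedBall.mem_iff.1 (hΩ.mem_nhds hx)
  obtain ⟨K, hK⟩ := (isCompact_closedBall x r).exists_bound_of_continuousOn
    (hM.continuousOn.mono hrΩ)
  obtain ⟨R, hR, hRr, hRK⟩ : ∃ R : ℝ, 0 < R ∧ R ≤ r ∧
      64 * R ^ 2 * (Fintype.card ι * K ^ 2) ≤ 1 := by
    have h1 : Filter.Tendsto (fun R : ℝ => 64 * R ^ 2 * (Fintype.card ι * K ^ 2))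
        (nhdsWithin 0 (Set.Ioi 0)) (nhds 0) := by
      have : Continuous fun R : ℝ => 64 * R ^ 2 * (Fintype.card ι * K ^ 2) := by fun_prop
      simpa using (this.tendsto 0).mono_left nhdsWithin_le_nhds
    obtain ⟨R, h2, h3, h4⟩ := ((h1.eventually (ge_mem_nhds one_pos)).and
      ((Ioc_mem_nhdsGT hr))).exists
    exact ⟨R, h3, h4, h2⟩
  let χ : ContDiffBump x := ⟨R / 2, R, by positivity, by linarith⟩
  have hball : Metric.closedBall x R ⊆ Metric.closedBall x r :=
    Metric.closedBall_subset_closedBall hRr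
  have hχΩ : Metric.closedBall x χ.rOut ⊆ Ω := hball.trans hrΩ
  set B : ℝ := 64 * R ^ 2 * ∫ z, ‖pdzbar (fun w => (χ w : ℂ)) z‖ ^ 2 * ∑ i, ‖f z i‖ ^ 2 with hB
  have hB0 : 0 ≤ B := by
    have : 0 ≤ ∫ z, ‖pdzbar (fun w => (χ w : ℂ)) z‖ ^ 2 * ∑ i, ‖f z i‖ ^ 2 :=
      integral_nonneg fun z => by positivity
    positivity
  have hcont : ContinuousOn (fun z => ∑ i, ‖f z i‖ ^ 2) Ω := by
    have := fun i => (continuous_apply i).comp_continuousOn hf.continuousOn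
    exact continuousOn_finsetSum _ fun i _ => ((this i).norm.pow 2)
  have hsub : Metric.closedBall x (R / 4) ⊆ Ω :=
    (Metric.closedBall_subset_closedBall (by linarith)).trans hχΩ
  have hint : IntegrableOn (fun z => ∑ i, ‖f z i‖ ^ 2) (Metric.closedBall x (R / 4)) :=
    (hcont.mono hsub).integrableOn_compact (isCompact_closedBall _ _)
  have hle : ∀ n : ℕ, ∫ z in Metric.closedBall x (R / 4), ∑ i, ‖f z i‖ ^ 2 ≤ (1 / 4) ^ n * B := by
    intro n
    obtain ⟨g, hg, hfg, hgM⟩ := hdiv n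
    have h1 := integral_cutoff_quotient_le hΩ hf hg hgM χ hχΩ rfl
      (fun z hz => hK z (hball hz)) hRK hfg
    have hs := contDiff_bump_smul hΩ hg χ hχΩ
    have hsi := fun i => (continuous_apply i).comp hs.continuous
    have hci : Continuous fun z => ∑ i, ‖(χ z • g z) i‖ ^ 2 :=
      continuous_finsetSum _ fun i _ => ((hsi i).norm.pow 2)
    have hcs : HasCompactSupport fun z => ∑ i, ‖(χ z • g z) i‖ ^ 2 := by
      refine χ.hasCompactSupport.mono fun z hz => ?_
      rw [Function.mem_support] at hz ⊢
      contrapose! hz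
      simp [hz]
    have hgi := hci.integrable_of_hasCompactSupport hcs (μ := volume)
    have h2 : ∫ z in Metric.closedBall x (R / 4), ∑ i, ‖f z i‖ ^ 2
        ≤ ∫ z in Metric.closedBall x (R / 4), (R / 4) ^ (2 * n) * ∑ i, ‖(χ z • g z) i‖ ^ 2 := by
      refine setIntegral_mono_on hint ((hgi.const_mul _).integrableOn)
        Metric.isClosed_closedBall.measurableSet fun z hz => ?_
      have hz1 : χ z = 1 := χ.one_of_mem_closedBall
        (Metric.closedBall_subset_closedBall (show R / 4 ≤ R / 2 by linarith) hz)
      have hz2 : ‖z - x‖ ≤ R / 4 := by simpa [dist_eq_norm] using hz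
      rw [Finset.mul_sum]
      refine Finset.sum_le_sum fun i _ => ?_
      rw [hz1, one_smul, hfg z (hsub hz), Pi.smul_apply, norm_smul, mul_pow, norm_pow, ← pow_mul,
        mul_comm n 2]
      gcongr
    have h3 : ∫ z in Metric.closedBall x (R / 4), (R / 4) ^ (2 * n) * ∑ i, ‖(χ z • g z) i‖ ^ 2
        ≤ ∫ z, (R / 4) ^ (2 * n) * ∑ i, ‖(χ z • g z) i‖ ^ 2 :=
      setIntegral_le_integral (hgi.const_mul _) (Filter.Eventually.of_forall fun z => by
        simp only [Pi.zero_apply]; positivity)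
    calc _ ≤ _ := (h2.trans h3).trans_eq (integral_const_mul _ _)
      _ ≤ (R / 4) ^ (2 * n) * ((2 / R) ^ (2 * n) * B) := by gcongr
      _ = (1 / 4) ^ n * B := by
        rw [← mul_assoc, ← mul_pow, pow_mul]
        congr 2
        field_simp
        norm_num
  have hzero : ∫ z in Metric.closedBall x (R / 4), ∑ i, ‖f z i‖ ^ 2 ≤ 0 := by
    have : Filter.Tendsto (fun n : ℕ => ((1 : ℝ) / 4) ^ n * B) Filter.atTop (nhds (0 * B)) :=
      (tendsto_pow_atTop_nhds_zero_of_lt_one (by norm_num) (by norm_num)).mul_const B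
    rw [zero_mul] at this
    exact ge_of_tendsto' this hle
  have hzero' : ∫ z in Metric.ball x (R / 4), ∑ i, ‖f z i‖ ^ 2 = 0 :=
    le_antisymm ((setIntegral_mono_set hint (Filter.Eventually.of_forall fun z => by
      simp only [Pi.zero_apply]; positivity)
      Metric.ball_subset_closedBall.eventuallyLE).trans hzero)
      (integral_nonneg fun z => by positivity)
  have hae : (fun z => ∑ i, ‖f z i‖ ^ 2) =ᵐ[volume.restrict (Metric.ball x (R / 4))] 0 :=
    (setIntegral_eq_zero_iff_of_nonneg_ae (Filter.Eventually.of_forall fun z => by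
      simp only [Pi.zero_apply]; positivity)
      (hint.mono_set Metric.ball_subset_closedBall)).1 hzero'
  have heq := Measure.eqOn_open_of_ae_eq hae Metric.isOpen_ball
    (hcont.mono (Metric.ball_subset_closedBall.trans hsub)) continuousOn_const
  filter_upwards [Metric.ball_mem_nhds x (show 0 < R / 4 by positivity)] with z hz
  have h1 := heq hz
  simp only [Pi.zero_apply] at h1
  rw [Finset.sum_eq_zero_iff_of_nonneg (fun i _ => by positivity)] at h1
  funext i
  simpa using h1 i (Finset.mem_univ i)

/-- **Finite order of vanishing**: a smooth solution of a linear equation `∂f/∂z̄ = M f` that does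
not vanish near `x` is `(z - x)ⁿ` times a smooth solution that is nonzero at `x`. -/
theorem eventually_eq_zero_or_exists_order {f : ℂ → ι → ℂ} {M : ℂ → (ι → ℂ) →L[ℂ] (ι → ℂ)}
    {Ω : Set ℂ} (hΩ : IsOpen Ω) (hf : ContDiffOn ℝ ∞ f Ω) (hM : ContDiffOn ℝ ∞ M Ω)
    (hfM : ∀ z ∈ Ω, pdzbar f z = M z (f z)) {x : ℂ} (hx : x ∈ Ω) :
    (∀ᶠ z in nhds x, f z = 0) ∨ ∃ (n : ℕ) (g : ℂ → ι → ℂ), ContDiffOn ℝ ∞ g Ω ∧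
      (∀ z ∈ Ω, f z = (z - x) ^ n • g z) ∧ g x ≠ 0 := by
  by_cases h : ∀ n : ℕ, ∃ g : ℂ → ι → ℂ, ContDiffOn ℝ ∞ g Ω ∧
      (∀ z ∈ Ω, f z = (z - x) ^ n • g z) ∧ ∀ z ∈ Ω, pdzbar g z = M z (g z)
  · exact Or.inl (eventually_eq_zero_of_forall_divisible hΩ hf hM hx h)
  right
  by_contra! hne
  refine h fun n => ?_
  induction n with
  | zero => exact ⟨f, hf, fun z _ => by simp, hfM⟩
  | succ n ih =>
    obtain ⟨g, hg, hfg, hgM⟩ := ih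
    obtain ⟨g', hg', hgg', hgM'⟩ := exists_division hΩ hg hM hgM hx (hne n g hg hfg)
    refine ⟨g', hg', fun z hz => ?_, hgM'⟩
    rw [hfg z hz, hgg' z hz, smul_smul, pow_succ]

end FiniteOrder

/-! ### The Lorentz form -/

section Lorentz

variable {m : ℕ}

/-- The complex bilinear Lorentz form as a continuous bilinear map. -/
def lorentzB (m : ℕ) : (Fin (m + 1) → ℂ) →L[ℂ] (Fin (m + 1) → ℂ) →L[ℂ] ℂ :=
  -(ContinuousLinearMap.proj (R := ℂ) (φ := fun _ : Fin (m + 1) => ℂ) 0).smulRight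
      (ContinuousLinearMap.proj (R := ℂ) (φ := fun _ : Fin (m + 1) => ℂ) 0)
    + ∑ i : Fin m, (ContinuousLinearMap.proj (R := ℂ) (φ := fun _ : Fin (m + 1) => ℂ)
      i.succ).smulRight (ContinuousLinearMap.proj (R := ℂ) (φ := fun _ : Fin (m + 1) => ℂ) i.succ)

theorem lorentzB_apply (x y : Fin (m + 1) → ℂ) : lorentzB m x y = lorentz x y := by
  simp [lorentzB, lorentz]

theorem lorentz_comm (x y : Fin (m + 1) → ℂ) : lorentz x y = lorentz y x := by
  simp [lorentz, mul_comm]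

theorem lorentz_add_left (x y w : Fin (m + 1) → ℂ) :
    lorentz (x + y) w = lorentz x w + lorentz y w := by
  simp [← lorentzB_apply]

theorem lorentz_sub_left (x y w : Fin (m + 1) → ℂ) :
    lorentz (x - y) w = lorentz x w - lorentz y w := by
  simp [← lorentzB_apply]

theorem lorentz_smul_left (c : ℂ) (x w : Fin (m + 1) → ℂ) :
    lorentz (c • x) w = c * lorentz x w := by
  simp [← lorentzB_apply]

theorem lorentz_add_right (x y w : Fin (m + 1) → ℂ) :
    lorentz w (x + y) = lorentz w x + lorentz w y := by
  simp [← lorentzB_apply]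

theorem lorentz_sub_right (x y w : Fin (m + 1) → ℂ) :
    lorentz w (x - y) = lorentz w x - lorentz w y := by
  simp [← lorentzB_apply]

theorem lorentz_smul_right (c : ℂ) (x w : Fin (m + 1) → ℂ) :
    lorentz w (c • x) = c * lorentz w x := by
  simp [← lorentzB_apply]

theorem lorentz_zero_left (w : Fin (m + 1) → ℂ) : lorentz 0 w = 0 := by
  simp [← lorentzB_apply]

theorem lorentz_zero_right (w : Fin (m + 1) → ℂ) : lorentz w 0 = 0 := by
  simp [← lorentzB_apply]

theorem lorentz_star_star (x y : Fin (m + 1) → ℂ) :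
    lorentz (star x) (star y) = star (lorentz x y) := by
  simp [lorentz]

theorem pdz_lorentz {f g : ℂ → Fin (m + 1) → ℂ} {z : ℂ} (hf : DifferentiableAt ℝ f z)
    (hg : DifferentiableAt ℝ g z) :
    pdz (fun w => lorentz (f w) (g w)) z = lorentz (dZ f z) (g z) + lorentz (f z) (dZ g z) := by
  simp only [← lorentzB_apply]
  exact pdz_bilin (lorentzB m) hf hg

theorem pdzbar_lorentz {f g : ℂ → Fin (m + 1) → ℂ} {z : ℂ} (hf : DifferentiableAt ℝ f z)
    (hg : DifferentiableAt ℝ g z) :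
    pdzbar (fun w => lorentz (f w) (g w)) z
      = lorentz (dZbar f z) (g z) + lorentz (f z) (dZbar g z) := by
  simp only [← lorentzB_apply]
  exact pdzbar_bilin (lorentzB m) hf hg

theorem contDiffOn_lorentz {f g : ℂ → Fin (m + 1) → ℂ} {Ω : Set ℂ} (hf : ContDiffOn ℝ ∞ f Ω)
    (hg : ContDiffOn ℝ ∞ g Ω) : ContDiffOn ℝ ∞ (fun z => lorentz (f z) (g z)) Ω := by
  rw [contDiffOn_pi] at hf hg
  exact ((hf 0).mul (hg 0)).neg.add (ContDiffOn.sum fun i _ => (hf i.succ).mul (hg i.succ))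

theorem continuousAt_lorentz {f g : ℂ → Fin (m + 1) → ℂ} {z : ℂ} (hf : ContinuousAt f z)
    (hg : ContinuousAt g z) : ContinuousAt (fun z => lorentz (f z) (g z)) z := by
  simp only [← lorentzB_apply]
  exact ((lorentzB m).continuous.continuousAt.comp hf).clm_apply hg

theorem contDiffOn_star {f : ℂ → Fin (m + 1) → ℂ} {Ω : Set ℂ} (hf : ContDiffOn ℝ ∞ f Ω) :
    ContDiffOn ℝ ∞ (fun z => star (f z)) Ω :=
  contDiffOn_pi.2 fun i => Complex.conjCLE.contDiff.comp_contDiffOn (contDiffOn_pi.1 hf i)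

end Lorentz

/-! ### Canonical lifts and their structure equations -/

/-- The properties of the canonical lift `Y` on a coordinate domain `Ω` on which the local theory
depends: `Y` is smooth, real and null, and the metric it induces is `|dz|²`. -/
structure IsLift {m : ℕ} (Y : ℂ → Fin (m + 1) → ℂ) (Ω : Set ℂ) : Prop where
  isOpen : IsOpen Ω
  smooth : ContDiffOn ℝ ∞ Y Ω
  real : ∀ z ∈ Ω, star (Y z) = Y z
  null : ∀ z ∈ Ω, lorentz (Y z) (Y z) = 0
  conformal : ∀ z ∈ Ω, lorentz (dZ Y z) (dZ Y z) = 0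
  normalized : ∀ z ∈ Ω, lorentz (dZ Y z) (dZbar Y z) = 1 / 2

/-- A smooth section over `Ω` of the complexified normal bundle. -/
structure IsNormalSection {m : ℕ} (Y ψ : ℂ → Fin (m + 1) → ℂ) (Ω : Set ℂ) : Prop where
  smooth : ContDiffOn ℝ ∞ ψ Ω
  mem : ∀ z ∈ Ω, ψ z ∈ normalSpace Y z

section Structure

variable {m : ℕ} {Y : ℂ → Fin (m + 1) → ℂ} {Ω : Set ℂ} {z : ℂ}

theorem mem_normalSpace_iff {v : Fin (m + 1) → ℂ} :
    v ∈ normalSpace Y z ↔ lorentz v (Y z) = 0 ∧ lorentz v (dZ Y z) = 0 ∧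
      lorentz v (dZbar Y z) = 0 ∧ lorentz v (dZ (dZbar Y) z) = 0 := by
  constructor
  · intro h
    refine ⟨h _ ?_, h _ ?_, h _ ?_, h _ ?_⟩ <;> exact Submodule.subset_span (by simp)
  · rintro ⟨h1, h2, h3, h4⟩ w hw
    induction hw using Submodule.span_induction with
    | mem x hx =>
      simp only [Set.mem_insert_iff, Set.mem_singleton_iff] at hx
      rcases hx with rfl | rfl | rfl | rfl <;> assumption
    | zero => exact lorentz_zero_right _
    | add x y _ _ hx hy => rw [lorentz_add_right, hx, hy, add_zero]
    | smul c x _ hx => rw [lorentz_smul_right, hx, mul_zero]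

theorem normalPart_add (v w : Fin (m + 1) → ℂ) :
    normalPart Y z (v + w) = normalPart Y z v + normalPart Y z w := by
  simp only [normalPart, lorentz_add_left]; module

theorem normalPart_sub (v w : Fin (m + 1) → ℂ) :
    normalPart Y z (v - w) = normalPart Y z v - normalPart Y z w := by
  simp only [normalPart, lorentz_sub_left]; module

theorem normalPart_smul (c : ℂ) (v : Fin (m + 1) → ℂ) :
    normalPart Y z (c • v) = c • normalPart Y z v := by
  simp only [normalPart, lorentz_smul_left]; module

namespace IsLift

theorem differentiableAt (h : IsLift Y Ω) (hz : z ∈ Ω) {E : Type*} [NormedAddCommGroup E]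
    [NormedSpace ℝ E] {f : ℂ → E} (hf : ContDiffOn ℝ ∞ f Ω) : DifferentiableAt ℝ f z :=
  (hf.contDiffAt (h.isOpen.mem_nhds hz)).differentiableAt (by simp)

theorem contDiffOn_dZ (h : IsLift Y Ω) {f : ℂ → Fin (m + 1) → ℂ} (hf : ContDiffOn ℝ ∞ f Ω) :
    ContDiffOn ℝ ∞ (dZ f) Ω :=
  contDiffOn_pdz h.isOpen hf

theorem contDiffOn_dZbar (h : IsLift Y Ω) {f : ℂ → Fin (m + 1) → ℂ} (hf : ContDiffOn ℝ ∞ f Ω) :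
    ContDiffOn ℝ ∞ (dZbar f) Ω :=
  contDiffOn_pdzbar h.isOpen hf

theorem dZ_dZbar_comm (h : IsLift Y Ω) (hz : z ∈ Ω) {f : ℂ → Fin (m + 1) → ℂ}
    (hf : ContDiffOn ℝ ∞ f Ω) : dZ (dZbar f) z = dZbar (dZ f) z :=
  pdz_pdzbar_comm h.isOpen hf hz

/-- If `⟨f, g⟩` is constant on `Ω`, its `z`-derivative vanishes. -/
theorem lorentz_dZ_add (h : IsLift Y Ω) (hz : z ∈ Ω) {f g : ℂ → Fin (m + 1) → ℂ} {c : ℂ}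
    (hf : ContDiffOn ℝ ∞ f Ω) (hg : ContDiffOn ℝ ∞ g Ω)
    (hc : ∀ w ∈ Ω, lorentz (f w) (g w) = c) :
    lorentz (dZ f z) (g z) + lorentz (f z) (dZ g z) = 0 := by
  rw [← pdz_lorentz (h.differentiableAt hz hf) (h.differentiableAt hz hg)]
  exact (pdz_congr_on (g := fun _ => c) h.isOpen hc hz).trans (pdz_const c z)

/-- If `⟨f, g⟩` is constant on `Ω`, its `z̄`-derivative vanishes. -/
theorem lorentz_dZbar_add (h : IsLift Y Ω) (hz : z ∈ Ω) {f g : ℂ → Fin (m + 1) → ℂ} {c : ℂ}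
    (hf : ContDiffOn ℝ ∞ f Ω) (hg : ContDiffOn ℝ ∞ g Ω)
    (hc : ∀ w ∈ Ω, lorentz (f w) (g w) = c) :
    lorentz (dZbar f z) (g z) + lorentz (f z) (dZbar g z) = 0 := by
  rw [← pdzbar_lorentz (h.differentiableAt hz hf) (h.differentiableAt hz hg)]
  exact (pdzbar_congr_on (g := fun _ => c) h.isOpen hc hz).trans (pdzbar_const c z)

theorem dZ_star (h : IsLift Y Ω) (hz : z ∈ Ω) {f : ℂ → Fin (m + 1) → ℂ}
    (hf : ContDiffOn ℝ ∞ f Ω) : dZ (fun w => star (f w)) z = star (dZbar f z) :=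
  pdz_star (h.differentiableAt hz hf)

theorem dZbar_star (h : IsLift Y Ω) (hz : z ∈ Ω) {f : ℂ → Fin (m + 1) → ℂ}
    (hf : ContDiffOn ℝ ∞ f Ω) : dZbar (fun w => star (f w)) z = star (dZ f z) :=
  pdzbar_star (h.differentiableAt hz hf)

theorem star_dZbar (h : IsLift Y Ω) (hz : z ∈ Ω) : star (dZbar Y z) = dZ Y z := by
  rw [← h.dZ_star hz h.smooth]
  exact pdz_congr_on h.isOpen h.real hz

theorem star_dZ (h : IsLift Y Ω) (hz : z ∈ Ω) : star (dZ Y z) = dZbar Y z := by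
  rw [← h.star_dZbar hz, star_star]

theorem star_dZ_dZbar (h : IsLift Y Ω) (hz : z ∈ Ω) :
    star (dZ (dZbar Y) z) = dZ (dZbar Y) z := by
  rw [h.dZ_dZbar_comm hz h.smooth]
  conv_rhs => rw [← h.dZ_dZbar_comm hz h.smooth]
  rw [← h.dZ_star hz (h.contDiffOn_dZ h.smooth)]
  exact pdz_congr_on h.isOpen (fun w hw => h.star_dZ hw) hz

theorem lorentz_dZ_self (h : IsLift Y Ω) (hz : z ∈ Ω) : lorentz (dZ Y z) (Y z) = 0 := by
  have h1 := h.lorentz_dZ_add hz h.smooth h.smooth h.null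
  rw [lorentz_comm (Y z)] at h1
  linear_combination h1 / 2

theorem lorentz_dZbar_self (h : IsLift Y Ω) (hz : z ∈ Ω) : lorentz (dZbar Y z) (Y z) = 0 := by
  have h1 := h.lorentz_dZbar_add hz h.smooth h.smooth h.null
  rw [lorentz_comm (Y z)] at h1
  linear_combination h1 / 2

theorem lorentz_dZbar_dZbar (h : IsLift Y Ω) (hz : z ∈ Ω) :
    lorentz (dZbar Y z) (dZbar Y z) = 0 := by
  rw [← h.star_dZ hz, lorentz_star_star, h.conformal z hz, star_zero]

theorem lorentz_laplace_self (h : IsLift Y Ω) (hz : z ∈ Ω) :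
    lorentz (dZ (dZbar Y) z) (Y z) = -1 / 2 := by
  have h1 := h.lorentz_dZ_add hz (h.contDiffOn_dZbar h.smooth) h.smooth
    (fun w hw => h.lorentz_dZbar_self hw)
  rw [lorentz_comm (dZbar Y z), h.normalized z hz] at h1
  linear_combination h1

theorem lorentz_laplace_dZ (h : IsLift Y Ω) (hz : z ∈ Ω) :
    lorentz (dZ (dZbar Y) z) (dZ Y z) = 0 := by
  have h1 := h.lorentz_dZbar_add hz (h.contDiffOn_dZ h.smooth) (h.contDiffOn_dZ h.smooth)
    h.conformal
  rw [lorentz_comm (dZ Y z), ← h.dZ_dZbar_comm hz h.smooth] at h1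
  linear_combination h1 / 2

theorem lorentz_laplace_dZbar (h : IsLift Y Ω) (hz : z ∈ Ω) :
    lorentz (dZ (dZbar Y) z) (dZbar Y z) = 0 := by
  rw [← h.star_dZ_dZbar hz, ← h.star_dZ hz, lorentz_star_star, h.lorentz_laplace_dZ hz, star_zero]

theorem lorentz_N_self (h : IsLift Y Ω) (hz : z ∈ Ω) : lorentz (sectionN Y z) (Y z) = -1 := by
  simp only [sectionN, lorentz_add_left, lorentz_smul_left, h.lorentz_laplace_self hz, h.null z hz]
  ring

theorem lorentz_N_dZ (h : IsLift Y Ω) (hz : z ∈ Ω) : lorentz (sectionN Y z) (dZ Y z) = 0 := by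
  simp only [sectionN, lorentz_add_left, lorentz_smul_left, h.lorentz_laplace_dZ hz,
    lorentz_comm (Y z), h.lorentz_dZ_self hz]
  ring

theorem lorentz_N_dZbar (h : IsLift Y Ω) (hz : z ∈ Ω) :
    lorentz (sectionN Y z) (dZbar Y z) = 0 := by
  simp only [sectionN, lorentz_add_left, lorentz_smul_left, h.lorentz_laplace_dZbar hz,
    lorentz_comm (Y z), h.lorentz_dZbar_self hz]
  ring

theorem lorentz_N_N (h : IsLift Y Ω) (hz : z ∈ Ω) :
    lorentz (sectionN Y z) (sectionN Y z) = 0 := by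
  simp only [sectionN, lorentz_add_left, lorentz_smul_left, lorentz_add_right, lorentz_smul_right,
    h.lorentz_laplace_self hz, h.null z hz, lorentz_comm (Y z)]
  ring

theorem star_sectionN (h : IsLift Y Ω) (hz : z ∈ Ω) : star (sectionN Y z) = sectionN Y z := by
  have h1 : star (lorentz (dZ (dZbar Y) z) (dZ (dZbar Y) z))
      = lorentz (dZ (dZbar Y) z) (dZ (dZbar Y) z) := by
    rw [← lorentz_star_star, h.star_dZ_dZbar hz]
  simp only [sectionN, star_add, star_smul, star_mul', h1, h.star_dZ_dZbar hz, h.real z hz]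
  simp

theorem normalPart_mem (h : IsLift Y Ω) (hz : z ∈ Ω) (v : Fin (m + 1) → ℂ) :
    normalPart Y z v ∈ normalSpace Y z := by
  have hY : lorentz (normalPart Y z v) (Y z) = 0 := by
    simp only [normalPart, lorentz_add_left, lorentz_sub_left, lorentz_smul_left, h.null z hz,
      h.lorentz_N_self hz, h.lorentz_dZ_self hz, h.lorentz_dZbar_self hz]
    ring
  have hN : lorentz (normalPart Y z v) (sectionN Y z) = 0 := by
    simp only [normalPart, lorentz_add_left, lorentz_sub_left, lorentz_smul_left,
      lorentz_comm (Y z) (sectionN Y z), lorentz_comm (dZ Y z) (sectionN Y z),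
      lorentz_comm (dZbar Y z) (sectionN Y z), h.lorentz_N_N hz, h.lorentz_N_self hz, h.lorentz_N_dZ hz,
      h.lorentz_N_dZbar hz]
    ring
  refine mem_normalSpace_iff.2 ⟨hY, ?_, ?_, ?_⟩
  · simp only [normalPart, lorentz_add_left, lorentz_sub_left, lorentz_smul_left,
      h.conformal z hz, h.lorentz_N_dZ hz, lorentz_comm (Y z), h.lorentz_dZ_self hz,
      lorentz_comm (dZbar Y z), h.normalized z hz]
    ring
  · simp only [normalPart, lorentz_add_left, lorentz_sub_left, lorentz_smul_left,
      h.lorentz_dZbar_dZbar hz, h.lorentz_N_dZbar hz, lorentz_comm (Y z), h.lorentz_dZbar_self hz,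
      h.normalized z hz]
    ring
  · have h1 : (2 : ℂ) • dZ (dZbar Y) z
        = sectionN Y z - (2 * lorentz (dZ (dZbar Y) z) (dZ (dZbar Y) z)) • Y z := by
      simp [sectionN]
    have h2 : (2 : ℂ) * lorentz (normalPart Y z v) (dZ (dZbar Y) z) = 0 := by
      rw [← lorentz_smul_right, h1, lorentz_sub_right, lorentz_smul_right, hN, hY]
      ring
    simpa using h2

theorem lorentz_N_of_mem {v : Fin (m + 1) → ℂ}
    (hv : v ∈ normalSpace Y z) : lorentz v (sectionN Y z) = 0 := by
  obtain ⟨h1, -, -, h4⟩ := mem_normalSpace_iff.1 hv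
  simp [sectionN, lorentz_add_right, lorentz_smul_right, h1, h4]

theorem normalPart_of_mem {v : Fin (m + 1) → ℂ}
    (hv : v ∈ normalSpace Y z) : normalPart Y z v = v := by
  obtain ⟨h1, h2, h3, -⟩ := mem_normalSpace_iff.1 hv
  simp [normalPart, h1, h2, h3, lorentz_N_of_mem hv]

theorem normalPart_self (h : IsLift Y Ω) (hz : z ∈ Ω) : normalPart Y z (Y z) = 0 := by
  simp [normalPart, lorentz_comm (Y z), h.null z hz, h.lorentz_N_self hz, h.lorentz_dZ_self hz,
    h.lorentz_dZbar_self hz]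

theorem normalPart_N (h : IsLift Y Ω) (hz : z ∈ Ω) : normalPart Y z (sectionN Y z) = 0 := by
  simp [normalPart, h.lorentz_N_N hz, h.lorentz_N_self hz, h.lorentz_N_dZ hz,
    h.lorentz_N_dZbar hz]

theorem normalPart_dZ (h : IsLift Y Ω) (hz : z ∈ Ω) : normalPart Y z (dZ Y z) = 0 := by
  simp [normalPart, lorentz_comm _ (sectionN Y z), h.lorentz_N_dZ hz, h.lorentz_dZ_self hz,
    h.conformal z hz, h.normalized z hz]

theorem normalPart_dZbar (h : IsLift Y Ω) (hz : z ∈ Ω) : normalPart Y z (dZbar Y z) = 0 := by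
  simp [normalPart, lorentz_comm _ (sectionN Y z), h.lorentz_N_dZbar hz, h.lorentz_dZbar_self hz,
    h.lorentz_dZbar_dZbar hz, lorentz_comm (dZbar Y z) (dZ Y z), h.normalized z hz]

theorem normalPart_laplace (h : IsLift Y Ω) (hz : z ∈ Ω) :
    normalPart Y z (dZ (dZbar Y) z) = 0 := by
  have h1 : (2 : ℂ) • dZ (dZbar Y) z
      = sectionN Y z - (2 * lorentz (dZ (dZbar Y) z) (dZ (dZbar Y) z)) • Y z := by
    simp [sectionN]
  have h2 : (2 : ℂ) • normalPart Y z (dZ (dZbar Y) z) = 0 := by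
    rw [← normalPart_smul, h1, normalPart_sub, normalPart_smul, h.normalPart_N hz,
      h.normalPart_self hz]
    simp
  simpa using h2

theorem normalPart_of_mem_tangentialSpace (h : IsLift Y Ω) (hz : z ∈ Ω) {v : Fin (m + 1) → ℂ}
    (hv : v ∈ tangentialSpace Y z) : normalPart Y z v = 0 := by
  induction hv using Submodule.span_induction with
  | mem x hx =>
    simp only [Set.mem_insert_iff, Set.mem_singleton_iff] at hx
    rcases hx with rfl | rfl | rfl | rfl
    exacts [h.normalPart_self hz, h.normalPart_dZ hz, h.normalPart_dZbar hz,
      h.normalPart_laplace hz]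
  | zero => simp [normalPart, lorentz_zero_left]
  | add x y _ _ hx hy => rw [normalPart_add, hx, hy, add_zero]
  | smul c x _ hx => rw [normalPart_smul, hx, smul_zero]

theorem lorentz_normalPart_left (v : Fin (m + 1) → ℂ)
    {w : Fin (m + 1) → ℂ} (hw : w ∈ normalSpace Y z) :
    lorentz (normalPart Y z v) w = lorentz v w := by
  obtain ⟨h1, h2, h3, -⟩ := mem_normalSpace_iff.1 hw
  rw [lorentz_comm] at h1 h2 h3
  have h4 := lorentz_N_of_mem hw
  rw [lorentz_comm] at h4
  simp [normalPart, lorentz_add_left, lorentz_sub_left, lorentz_smul_left, h1, h2, h3, h4]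

theorem lorentz_normalPart_right (v : Fin (m + 1) → ℂ)
    {w : Fin (m + 1) → ℂ} (hw : w ∈ normalSpace Y z) :
    lorentz w (normalPart Y z v) = lorentz w v := by
  rw [lorentz_comm, lorentz_normalPart_left v hw, lorentz_comm]

theorem normalPart_star (h : IsLift Y Ω) (hz : z ∈ Ω) (v : Fin (m + 1) → ℂ) :
    normalPart Y z (star v) = star (normalPart Y z v) := by
  have e1 : lorentz (star v) (sectionN Y z) = star (lorentz v (sectionN Y z)) := by
    rw [← lorentz_star_star, h.star_sectionN hz]
  have e2 : lorentz (star v) (Y z) = star (lorentz v (Y z)) := by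
    rw [← lorentz_star_star, h.real z hz]
  have e3 : lorentz (star v) (dZbar Y z) = star (lorentz v (dZ Y z)) := by
    rw [← lorentz_star_star, h.star_dZ hz]
  have e4 : lorentz (star v) (dZ Y z) = star (lorentz v (dZbar Y z)) := by
    rw [← lorentz_star_star, h.star_dZbar hz]
  simp only [normalPart, e1, e2, e3, e4, star_add, star_sub, star_smul, star_mul', h.real z hz,
    h.star_sectionN hz, h.star_dZ hz, h.star_dZbar hz]
  simp
  module

theorem star_mem_normalSpace (h : IsLift Y Ω) (hz : z ∈ Ω) {v : Fin (m + 1) → ℂ}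
    (hv : v ∈ normalSpace Y z) : star v ∈ normalSpace Y z := by
  rw [← normalPart_of_mem hv, ← h.normalPart_star hz]
  exact h.normalPart_mem hz _

theorem contDiffOn_sectionN (h : IsLift Y Ω) : ContDiffOn ℝ ∞ (sectionN Y) Ω := by
  have h1 := h.contDiffOn_dZ (h.contDiffOn_dZbar h.smooth)
  have h2 := contDiffOn_lorentz h1 h1
  unfold sectionN
  exact (h1.const_smul _).add ((contDiffOn_const.mul h2).smul h.smooth)

theorem isNormalSection_normalPart (h : IsLift Y Ω) {f : ℂ → Fin (m + 1) → ℂ}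
    (hf : ContDiffOn ℝ ∞ f Ω) : IsNormalSection Y (fun z => normalPart Y z (f z)) Ω := by
  refine ⟨?_, fun z hz => h.normalPart_mem hz _⟩
  have h1 := h.contDiffOn_dZ h.smooth
  have h2 := h.contDiffOn_dZbar h.smooth
  have h3 := h.contDiffOn_sectionN
  unfold normalPart
  exact (((hf.add ((contDiffOn_lorentz hf h3).smul h.smooth)).add
    ((contDiffOn_lorentz hf h.smooth).smul h3)).sub
    ((contDiffOn_const.mul (contDiffOn_lorentz hf h2)).smul h1)).sub
    ((contDiffOn_const.mul (contDiffOn_lorentz hf h1)).smul h2)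

theorem isNormalSection_hopf (h : IsLift Y Ω) : IsNormalSection Y (hopf Y) Ω :=
  h.isNormalSection_normalPart (h.contDiffOn_dZ (h.contDiffOn_dZ h.smooth))

theorem isNormalSection_normalDZ (h : IsLift Y Ω) {ψ : ℂ → Fin (m + 1) → ℂ}
    (hψ : ContDiffOn ℝ ∞ ψ Ω) : IsNormalSection Y (normalDZ Y ψ) Ω :=
  h.isNormalSection_normalPart (h.contDiffOn_dZ hψ)

theorem isNormalSection_normalDZbar (h : IsLift Y Ω) {ψ : ℂ → Fin (m + 1) → ℂ}
    (hψ : ContDiffOn ℝ ∞ ψ Ω) : IsNormalSection Y (normalDZbar Y ψ) Ω :=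
  h.isNormalSection_normalPart (h.contDiffOn_dZbar hψ)

/-- `Y_zz = κ - (s/2) Y`. -/
theorem dZ_dZ (h : IsLift Y Ω) (hz : z ∈ Ω) :
    dZ (dZ Y) z = hopf Y z - (schwarzian Y z / 2) • Y z := by
  have s1 := h.contDiffOn_dZ h.smooth
  have h1 : lorentz (dZ (dZ Y) z) (Y z) = 0 := by
    have := h.lorentz_dZ_add hz s1 h.smooth (fun w hw => h.lorentz_dZ_self hw)
    rwa [h.conformal z hz, add_zero] at this
  have h2 : lorentz (dZ (dZ Y) z) (dZ Y z) = 0 := by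
    have := h.lorentz_dZ_add hz s1 s1 h.conformal
    rw [lorentz_comm (dZ Y z)] at this
    linear_combination this / 2
  have h3 : lorentz (dZ (dZ Y) z) (dZbar Y z) = 0 := by
    have := h.lorentz_dZ_add hz s1 (h.contDiffOn_dZbar h.smooth) h.normalized
    rwa [lorentz_comm (dZ Y z), h.lorentz_laplace_dZ hz, add_zero] at this
  simp only [hopf, normalPart, schwarzian, h1, h2, h3]
  module

/-- `Y_z̄z̄ = κ̄ - (s̄/2) Y`. -/
theorem dZbar_dZbar (h : IsLift Y Ω) (hz : z ∈ Ω) :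
    dZbar (dZbar Y) z = star (hopf Y z) - (star (schwarzian Y z) / 2) • Y z := by
  have h1 : dZbar (dZbar Y) z = star (dZ (dZ Y) z) := by
    rw [← h.dZbar_star hz (h.contDiffOn_dZ h.smooth)]
    exact pdzbar_congr_on h.isOpen (fun w hw => (h.star_dZ hw).symm) hz
  rw [h1, h.dZ_dZ hz, star_sub, star_smul, h.real z hz]
  simp

section NormalConnection

variable {ψ φ : ℂ → Fin (m + 1) → ℂ}

/-- The Weingarten equation for `∂ψ/∂z`. -/
theorem dZ_normalSection (h : IsLift Y Ω) (hψ : IsNormalSection Y ψ Ω) (hz : z ∈ Ω) :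
    dZ ψ z = normalDZ Y ψ z + lorentz (ψ z) (dZ (sectionN Y) z) • Y z
      - (2 * lorentz (ψ z) (hopf Y z)) • dZbar Y z := by
  have hm := fun w hw => mem_normalSpace_iff.1 (hψ.mem w hw)
  have h1 := h.lorentz_dZ_add hz hψ.smooth h.smooth (fun w hw => (hm w hw).1)
  have h2 := h.lorentz_dZ_add hz hψ.smooth (h.contDiffOn_dZ h.smooth) (fun w hw => (hm w hw).2.1)
  have h3 := h.lorentz_dZ_add hz hψ.smooth (h.contDiffOn_dZbar h.smooth)
    (fun w hw => (hm w hw).2.2.1)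
  have h4 := h.lorentz_dZ_add hz hψ.smooth h.contDiffOn_sectionN
    (fun w hw => lorentz_N_of_mem (hψ.mem w hw))
  obtain ⟨m1, m2, m3, m4⟩ := hm z hz
  rw [m2, add_zero] at h1
  rw [h.dZ_dZ hz, lorentz_sub_right, lorentz_smul_right, m1] at h2
  rw [m4, add_zero] at h3
  rw [normalDZ, normalPart, h1, h3, eq_neg_of_add_eq_zero_left h4, eq_neg_of_add_eq_zero_left h2]
  module

/-- The Weingarten equation for `∂ψ/∂z̄`. -/
theorem dZbar_normalSection (h : IsLift Y Ω) (hψ : IsNormalSection Y ψ Ω) (hz : z ∈ Ω) :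
    dZbar ψ z = normalDZbar Y ψ z + lorentz (ψ z) (dZbar (sectionN Y) z) • Y z
      - (2 * lorentz (ψ z) (star (hopf Y z))) • dZ Y z := by
  have hm := fun w hw => mem_normalSpace_iff.1 (hψ.mem w hw)
  have h1 := h.lorentz_dZbar_add hz hψ.smooth h.smooth (fun w hw => (hm w hw).1)
  have h2 := h.lorentz_dZbar_add hz hψ.smooth (h.contDiffOn_dZ h.smooth)
    (fun w hw => (hm w hw).2.1)
  have h3 := h.lorentz_dZbar_add hz hψ.smooth (h.contDiffOn_dZbar h.smooth)
    (fun w hw => (hm w hw).2.2.1)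
  have h4 := h.lorentz_dZbar_add hz hψ.smooth h.contDiffOn_sectionN
    (fun w hw => lorentz_N_of_mem (hψ.mem w hw))
  obtain ⟨m1, m2, m3, m4⟩ := hm z hz
  rw [m3, add_zero] at h1
  rw [← h.dZ_dZbar_comm hz h.smooth, m4, add_zero] at h2
  rw [h.dZbar_dZbar hz, lorentz_sub_right, lorentz_smul_right, m1] at h3
  rw [normalDZbar, normalPart, h1, h2, eq_neg_of_add_eq_zero_left h4,
    eq_neg_of_add_eq_zero_left h3]
  module

theorem pdz_lorentz_normal (h : IsLift Y Ω) (hψ : IsNormalSection Y ψ Ω)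
    (hφ : IsNormalSection Y φ Ω) (hz : z ∈ Ω) :
    pdz (fun w => lorentz (ψ w) (φ w)) z
      = lorentz (normalDZ Y ψ z) (φ z) + lorentz (ψ z) (normalDZ Y φ z) := by
  rw [pdz_lorentz (h.differentiableAt hz hψ.smooth) (h.differentiableAt hz hφ.smooth), normalDZ,
    normalDZ, lorentz_normalPart_left _ (hφ.mem z hz), lorentz_normalPart_right _ (hψ.mem z hz)]

theorem pdzbar_lorentz_normal (h : IsLift Y Ω) (hψ : IsNormalSection Y ψ Ω)
    (hφ : IsNormalSection Y φ Ω) (hz : z ∈ Ω) :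
    pdzbar (fun w => lorentz (ψ w) (φ w)) z
      = lorentz (normalDZbar Y ψ z) (φ z) + lorentz (ψ z) (normalDZbar Y φ z) := by
  rw [pdzbar_lorentz (h.differentiableAt hz hψ.smooth) (h.differentiableAt hz hφ.smooth),
    normalDZbar, normalDZbar, lorentz_normalPart_left _ (hφ.mem z hz),
    lorentz_normalPart_right _ (hψ.mem z hz)]

theorem lorentz_normalDZ_add (h : IsLift Y Ω) (hψ : IsNormalSection Y ψ Ω)
    (hφ : IsNormalSection Y φ Ω) {c : ℂ} (hc : ∀ w ∈ Ω, lorentz (ψ w) (φ w) = c) (hz : z ∈ Ω) :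
    lorentz (normalDZ Y ψ z) (φ z) + lorentz (ψ z) (normalDZ Y φ z) = 0 := by
  rw [← h.pdz_lorentz_normal hψ hφ hz]
  exact (pdz_congr_on (g := fun _ => c) h.isOpen hc hz).trans (pdz_const c z)

theorem lorentz_normalDZbar_add (h : IsLift Y Ω) (hψ : IsNormalSection Y ψ Ω)
    (hφ : IsNormalSection Y φ Ω) {c : ℂ} (hc : ∀ w ∈ Ω, lorentz (ψ w) (φ w) = c) (hz : z ∈ Ω) :
    lorentz (normalDZbar Y ψ z) (φ z) + lorentz (ψ z) (normalDZbar Y φ z) = 0 := by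
  rw [← h.pdzbar_lorentz_normal hψ hφ hz]
  exact (pdzbar_congr_on (g := fun _ => c) h.isOpen hc hz).trans (pdzbar_const c z)

/-- The Ricci equation `D_z̄ D_z ψ - D_z D_z̄ ψ = 2⟨ψ, κ⟩ κ̄ - 2⟨ψ, κ̄⟩ κ`. -/
theorem ricci (h : IsLift Y Ω) (hψ : IsNormalSection Y ψ Ω) (hz : z ∈ Ω) :
    normalDZbar Y (normalDZ Y ψ) z = normalDZ Y (normalDZbar Y ψ) z
      + (2 * lorentz (ψ z) (hopf Y z)) • star (hopf Y z)
      - (2 * lorentz (ψ z) (star (hopf Y z))) • hopf Y z := by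
  have sN := h.contDiffOn_sectionN
  have sκ := h.isNormalSection_hopf.smooth
  have sκ' := contDiffOn_star sκ
  have mκ := h.isNormalSection_hopf.mem z hz
  have sY := h.smooth
  have sZ := h.contDiffOn_dZ sY
  have sZb := h.contDiffOn_dZbar sY
  have e1 : normalDZbar Y (normalDZ Y ψ) z = normalPart Y z (dZbar (dZ ψ) z)
      + (2 * lorentz (ψ z) (hopf Y z)) • star (hopf Y z) := by
    have a1 := contDiffOn_lorentz hψ.smooth (h.contDiffOn_dZ sN)
    have a2 : ContDiffOn ℝ ∞ (fun w => 2 * lorentz (ψ w) (hopf Y w)) Ω :=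
      contDiffOn_const.mul (contDiffOn_lorentz hψ.smooth sκ)
    have hD : Set.EqOn (normalDZ Y ψ) (fun w => dZ ψ w - lorentz (ψ w) (dZ (sectionN Y) w) • Y w
        + (2 * lorentz (ψ w) (hopf Y w)) • dZbar Y w) Ω := fun w hw => by
      simp only [h.dZ_normalSection hψ hw]; module
    have hdiff := fun {f : ℂ → Fin (m + 1) → ℂ} (hf : ContDiffOn ℝ ∞ f Ω) =>
      h.differentiableAt hz hf
    have hb : dZbar (normalDZ Y ψ) z = dZbar (dZ ψ) z
        - (pdzbar (fun w => lorentz (ψ w) (dZ (sectionN Y) w)) z • Y z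
          + lorentz (ψ z) (dZ (sectionN Y) z) • dZbar Y z)
        + (pdzbar (fun w => 2 * lorentz (ψ w) (hopf Y w)) z • dZbar Y z
          + (2 * lorentz (ψ z) (hopf Y z)) • dZbar (dZbar Y) z) := by
      refine (pdzbar_congr_on h.isOpen hD hz).trans ?_
      refine (pdzbar_add (hdiff ((h.contDiffOn_dZ hψ.smooth).sub (a1.smul sY)))
        (hdiff (a2.smul sZb))).trans ?_
      refine congrArg₂ _ ((pdzbar_sub (hdiff (h.contDiffOn_dZ hψ.smooth))
        (hdiff (a1.smul sY))).trans (congrArg₂ _ rfl ?_)) ?_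
      · exact pdzbar_smul (h.differentiableAt hz a1) (hdiff sY)
      · exact pdzbar_smul (h.differentiableAt hz a2) (hdiff sZb)
    rw [normalDZbar, hb, h.dZbar_dZbar hz]
    simp only [normalPart_add, normalPart_sub, normalPart_smul, h.normalPart_self hz,
      h.normalPart_dZbar hz, normalPart_of_mem (h.star_mem_normalSpace hz mκ)]
    module
  have e2 : normalDZ Y (normalDZbar Y ψ) z = normalPart Y z (dZ (dZbar ψ) z)
      + (2 * lorentz (ψ z) (star (hopf Y z))) • hopf Y z := by
    have a1 := contDiffOn_lorentz hψ.smooth (h.contDiffOn_dZbar sN)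
    have a2 : ContDiffOn ℝ ∞ (fun w => 2 * lorentz (ψ w) (star (hopf Y w))) Ω :=
      contDiffOn_const.mul (contDiffOn_lorentz hψ.smooth sκ')
    have hD : Set.EqOn (normalDZbar Y ψ) (fun w => dZbar ψ w
        - lorentz (ψ w) (dZbar (sectionN Y) w) • Y w
        + (2 * lorentz (ψ w) (star (hopf Y w))) • dZ Y w) Ω := fun w hw => by
      simp only [h.dZbar_normalSection hψ hw]; module
    have hdiff := fun {f : ℂ → Fin (m + 1) → ℂ} (hf : ContDiffOn ℝ ∞ f Ω) =>
      h.differentiableAt hz hf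
    have hb : dZ (normalDZbar Y ψ) z = dZ (dZbar ψ) z
        - (pdz (fun w => lorentz (ψ w) (dZbar (sectionN Y) w)) z • Y z
          + lorentz (ψ z) (dZbar (sectionN Y) z) • dZ Y z)
        + (pdz (fun w => 2 * lorentz (ψ w) (star (hopf Y w))) z • dZ Y z
          + (2 * lorentz (ψ z) (star (hopf Y z))) • dZ (dZ Y) z) := by
      refine (pdz_congr_on h.isOpen hD hz).trans ?_
      refine (pdz_add (hdiff ((h.contDiffOn_dZbar hψ.smooth).sub (a1.smul sY)))
        (hdiff (a2.smul sZ))).trans ?_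
      refine congrArg₂ _ ((pdz_sub (hdiff (h.contDiffOn_dZbar hψ.smooth))
        (hdiff (a1.smul sY))).trans (congrArg₂ _ rfl ?_)) ?_
      · exact pdz_smul (h.differentiableAt hz a1) (hdiff sY)
      · exact pdz_smul (h.differentiableAt hz a2) (hdiff sZ)
    rw [normalDZ, hb, h.dZ_dZ hz]
    simp only [normalPart_add, normalPart_sub, normalPart_smul, h.normalPart_self hz,
      h.normalPart_dZ hz, normalPart_of_mem mκ]
    module
  rw [e1, e2, h.dZ_dZbar_comm hz hψ.smooth]
  module

end NormalConnection

end IsLift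

end Structure

/-! ### Willmore surfaces with isotropic Hopf differential -/

/-- The canonical lift of a Willmore surface with isotropic Hopf differential. -/
structure IsIsotropicWillmoreLift {m : ℕ} (Y : ℂ → Fin (m + 1) → ℂ) (Ω : Set ℂ) : Prop
    extends IsLift Y Ω where
  isotropic : ∀ z ∈ Ω, lorentz (hopf Y z) (hopf Y z) = 0
  willmore : ∀ z ∈ Ω, normalDZbar Y (normalDZbar Y (hopf Y)) z
    + (star (schwarzian Y z) / 2) • hopf Y z = 0

/-- The coefficient `⟨D_z κ, D_z̄ κ⟩` of the quartic differential of the surface. -/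
def quartic {m : ℕ} (Y : ℂ → Fin (m + 1) → ℂ) (z : ℂ) : ℂ :=
  lorentz (normalDZ Y (hopf Y) z) (normalDZbar Y (hopf Y) z)

/-- The bivector `κ ∧ D_z̄ κ`, written in coordinates as an antisymmetric matrix. -/
def hopfWedge {m : ℕ} (Y : ℂ → Fin (m + 1) → ℂ) (z : ℂ) : Fin (m + 1) × Fin (m + 1) → ℂ :=
  fun p => hopf Y z p.1 * normalDZbar Y (hopf Y) z p.2
    - hopf Y z p.2 * normalDZbar Y (hopf Y) z p.1

namespace IsIsotropicWillmoreLift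

variable {m : ℕ} {Y : ℂ → Fin (m + 1) → ℂ} {Ω : Set ℂ} {z : ℂ}

theorem normalSection_hopf (h : IsIsotropicWillmoreLift Y Ω) : IsNormalSection Y (hopf Y) Ω :=
  h.isNormalSection_hopf

theorem normalSection_dZ_hopf (h : IsIsotropicWillmoreLift Y Ω) :
    IsNormalSection Y (normalDZ Y (hopf Y)) Ω :=
  h.isNormalSection_normalDZ h.normalSection_hopf.smooth

theorem normalSection_dZbar_hopf (h : IsIsotropicWillmoreLift Y Ω) :
    IsNormalSection Y (normalDZbar Y (hopf Y)) Ω :=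
  h.isNormalSection_normalDZbar h.normalSection_hopf.smooth

theorem dZbar_dZbar_hopf (h : IsIsotropicWillmoreLift Y Ω) (hz : z ∈ Ω) :
    normalDZbar Y (normalDZbar Y (hopf Y)) z = (-(star (schwarzian Y z) / 2)) • hopf Y z := by
  rw [neg_smul]
  exact eq_neg_of_add_eq_zero_left (h.willmore z hz)

theorem lorentz_dZ_hopf_hopf (h : IsIsotropicWillmoreLift Y Ω) (hz : z ∈ Ω) :
    lorentz (normalDZ Y (hopf Y) z) (hopf Y z) = 0 := by
  have := h.lorentz_normalDZ_add h.normalSection_hopf h.normalSection_hopf h.isotropic hz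
  rw [lorentz_comm (hopf Y z)] at this
  linear_combination this / 2

theorem lorentz_dZbar_hopf_hopf (h : IsIsotropicWillmoreLift Y Ω) (hz : z ∈ Ω) :
    lorentz (normalDZbar Y (hopf Y) z) (hopf Y z) = 0 := by
  have := h.lorentz_normalDZbar_add h.normalSection_hopf h.normalSection_hopf h.isotropic hz
  rw [lorentz_comm (hopf Y z)] at this
  linear_combination this / 2

theorem lorentz_dZbar_hopf_self (h : IsIsotropicWillmoreLift Y Ω) (hz : z ∈ Ω) :
    lorentz (normalDZbar Y (hopf Y) z) (normalDZbar Y (hopf Y) z) = 0 := by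
  have := h.lorentz_normalDZbar_add h.normalSection_dZbar_hopf h.normalSection_hopf
    (fun w hw => h.lorentz_dZbar_hopf_hopf hw) hz
  rw [h.dZbar_dZbar_hopf hz, lorentz_smul_left, h.isotropic z hz] at this
  linear_combination this

/-- The quartic differential is holomorphic: by the Ricci equation
`D_z̄ D_z κ = D_z D_z̄ κ - 2⟨κ, κ̄⟩ κ` and by the Willmore equation, the derivative is a combination
of products that vanish because `κ` and `D_z̄ κ` span an isotropic plane. -/
theorem pdzbar_quartic (h : IsIsotropicWillmoreLift Y Ω) (hz : z ∈ Ω) :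
    pdzbar (quartic Y) z = 0 := by
  have e1 := h.pdzbar_lorentz_normal h.normalSection_dZ_hopf h.normalSection_dZbar_hopf hz
  have e2 := h.lorentz_normalDZ_add h.normalSection_dZbar_hopf h.normalSection_dZbar_hopf
    (fun w hw => h.lorentz_dZbar_hopf_self hw) hz
  rw [lorentz_comm (normalDZbar Y (hopf Y) z)] at e2
  have e3 : lorentz (normalDZ Y (normalDZbar Y (hopf Y)) z) (normalDZbar Y (hopf Y) z) = 0 := by
    linear_combination e2 / 2
  refine e1.trans ?_
  rw [h.ricci h.normalSection_hopf hz, h.dZbar_dZbar_hopf hz, lorentz_sub_left, lorentz_add_left,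
    lorentz_smul_left, lorentz_smul_left, lorentz_smul_right, e3, h.isotropic z hz,
    lorentz_comm (hopf Y z) (normalDZbar Y (hopf Y) z), h.lorentz_dZbar_hopf_hopf hz,
    h.lorentz_dZ_hopf_hopf hz]
  ring

theorem contDiffOn_quartic (h : IsIsotropicWillmoreLift Y Ω) : ContDiffOn ℝ ∞ (quartic Y) Ω :=
  contDiffOn_lorentz h.normalSection_dZ_hopf.smooth h.normalSection_dZbar_hopf.smooth

theorem lorentz_dZ_dZbar_hopf_hopf (h : IsIsotropicWillmoreLift Y Ω)
    (hq : ∀ w ∈ Ω, quartic Y w = 0) (hz : z ∈ Ω) :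
    lorentz (normalDZ Y (normalDZbar Y (hopf Y)) z) (hopf Y z) = 0 := by
  have := h.lorentz_normalDZ_add h.normalSection_dZbar_hopf h.normalSection_hopf
    (fun w hw => h.lorentz_dZbar_hopf_hopf hw) hz
  rw [lorentz_comm (normalDZbar Y (hopf Y) z)] at this
  have hq' : lorentz (normalDZ Y (hopf Y) z) (normalDZbar Y (hopf Y) z) = 0 := hq z hz
  rwa [hq', add_zero] at this

theorem lorentz_dZ_dZbar_hopf_dZbar_hopf (h : IsIsotropicWillmoreLift Y Ω) (hz : z ∈ Ω) :
    lorentz (normalDZ Y (normalDZbar Y (hopf Y)) z) (normalDZbar Y (hopf Y) z) = 0 := by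
  have := h.lorentz_normalDZ_add h.normalSection_dZbar_hopf h.normalSection_dZbar_hopf
    (fun w hw => h.lorentz_dZbar_hopf_self hw) hz
  rw [lorentz_comm (normalDZbar Y (hopf Y) z)] at this
  linear_combination this / 2

theorem contDiffOn_hopfWedge (h : IsIsotropicWillmoreLift Y Ω) :
    ContDiffOn ℝ ∞ (hopfWedge Y) Ω := by
  have h1 := contDiffOn_pi.1 h.normalSection_hopf.smooth
  have h2 := contDiffOn_pi.1 h.normalSection_dZbar_hopf.smooth
  exact contDiffOn_pi.2 fun p => ((h1 p.1).mul (h2 p.2)).sub ((h1 p.2).mul (h2 p.1))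

end IsIsotropicWillmoreLift

section WedgeEquation

variable {m : ℕ}

/-- For an index `p`, a linear map `S` from bivectors to vectors and a vector `c`, the endomorphism
`w ↦ ⟨S w, c⟩ eₚ` of the space of bivectors, as a linear function of `c`. -/
def slotMap (p : Fin (m + 1) × Fin (m + 1))
    (S : (Fin (m + 1) × Fin (m + 1) → ℂ) →L[ℂ] (Fin (m + 1) → ℂ)) :
    (Fin (m + 1) → ℂ) →L[ℂ] ((Fin (m + 1) × Fin (m + 1) → ℂ) →L[ℂ]
      (Fin (m + 1) × Fin (m + 1) → ℂ)) :=
  ((ContinuousLinearMap.smulRightL ℂ (Fin (m + 1) × Fin (m + 1) → ℂ)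
    (Fin (m + 1) × Fin (m + 1) → ℂ)).flip (Pi.single p 1)).comp
    (((ContinuousLinearMap.compL ℂ (Fin (m + 1) × Fin (m + 1) → ℂ) (Fin (m + 1) → ℂ) ℂ).flip
      S).comp (lorentzB m).flip)

theorem slotMap_apply (p : Fin (m + 1) × Fin (m + 1))
    (S : (Fin (m + 1) × Fin (m + 1) → ℂ) →L[ℂ] (Fin (m + 1) → ℂ)) (c : Fin (m + 1) → ℂ)
    (w : Fin (m + 1) × Fin (m + 1) → ℂ) :
    slotMap p S c w = lorentz (S w) c • Pi.single p 1 := by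
  simp [slotMap, lorentzB_apply]

/-- The columns of a matrix. -/
def colMap (b : Fin (m + 1)) :
    (Fin (m + 1) × Fin (m + 1) → ℂ) →L[ℂ] (Fin (m + 1) → ℂ) :=
  ContinuousLinearMap.pi fun a => ContinuousLinearMap.proj (a, b)

/-- The rows of a matrix. -/
def rowMap (a : Fin (m + 1)) :
    (Fin (m + 1) × Fin (m + 1) → ℂ) →L[ℂ] (Fin (m + 1) → ℂ) :=
  ContinuousLinearMap.pi fun b => ContinuousLinearMap.proj (a, b)

/-- The zeroth order operator in the linear equation satisfied by `κ ∧ D_z̄ κ`: the derivation of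
the space of bivectors induced by `ψ ↦ ⟨ψ, N_z̄⟩ Y - 2⟨ψ, κ̄⟩ Y_z`. -/
def wedgeOperator (Y : ℂ → Fin (m + 1) → ℂ) (z : ℂ) :
    (Fin (m + 1) × Fin (m + 1) → ℂ) →L[ℂ] (Fin (m + 1) × Fin (m + 1) → ℂ) :=
  ∑ p : Fin (m + 1) × Fin (m + 1),
    (Y z p.1 • slotMap p (colMap p.2) (dZbar (sectionN Y) z)
      - (2 * dZ Y z p.1) • slotMap p (colMap p.2) (star (hopf Y z))
      + (Y z p.2 • slotMap p (rowMap p.1) (dZbar (sectionN Y) z)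
      - (2 * dZ Y z p.2) • slotMap p (rowMap p.1) (star (hopf Y z))))

theorem wedgeOperator_apply (Y : ℂ → Fin (m + 1) → ℂ) (z : ℂ)
    (w : Fin (m + 1) × Fin (m + 1) → ℂ) (p : Fin (m + 1) × Fin (m + 1)) :
    wedgeOperator Y z w p = Y z p.1 * lorentz (colMap p.2 w) (dZbar (sectionN Y) z)
      - 2 * dZ Y z p.1 * lorentz (colMap p.2 w) (star (hopf Y z))
      + (Y z p.2 * lorentz (rowMap p.1 w) (dZbar (sectionN Y) z)
      - 2 * dZ Y z p.2 * lorentz (rowMap p.1 w) (star (hopf Y z))) := by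
  simp only [wedgeOperator, sum_apply, Finset.sum_apply]
  rw [Finset.sum_eq_single p]
  · simp [slotMap_apply]
  · intro q _ hq
    simp [slotMap_apply, Pi.single_eq_of_ne hq.symm]
  · intro hp
    exact absurd (Finset.mem_univ p) hp

theorem colMap_hopfWedge (Y : ℂ → Fin (m + 1) → ℂ) (z : ℂ) (b : Fin (m + 1)) :
    colMap b (hopfWedge Y z) = normalDZbar Y (hopf Y) z b • hopf Y z
      - hopf Y z b • normalDZbar Y (hopf Y) z := by
  funext a
  simp [colMap, hopfWedge, mul_comm]

theorem rowMap_hopfWedge (Y : ℂ → Fin (m + 1) → ℂ) (z : ℂ) (a : Fin (m + 1)) :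
    rowMap a (hopfWedge Y z) = hopf Y z a • normalDZbar Y (hopf Y) z
      - normalDZbar Y (hopf Y) z a • hopf Y z := by
  funext b
  simp [rowMap, hopfWedge, mul_comm]

namespace IsIsotropicWillmoreLift

variable {Y : ℂ → Fin (m + 1) → ℂ} {Ω : Set ℂ} {z : ℂ}

theorem contDiffOn_wedgeOperator (h : IsIsotropicWillmoreLift Y Ω) :
    ContDiffOn ℝ ∞ (wedgeOperator Y) Ω := by
  have sY := contDiffOn_pi.1 h.smooth
  have sZ := contDiffOn_pi.1 (h.contDiffOn_dZ h.smooth)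
  have hT : ∀ (p) (S : (Fin (m + 1) × Fin (m + 1) → ℂ) →L[ℂ] (Fin (m + 1) → ℂ))
      {c : ℂ → Fin (m + 1) → ℂ}, ContDiffOn ℝ ∞ c Ω →
      ContDiffOn ℝ ∞ (fun z => slotMap p S (c z)) Ω := fun p S c hc =>
    ((slotMap p S).restrictScalars ℝ).contDiff.comp_contDiffOn hc
  have sN := h.contDiffOn_dZbar h.contDiffOn_sectionN
  have sκ := contDiffOn_star h.normalSection_hopf.smooth
  unfold wedgeOperator
  exact ContDiffOn.sum fun p _ =>
    (((sY p.1).smul (hT _ _ sN)).sub ((contDiffOn_const.mul (sZ p.1)).smul (hT _ _ sκ))).add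
    (((sY p.2).smul (hT _ _ sN)).sub ((contDiffOn_const.mul (sZ p.2)).smul (hT _ _ sκ)))

/-- The bivector `κ ∧ D_z̄ κ` is parallel for `D_z̄`; in the ambient space this is a linear equation
without derivatives on the right hand side. -/
theorem pdzbar_hopfWedge (h : IsIsotropicWillmoreLift Y Ω) (hz : z ∈ Ω) :
    pdzbar (hopfWedge Y) z = wedgeOperator Y z (hopfWedge Y z) := by
  have d1 := h.differentiableAt hz h.normalSection_hopf.smooth
  have d2 := h.differentiableAt hz h.normalSection_dZbar_hopf.smooth
  have e1 := h.dZbar_normalSection h.normalSection_hopf hz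
  have e2 := h.dZbar_normalSection h.normalSection_dZbar_hopf hz
  rw [h.dZbar_dZbar_hopf hz] at e2
  have c1 : ∀ {f : ℂ → Fin (m + 1) → ℂ} (_ : DifferentiableAt ℝ f z) (a : Fin (m + 1)),
      pdzbar (fun w => f w a) z = dZbar f z a := fun hf a =>
    pdzbar_clm (ContinuousLinearMap.proj (R := ℂ) (φ := fun _ : Fin (m + 1) => ℂ) a) hf
  have dd : ∀ {f : ℂ → Fin (m + 1) → ℂ} (_ : DifferentiableAt ℝ f z) (a : Fin (m + 1)),
      DifferentiableAt ℝ (fun w => f w a) z := fun hf a => differentiableAt_pi.1 hf a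
  have dm : ∀ a b : Fin (m + 1),
      DifferentiableAt ℝ (fun w => hopf Y w a * normalDZbar Y (hopf Y) w b) z := fun a b =>
    (dd d1 a).mul (dd d2 b)
  funext p
  have hp : pdzbar (hopfWedge Y) z p = pdzbar (fun w => hopfWedge Y w p) z :=
    (pdzbar_clm (ContinuousLinearMap.proj (R := ℂ)
      (φ := fun _ : Fin (m + 1) × Fin (m + 1) => ℂ) p)
      (h.differentiableAt hz h.contDiffOn_hopfWedge)).symm
  have hp2 : pdzbar (fun w => hopfWedge Y w p) z
      = (dZbar (hopf Y) z p.1 * normalDZbar Y (hopf Y) z p.2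
        + hopf Y z p.1 * dZbar (normalDZbar Y (hopf Y)) z p.2)
      - (dZbar (hopf Y) z p.2 * normalDZbar Y (hopf Y) z p.1
        + hopf Y z p.2 * dZbar (normalDZbar Y (hopf Y)) z p.1) := by
    simp only [hopfWedge]
    rw [pdzbar_sub (dm _ _) (dm _ _),
      pdzbar_mul (dd d1 _) (dd d2 _), pdzbar_mul (dd d1 _) (dd d2 _), c1 d1, c1 d1, c1 d2, c1 d2]
  rw [hp, hp2, wedgeOperator_apply, colMap_hopfWedge, rowMap_hopfWedge, e1, e2]
  simp only [lorentz_sub_left, lorentz_smul_left, Pi.add_apply, Pi.sub_apply, Pi.smul_apply,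
    smul_eq_mul]
  ring

theorem eventually_hopfWedge_eq_zero_or (h : IsIsotropicWillmoreLift Y Ω) (hz : z ∈ Ω) :
    (∀ᶠ w in nhds z, hopfWedge Y w = 0) ∨ ∃ (n : ℕ)
      (g : ℂ → Fin (m + 1) × Fin (m + 1) → ℂ), ContDiffOn ℝ ∞ g Ω ∧
      (∀ w ∈ Ω, hopfWedge Y w = (w - z) ^ n • g w) ∧ g z ≠ 0 :=
  eventually_eq_zero_or_exists_order h.isOpen h.contDiffOn_hopfWedge h.contDiffOn_wedgeOperator
    (fun _ hw => h.pdzbar_hopfWedge hw) hz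

end IsIsotropicWillmoreLift

end WedgeEquation

/-! ### Change of the complex coordinate -/

/-- The lifts `Y` and `Y'` of one surface with respect to two complex coordinates: `φ` is the
holomorphic coordinate change and `Y' = ρ • Y ∘ φ`. -/
structure IsCoordinateChange {m : ℕ} (Y : ℂ → Fin (m + 1) → ℂ) (Ω : Set ℂ)
    (Y' : ℂ → Fin (m + 1) → ℂ) (Ω' : Set ℂ) (φ ρ : ℂ → ℂ) : Prop where
  lift : IsLift Y Ω
  lift' : IsLift Y' Ω'
  holomorphic : DifferentiableOn ℂ φ Ω'
  mapsTo : Set.MapsTo φ Ω' Ω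
  deriv_ne_zero : ∀ w ∈ Ω', deriv φ w ≠ 0
  smooth_scale : ContDiffOn ℝ ∞ ρ Ω'
  scale_ne_zero : ∀ w ∈ Ω', ρ w ≠ 0
  eq_smul : ∀ w ∈ Ω', Y' w = ρ w • Y (φ w)

namespace IsLift

variable {m : ℕ} {Y : ℂ → Fin (m + 1) → ℂ} {Ω : Set ℂ} {z : ℂ}

theorem self_mem_tangentialSpace : Y z ∈ tangentialSpace Y z :=
  Submodule.subset_span (by simp)

theorem dZ_mem_tangentialSpace : dZ Y z ∈ tangentialSpace Y z :=
  Submodule.subset_span (by simp)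

theorem dZbar_mem_tangentialSpace : dZbar Y z ∈ tangentialSpace Y z :=
  Submodule.subset_span (by simp)

theorem laplace_mem_tangentialSpace : dZ (dZbar Y) z ∈ tangentialSpace Y z :=
  Submodule.subset_span (by simp)

theorem sectionN_mem_tangentialSpace : sectionN Y z ∈ tangentialSpace Y z :=
  add_mem (Submodule.smul_mem _ _ laplace_mem_tangentialSpace)
    (Submodule.smul_mem _ _ self_mem_tangentialSpace)

theorem sub_normalPart_mem (v : Fin (m + 1) → ℂ) :
    v - normalPart Y z v ∈ tangentialSpace Y z := by
  have : v - normalPart Y z v = (2 * lorentz v (dZbar Y z)) • dZ Y z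
      + (2 * lorentz v (dZ Y z)) • dZbar Y z - lorentz v (sectionN Y z) • Y z
      - lorentz v (Y z) • sectionN Y z := by
    rw [normalPart]; module
  rw [this]
  exact sub_mem (sub_mem (add_mem (Submodule.smul_mem _ _ dZ_mem_tangentialSpace)
    (Submodule.smul_mem _ _ dZbar_mem_tangentialSpace))
    (Submodule.smul_mem _ _ self_mem_tangentialSpace))
    (Submodule.smul_mem _ _ sectionN_mem_tangentialSpace)

end IsLift

namespace IsCoordinateChange

open IsLift

variable {m : ℕ} {Y Y' : ℂ → Fin (m + 1) → ℂ} {Ω Ω' : Set ℂ} {φ ρ : ℂ → ℂ} {w : ℂ}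

theorem differentiableAt (h : IsCoordinateChange Y Ω Y' Ω' φ ρ) (hw : w ∈ Ω') :
    DifferentiableAt ℂ φ w :=
  h.holomorphic.differentiableAt (h.lift'.isOpen.mem_nhds hw)

theorem contDiffOn_map (h : IsCoordinateChange Y Ω Y' Ω' φ ρ) : ContDiffOn ℝ ∞ φ Ω' :=
  (h.holomorphic.contDiffOn h.lift'.isOpen).restrict_scalars ℝ

theorem contDiffOn_deriv (h : IsCoordinateChange Y Ω Y' Ω' φ ρ) :
    ContDiffOn ℝ ∞ (deriv φ) Ω' :=
  ((h.holomorphic.deriv h.lift'.isOpen).contDiffOn h.lift'.isOpen).restrict_scalars ℝ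

theorem contDiffOn_comp (h : IsCoordinateChange Y Ω Y' Ω' φ ρ) {ψ : ℂ → Fin (m + 1) → ℂ}
    (hψ : ContDiffOn ℝ ∞ ψ Ω) : ContDiffOn ℝ ∞ (fun w => ψ (φ w)) Ω' :=
  hψ.comp h.contDiffOn_map h.mapsTo

theorem dZ_smul_comp (h : IsCoordinateChange Y Ω Y' Ω' φ ρ) {f : ℂ → ℂ}
    {ψ : ℂ → Fin (m + 1) → ℂ} (hf : ContDiffOn ℝ ∞ f Ω') (hψ : ContDiffOn ℝ ∞ ψ Ω)
    (hw : w ∈ Ω') : dZ (fun w => f w • ψ (φ w)) w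
      = pdz f w • ψ (φ w) + (f w * deriv φ w) • dZ ψ (φ w) := by
  refine (pdz_smul (h.lift'.differentiableAt hw hf)
    (h.lift'.differentiableAt hw (h.contDiffOn_comp hψ))).trans ?_
  rw [pdz_comp_holomorphic (h.lift.differentiableAt (h.mapsTo hw) hψ) (h.differentiableAt hw),
    smul_smul]
  rfl

theorem dZbar_smul_comp (h : IsCoordinateChange Y Ω Y' Ω' φ ρ) {f : ℂ → ℂ}
    {ψ : ℂ → Fin (m + 1) → ℂ} (hf : ContDiffOn ℝ ∞ f Ω') (hψ : ContDiffOn ℝ ∞ ψ Ω)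
    (hw : w ∈ Ω') : dZbar (fun w => f w • ψ (φ w)) w
      = pdzbar f w • ψ (φ w) + (f w * star (deriv φ w)) • dZbar ψ (φ w) := by
  refine (pdzbar_smul (h.lift'.differentiableAt hw hf)
    (h.lift'.differentiableAt hw (h.contDiffOn_comp hψ))).trans ?_
  rw [pdzbar_comp_holomorphic (h.lift.differentiableAt (h.mapsTo hw) hψ) (h.differentiableAt hw),
    smul_smul]
  rfl

theorem dZ_lift (h : IsCoordinateChange Y Ω Y' Ω' φ ρ) (hw : w ∈ Ω') :
    dZ Y' w = pdz ρ w • Y (φ w) + (ρ w * deriv φ w) • dZ Y (φ w) :=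
  (pdz_congr_on h.lift'.isOpen h.eq_smul hw).trans (h.dZ_smul_comp h.smooth_scale h.lift.smooth hw)

theorem dZbar_lift (h : IsCoordinateChange Y Ω Y' Ω' φ ρ) (hw : w ∈ Ω') :
    dZbar Y' w = pdzbar ρ w • Y (φ w) + (ρ w * star (deriv φ w)) • dZbar Y (φ w) :=
  (pdzbar_congr_on h.lift'.isOpen h.eq_smul hw).trans
    (h.dZbar_smul_comp h.smooth_scale h.lift.smooth hw)

theorem dZ_dZ_lift (h : IsCoordinateChange Y Ω Y' Ω' φ ρ) (hw : w ∈ Ω') :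
    dZ (dZ Y') w = pdz (pdz ρ) w • Y (φ w) + (pdz ρ w * deriv φ w) • dZ Y (φ w)
      + (pdz (fun w => ρ w * deriv φ w) w • dZ Y (φ w)
      + (ρ w * deriv φ w * deriv φ w) • dZ (dZ Y) (φ w)) := by
  have hΩ' := h.lift'.isOpen
  have s1 := contDiffOn_pdz hΩ' h.smooth_scale
  have s2 : ContDiffOn ℝ ∞ (fun w => ρ w * deriv φ w) Ω' := h.smooth_scale.mul h.contDiffOn_deriv
  have s3 := h.lift.contDiffOn_dZ h.lift.smooth
  refine (pdz_congr_on hΩ' (fun w hw => h.dZ_lift hw) hw).trans ?_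
  refine (pdz_add (h.lift'.differentiableAt hw (s1.smul (h.contDiffOn_comp h.lift.smooth)))
    (h.lift'.differentiableAt hw (s2.smul (h.contDiffOn_comp s3)))).trans ?_
  exact congrArg₂ _ (h.dZ_smul_comp s1 h.lift.smooth hw) (h.dZ_smul_comp s2 s3 hw)

theorem laplace_lift (h : IsCoordinateChange Y Ω Y' Ω' φ ρ) (hw : w ∈ Ω') :
    dZ (dZbar Y') w = pdz (pdzbar ρ) w • Y (φ w) + (pdzbar ρ w * deriv φ w) • dZ Y (φ w)
      + (pdz (fun w => ρ w * star (deriv φ w)) w • dZbar Y (φ w)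
      + (ρ w * star (deriv φ w) * deriv φ w) • dZ (dZbar Y) (φ w)) := by
  have hΩ' := h.lift'.isOpen
  have s1 := contDiffOn_pdzbar hΩ' h.smooth_scale
  have s2 : ContDiffOn ℝ ∞ (fun w => ρ w * star (deriv φ w)) Ω' :=
    h.smooth_scale.mul (Complex.conjCLE.contDiff.comp_contDiffOn h.contDiffOn_deriv)
  have s3 := h.lift.contDiffOn_dZbar h.lift.smooth
  refine (pdz_congr_on hΩ' (fun w hw => h.dZbar_lift hw) hw).trans ?_
  refine (pdz_add (h.lift'.differentiableAt hw (s1.smul (h.contDiffOn_comp h.lift.smooth)))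
    (h.lift'.differentiableAt hw (s2.smul (h.contDiffOn_comp s3)))).trans ?_
  exact congrArg₂ _ (h.dZ_smul_comp s1 h.lift.smooth hw) (h.dZ_smul_comp s2 s3 hw)

/-- The bundle `V_ℂ` does not depend on the coordinate. -/
theorem tangentialSpace_eq (h : IsCoordinateChange Y Ω Y' Ω' φ ρ) (hw : w ∈ Ω') :
    tangentialSpace Y' w = tangentialSpace Y (φ w) := by
  have hρ := h.scale_ne_zero w hw
  have hd := h.deriv_ne_zero w hw
  have hd' : star (deriv φ w) ≠ 0 := by simpa using hd
  have m1 := self_mem_tangentialSpace (Y := Y) (z := φ w)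
  have m2 := dZ_mem_tangentialSpace (Y := Y) (z := φ w)
  have m3 := dZbar_mem_tangentialSpace (Y := Y) (z := φ w)
  have m4 := laplace_mem_tangentialSpace (Y := Y) (z := φ w)
  have m1' := self_mem_tangentialSpace (Y := Y') (z := w)
  have m2' := dZ_mem_tangentialSpace (Y := Y') (z := w)
  have m3' := dZbar_mem_tangentialSpace (Y := Y') (z := w)
  have m4' := laplace_mem_tangentialSpace (Y := Y') (z := w)
  have key : ∀ {c : ℂ} {v : Fin (m + 1) → ℂ}, c ≠ 0 → c • v ∈ tangentialSpace Y' w →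
      v ∈ tangentialSpace Y' w := fun hc hv => (Submodule.smul_mem_iff _ hc).1 hv
  have n1 : Y (φ w) ∈ tangentialSpace Y' w := by
    refine key hρ ?_
    rw [← h.eq_smul w hw]
    exact m1'
  have n2 : dZ Y (φ w) ∈ tangentialSpace Y' w := by
    refine key (mul_ne_zero hρ hd) ?_
    rw [← add_sub_cancel_left (pdz ρ w • Y (φ w)) ((ρ w * deriv φ w) • dZ Y (φ w)), ← h.dZ_lift hw]
    exact sub_mem m2' (Submodule.smul_mem _ _ n1)
  have n3 : dZbar Y (φ w) ∈ tangentialSpace Y' w := by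
    refine key (mul_ne_zero hρ hd') ?_
    rw [← add_sub_cancel_left (pdzbar ρ w • Y (φ w)) ((ρ w * star (deriv φ w)) • dZbar Y (φ w)),
      ← h.dZbar_lift hw]
    exact sub_mem m3' (Submodule.smul_mem _ _ n1)
  have n4 : dZ (dZbar Y) (φ w) ∈ tangentialSpace Y' w := by
    refine key (mul_ne_zero (mul_ne_zero hρ hd') hd) ?_
    have e : (ρ w * star (deriv φ w) * deriv φ w) • dZ (dZbar Y) (φ w) = dZ (dZbar Y') w
        - (pdz (pdzbar ρ) w • Y (φ w) + (pdzbar ρ w * deriv φ w) • dZ Y (φ w)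
        + pdz (fun w => ρ w * star (deriv φ w)) w • dZbar Y (φ w)) := by
      rw [h.laplace_lift hw]; module
    rw [e]
    exact sub_mem m4' (add_mem (add_mem (Submodule.smul_mem _ _ n1) (Submodule.smul_mem _ _ n2))
      (Submodule.smul_mem _ _ n3))
  refine le_antisymm (Submodule.span_le.2 ?_) (Submodule.span_le.2 ?_)
  · intro v hv
    simp only [Set.mem_insert_iff, Set.mem_singleton_iff] at hv
    rcases hv with rfl | rfl | rfl | rfl
    · rw [h.eq_smul w hw]
      exact Submodule.smul_mem _ _ m1
    · rw [h.dZ_lift hw]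
      exact add_mem (Submodule.smul_mem _ _ m1) (Submodule.smul_mem _ _ m2)
    · rw [h.dZbar_lift hw]
      exact add_mem (Submodule.smul_mem _ _ m1) (Submodule.smul_mem _ _ m3)
    · rw [h.laplace_lift hw]
      exact add_mem (add_mem (Submodule.smul_mem _ _ m1) (Submodule.smul_mem _ _ m2))
        (add_mem (Submodule.smul_mem _ _ m3) (Submodule.smul_mem _ _ m4))
  · intro v hv
    simp only [Set.mem_insert_iff, Set.mem_singleton_iff] at hv
    rcases hv with rfl | rfl | rfl | rfl <;> assumption

theorem normalPart_eq (h : IsCoordinateChange Y Ω Y' Ω' φ ρ) (hw : w ∈ Ω')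
    (v : Fin (m + 1) → ℂ) : normalPart Y' w v = normalPart Y (φ w) v := by
  have h1 : normalPart Y' w v ∈ normalSpace Y (φ w) := fun u hu =>
    h.lift'.normalPart_mem hw v u (h.tangentialSpace_eq hw ▸ hu)
  have h2 : v - normalPart Y' w v ∈ tangentialSpace Y (φ w) :=
    h.tangentialSpace_eq hw ▸ sub_normalPart_mem v
  have h3 := h.lift.normalPart_of_mem_tangentialSpace (h.mapsTo hw) h2
  rw [normalPart_sub, normalPart_of_mem h1, sub_eq_zero] at h3
  exact h3.symm

/-- Both lifts are normalized, so that `ρ` is determined up to sign by `φ`. -/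
theorem scale_sq_mul (h : IsCoordinateChange Y Ω Y' Ω' φ ρ) (hw : w ∈ Ω') :
    ρ w ^ 2 * (deriv φ w * star (deriv φ w)) = 1 := by
  have hz := h.mapsTo hw
  have h1 := h.lift'.normalized w hw
  rw [h.dZ_lift hw, h.dZbar_lift hw] at h1
  simp only [lorentz_add_left, lorentz_add_right, lorentz_smul_left, lorentz_smul_right,
    h.lift.null _ hz, h.lift.normalized _ hz, h.lift.lorentz_dZ_self hz,
    lorentz_comm (Y (φ w)) (dZbar Y (φ w)), h.lift.lorentz_dZbar_self hz] at h1
  linear_combination 2 * h1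

theorem contDiffOn_hopfFactor (h : IsCoordinateChange Y Ω Y' Ω' φ ρ) :
    ContDiffOn ℝ ∞ (fun w => ρ w * deriv φ w * deriv φ w) Ω' :=
  (h.smooth_scale.mul h.contDiffOn_deriv).mul h.contDiffOn_deriv

theorem hopf_eq (h : IsCoordinateChange Y Ω Y' Ω' φ ρ) (hw : w ∈ Ω') :
    hopf Y' w = (ρ w * deriv φ w * deriv φ w) • hopf Y (φ w) := by
  have hz := h.mapsTo hw
  rw [hopf, h.normalPart_eq hw, h.dZ_dZ_lift hw]
  simp only [normalPart_add, normalPart_smul, h.lift.normalPart_self hz, h.lift.normalPart_dZ hz,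
    hopf]
  module

theorem normalDZ_hopf_eq (h : IsCoordinateChange Y Ω Y' Ω' φ ρ) (hw : w ∈ Ω') :
    normalDZ Y' (hopf Y') w = pdz (fun w => ρ w * deriv φ w * deriv φ w) w • hopf Y (φ w)
      + (ρ w * deriv φ w * deriv φ w * deriv φ w) • normalDZ Y (hopf Y) (φ w) := by
  have hz := h.mapsTo hw
  have e : dZ (hopf Y') w = _ := (pdz_congr_on h.lift'.isOpen (fun w hw => h.hopf_eq hw) hw).trans
    (h.dZ_smul_comp h.contDiffOn_hopfFactor h.lift.isNormalSection_hopf.smooth hw)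
  rw [normalDZ, h.normalPart_eq hw, e, normalPart_add, normalPart_smul, normalPart_smul,
    normalPart_of_mem (h.lift.isNormalSection_hopf.mem _ hz), normalDZ]

theorem normalDZbar_hopf_eq (h : IsCoordinateChange Y Ω Y' Ω' φ ρ) (hw : w ∈ Ω') :
    normalDZbar Y' (hopf Y') w = pdzbar (fun w => ρ w * deriv φ w * deriv φ w) w • hopf Y (φ w)
      + (ρ w * deriv φ w * deriv φ w * star (deriv φ w)) • normalDZbar Y (hopf Y) (φ w) := by
  have hz := h.mapsTo hw
  have e : dZbar (hopf Y') w = _ :=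
    (pdzbar_congr_on h.lift'.isOpen (fun w hw => h.hopf_eq hw) hw).trans
    (h.dZbar_smul_comp h.contDiffOn_hopfFactor h.lift.isNormalSection_hopf.smooth hw)
  rw [normalDZbar, h.normalPart_eq hw, e, normalPart_add, normalPart_smul, normalPart_smul,
    normalPart_of_mem (h.lift.isNormalSection_hopf.mem _ hz), normalDZbar]

/-- `⟨D_z κ, D_z̄ κ⟩ dz⁴` is a well defined quartic differential. -/
theorem quartic_eq (h : IsCoordinateChange Y Ω Y' Ω' φ ρ) (hY : IsIsotropicWillmoreLift Y Ω)
    (hw : w ∈ Ω') : quartic Y' w = deriv φ w ^ 4 * quartic Y (φ w) := by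
  have hz := h.mapsTo hw
  rw [quartic, h.normalDZ_hopf_eq hw, h.normalDZbar_hopf_eq hw]
  simp only [lorentz_add_left, lorentz_add_right, lorentz_smul_left, lorentz_smul_right,
    hY.isotropic _ hz, hY.lorentz_dZ_hopf_hopf hz,
    lorentz_comm (hopf Y (φ w)) (normalDZbar Y (hopf Y) (φ w)), hY.lorentz_dZbar_hopf_hopf hz]
  rw [← quartic]
  linear_combination (deriv φ w ^ 4 * quartic Y (φ w)) * h.scale_sq_mul hw

theorem hopfWedge_eq (h : IsCoordinateChange Y Ω Y' Ω' φ ρ) (hw : w ∈ Ω') :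
    hopfWedge Y' w
      = ((ρ w * deriv φ w * deriv φ w) ^ 2 * star (deriv φ w)) • hopfWedge Y (φ w) := by
  funext p
  simp only [hopfWedge, h.hopf_eq hw, h.normalDZbar_hopf_eq hw, Pi.smul_apply, Pi.add_apply,
    smul_eq_mul]
  ring

theorem hopfWedge_eq_zero_iff (h : IsCoordinateChange Y Ω Y' Ω' φ ρ) (hw : w ∈ Ω') :
    hopfWedge Y' w = 0 ↔ hopfWedge Y (φ w) = 0 := by
  have hρ := h.scale_ne_zero w hw
  have hd := h.deriv_ne_zero w hw
  have hd' : star (deriv φ w) ≠ 0 := by simpa using hd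
  rw [h.hopfWedge_eq hw, smul_eq_zero_iff_right]
  positivity

end IsCoordinateChange

/-! ### Unitary isotropic frames -/

section LinearAlgebra

theorem mem_span_range_fin_two {k : ℕ} {f : Fin 2 → Fin k → ℂ} {v : Fin k → ℂ} :
    v ∈ Submodule.span ℂ (Set.range f) ↔ ∃ a b : ℂ, v = a • f 0 + b • f 1 := by
  rw [Submodule.mem_span_range_iff_exists_fun]
  constructor
  · rintro ⟨c, rfl⟩
    exact ⟨c 0, c 1, by simp⟩
  · rintro ⟨a, b, rfl⟩
    exact ⟨![a, b], by simp⟩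

theorem lorentz_eq_zero_of_mem_span {m : ℕ} {f : Fin 2 → Fin (m + 1) → ℂ} {v w : Fin (m + 1) → ℂ}
    (hv : v ∈ Submodule.span ℂ (Set.range f)) (hw : ∀ i, lorentz (f i) w = 0) :
    lorentz v w = 0 := by
  obtain ⟨a, b, rfl⟩ := mem_span_range_fin_two.1 hv
  simp [lorentz_add_left, lorentz_smul_left, hw]

variable {m : ℕ} {Y : ℂ → Fin (m + 1) → ℂ} {Ω : Set ℂ} {z : ℂ}

/-- The Hermitian form `⟨v, v̄⟩` is positive definite on the complexified normal bundle. -/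
theorem IsLift.exists_pos_lorentz_star_self (h : IsLift Y Ω) (hz : z ∈ Ω) {v : Fin (m + 1) → ℂ}
    (hv : v ∈ normalSpace Y z) (hv0 : v ≠ 0) : ∃ r : ℝ, 0 < r ∧ lorentz v (star v) = r := by
  have hreal : ∀ i, star (Y z i) = Y z i := fun i => congrFun (h.real z hz) i
  have hY0 : Y z 0 ≠ 0 := by
    intro h0
    have h1 := h.null z hz
    have h2 : ∀ i, ((Y z i).re : ℂ) = Y z i := fun i => Complex.conj_eq_iff_re.1 (hreal i)
    have h3 : ∑ i : Fin m, (Y z i.succ).re ^ 2 = 0 := by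
      simp only [lorentz, h0, mul_zero, neg_zero, zero_add] at h1
      have : ((∑ i : Fin m, (Y z i.succ).re ^ 2 : ℝ) : ℂ) = 0 := by
        push_cast
        rw [← h1]
        exact Finset.sum_congr rfl fun i _ => by rw [h2, pow_two]
      exact_mod_cast this
    rw [Finset.sum_eq_zero_iff_of_nonneg fun i _ => sq_nonneg _] at h3
    have h4 : Y z = 0 := by
      funext i
      refine Fin.cases h0 (fun i => ?_) i
      rw [← h2, pow_eq_zero_iff two_ne_zero |>.1 (h3 i (Finset.mem_univ i))]
      rfl
    have h5 := h.lorentz_N_self hz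
    rw [h4, lorentz_zero_right] at h5
    norm_num at h5
  have hvY := (mem_normalSpace_iff.1 hv).1
  have hvY' : lorentz (Y z) (star v) = 0 := by
    rw [← h.real z hz, lorentz_star_star, lorentz_comm, hvY, star_zero]
  -- Subtracting a multiple of the null vector `Y` makes the time component vanish.
  set c : ℂ := v 0 / Y z 0 with hc
  set u := v - c • Y z with hu
  have hu0 : u 0 = 0 := by simp [hu, hc, hY0]
  have e1 : lorentz v (star v) = lorentz u (star u) := by
    have hsu : star u = star v - star c • Y z := by
      rw [hu, star_sub, star_smul, h.real z hz]
    rw [hsu, hu]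
    simp only [lorentz_sub_left, lorentz_sub_right, lorentz_smul_left, lorentz_smul_right, hvY,
      hvY', h.null z hz]
    ring
  have e2 : lorentz u (star u) = ((∑ i : Fin m, ‖u i.succ‖ ^ 2 : ℝ) : ℂ) := by
    simp only [lorentz, hu0, zero_mul, neg_zero, zero_add, Pi.star_apply]
    push_cast
    exact Finset.sum_congr rfl fun i _ => Complex.mul_conj' _
  refine ⟨_, ?_, e1.trans e2⟩
  refine lt_of_le_of_ne (Finset.sum_nonneg fun i _ => sq_nonneg _) fun h0 => hv0 ?_
  have h1 := (Finset.sum_eq_zero_iff_of_nonneg fun i _ => sq_nonneg _).1 h0.symm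
  have h2 : u = 0 := by
    funext i
    refine Fin.cases hu0 (fun i => ?_) i
    simpa using h1 i (Finset.mem_univ i)
  have h3 : v = c • Y z := sub_eq_zero.1 h2
  have h4 := IsLift.lorentz_N_of_mem hv
  rw [h3, lorentz_smul_left, lorentz_comm, h.lorentz_N_self hz] at h4
  have h5 : c = 0 := by linear_combination -h4
  rw [h3, h5, zero_smul]

/-- In the case of a surface in `S⁶` the normal bundle has rank four, so that two normal vectors
which form a unitary basis of an isotropic plane span it together with their conjugates. -/
theorem IsLift.eq_sum_of_isotropic {Y : ℂ → Fin 8 → ℂ} (h : IsLift (m := 7) Y Ω) (hz : z ∈ Ω)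
    {e : Fin 2 → Fin 8 → ℂ} (he : ∀ i, e i ∈ normalSpace (m := 7) Y z)
    (hiso : ∀ i j, lorentz (m := 7) (e i) (e j) = 0)
    (huni : ∀ i j, lorentz (m := 7) (e i) (star (e j)) = if i = j then 1 else 0)
    {v : Fin 8 → ℂ} (hv : v ∈ normalSpace (m := 7) Y z) :
    v = lorentz (m := 7) v (star (e 0)) • e 0 + lorentz (m := 7) v (star (e 1)) • e 1
      + (lorentz (m := 7) v (e 0) • star (e 0) + lorentz (m := 7) v (e 1) • star (e 1)) := by
  have he' : ∀ i, star (e i) ∈ normalSpace (m := 7) Y z := fun i => h.star_mem_normalSpace hz (he i)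
  have hiso' : ∀ i j, lorentz (m := 7) (star (e i)) (star (e j)) = 0 := fun i j => by
    rw [lorentz_star_star, hiso, star_zero]
  have huni' : ∀ i j, lorentz (m := 7) (star (e i)) (e j) = if i = j then 1 else 0 := fun i j => by
    rw [lorentz_comm, huni]
    simp [eq_comm]
  have nY := fun {v : Fin 8 → ℂ} (hv : v ∈ normalSpace (m := 7) Y z) =>
    (mem_normalSpace_iff.1 hv).1
  have nZ := fun {v : Fin 8 → ℂ} (hv : v ∈ normalSpace (m := 7) Y z) =>
    (mem_normalSpace_iff.1 hv).2.1
  have nZb := fun {v : Fin 8 → ℂ} (hv : v ∈ normalSpace (m := 7) Y z) =>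
    (mem_normalSpace_iff.1 hv).2.2.1
  have nN := fun {v : Fin 8 → ℂ} (hv : v ∈ normalSpace (m := 7) Y z) =>
    IsLift.lorentz_N_of_mem (m := 7) hv
  have cY := fun {v : Fin 8 → ℂ} (hv : v ∈ normalSpace (m := 7) Y z) =>
    (lorentz_comm (m := 7) (Y z) v).trans (nY hv)
  have cZ := fun {v : Fin 8 → ℂ} (hv : v ∈ normalSpace (m := 7) Y z) =>
    (lorentz_comm (m := 7) (dZ Y z) v).trans (nZ hv)
  have cZb := fun {v : Fin 8 → ℂ} (hv : v ∈ normalSpace (m := 7) Y z) =>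
    (lorentz_comm (m := 7) (dZbar Y z) v).trans (nZb hv)
  have cN := fun {v : Fin 8 → ℂ} (hv : v ∈ normalSpace (m := 7) Y z) =>
    (lorentz_comm (m := 7) (sectionN (m := 7) Y z) v).trans (nN hv)
  let b : Fin 8 → Fin 8 → ℂ := ![Y z, sectionN (m := 7) Y z, dZ Y z, dZbar Y z, e 0, e 1,
    star (e 0), star (e 1)]
  have hli : LinearIndependent ℂ b := by
    rw [Fintype.linearIndependent_iff]
    intro c hc
    have hc' : c 0 • Y z + c 1 • sectionN (m := 7) Y z + c 2 • dZ Y z + c 3 • dZbar Y z + c 4 • e 0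
        + c 5 • e 1 + c 6 • star (e 0) + c 7 • star (e 1) = 0 := by
      rw [← hc, Fin.sum_univ_eight]
      rfl
    have hp := fun w : Fin 8 → ℂ => congrArg (fun v => lorentz (m := 7) v w) hc'
    simp only [lorentz_add_left, lorentz_smul_left, lorentz_zero_left] at hp
    have p0 := hp (sectionN (m := 7) Y z)
    have p1 := hp (Y z)
    have p2 := hp (dZbar Y z)
    have p3 := hp (dZ Y z)
    have p4 := hp (star (e 0))
    have p5 := hp (star (e 1))
    have p6 := hp (e 0)
    have p7 := hp (e 1)
    simp only [h.null z hz, h.lorentz_N_self hz, h.lorentz_dZ_self hz, h.lorentz_dZbar_self hz,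
      h.conformal z hz, h.lorentz_dZbar_dZbar hz, h.normalized z hz, h.lorentz_N_dZ hz,
      lorentz_comm (m := 7) (dZbar Y z) (dZ Y z), h.lorentz_N_dZbar hz, h.lorentz_N_N hz,
      lorentz_comm (m := 7) (Y z) (dZ Y z), lorentz_comm (m := 7) (Y z) (dZbar Y z),
      lorentz_comm (m := 7) (Y z) (sectionN (m := 7) Y z),
      lorentz_comm (m := 7) (dZ Y z) (sectionN (m := 7) Y z),
      lorentz_comm (m := 7) (dZbar Y z) (sectionN (m := 7) Y z),
      nY (he _), nZ (he _), nZb (he _), nN (he _), nY (he' _), nZ (he' _), nZb (he' _), nN (he' _),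
      cY (he _), cZ (he _), cZb (he _), cN (he _), cY (he' _), cZ (he' _), cZb (he' _), cN (he' _),
      hiso, hiso', huni, huni'] at p0 p1 p2 p3 p4 p5 p6 p7
    simp at p0 p1 p2 p3 p4 p5 p6 p7
    intro i
    fin_cases i <;> assumption
  have hspan : Submodule.span ℂ (Set.range b) = ⊤ :=
    hli.span_eq_top_of_card_eq_finrank (by simp)
  -- The difference of both sides is orthogonal to the basis `b`.
  set u := v - (lorentz (m := 7) v (star (e 0)) • e 0 + lorentz (m := 7) v (star (e 1)) • e 1
      + (lorentz (m := 7) v (e 0) • star (e 0) + lorentz (m := 7) v (e 1) • star (e 1))) with hu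
  have hun : u ∈ normalSpace (m := 7) Y z :=
    sub_mem hv (add_mem (add_mem (Submodule.smul_mem _ _ (he 0)) (Submodule.smul_mem _ _ (he 1)))
      (add_mem (Submodule.smul_mem _ _ (he' 0)) (Submodule.smul_mem _ _ (he' 1))))
  have hue : ∀ i, lorentz (m := 7) u (e i) = 0 := by
    intro i
    simp only [hu, lorentz_sub_left, lorentz_add_left, lorentz_smul_left, hiso, huni']
    fin_cases i <;> simp
  have hue' : ∀ i, lorentz (m := 7) u (star (e i)) = 0 := by
    intro i
    simp only [hu, lorentz_sub_left, lorentz_add_left, lorentz_smul_left, hiso', huni]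
    fin_cases i <;> simp
  have hall : ∀ w, lorentz (m := 7) u w = 0 := by
    intro w
    have hw : w ∈ Submodule.span ℂ (Set.range b) := hspan ▸ Submodule.mem_top
    induction hw using Submodule.span_induction with
    | mem x hx =>
      obtain ⟨i, rfl⟩ := hx
      fin_cases i
      exacts [nY hun, nN hun, nZ hun, nZb hun, hue 0, hue 1, hue' 0, hue' 1]
    | zero => exact lorentz_zero_right _
    | add x y _ _ hx hy => rw [lorentz_add_right, hx, hy, add_zero]
    | smul c x _ hx => rw [lorentz_smul_right, hx, mul_zero]
  have hu0 : u = 0 := by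
    by_contra hne
    obtain ⟨r, hr, hr'⟩ := h.exists_pos_lorentz_star_self hz hun hne
    rw [hall] at hr'
    exact hr.ne (by exact_mod_cast hr')
  exact sub_eq_zero.1 hu0

end LinearAlgebra

/-! ### Sections orthogonal to a section together with their first derivatives -/

/-- `ψ`, `∂ψ/∂z` and `∂ψ/∂z̄` are orthogonal to `A` over `U`. -/
def IsJetOrthogonal {m : ℕ} (ψ A : ℂ → Fin (m + 1) → ℂ) (U : Set ℂ) : Prop :=
  ∀ z ∈ U, lorentz (ψ z) (A z) = 0 ∧ lorentz (dZ ψ z) (A z) = 0 ∧ lorentz (dZbar ψ z) (A z) = 0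

namespace IsJetOrthogonal

variable {m : ℕ} {ψ φ A B : ℂ → Fin (m + 1) → ℂ} {U : Set ℂ}

theorem comb_left (hU : IsOpen U) (h1 : IsJetOrthogonal ψ A U) (h2 : IsJetOrthogonal φ A U)
    {a b : ℂ → ℂ} (ha : ContDiffOn ℝ ∞ a U) (hb : ContDiffOn ℝ ∞ b U) (hψ : ContDiffOn ℝ ∞ ψ U)
    (hφ : ContDiffOn ℝ ∞ φ U) : IsJetOrthogonal (fun z => a z • ψ z + b z • φ z) A U := by
  intro z hz
  have d := fun {E : Type} [NormedAddCommGroup E] [NormedSpace ℝ E] {f : ℂ → E}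
    (hf : ContDiffOn ℝ ∞ f U) => (hf.contDiffAt (hU.mem_nhds hz)).differentiableAt
      (by simp : (∞ : WithTop ℕ∞) ≠ 0)
  obtain ⟨p1, p2, p3⟩ := h1 z hz
  obtain ⟨q1, q2, q3⟩ := h2 z hz
  have e1 : dZ (fun z => a z • ψ z + b z • φ z) z
      = (pdz a z • ψ z + a z • dZ ψ z) + (pdz b z • φ z + b z • dZ φ z) :=
    (pdz_add (d (ha.smul hψ)) (d (hb.smul hφ))).trans
      (congrArg₂ _ (pdz_smul (d ha) (d hψ)) (pdz_smul (d hb) (d hφ)))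
  have e2 : dZbar (fun z => a z • ψ z + b z • φ z) z
      = (pdzbar a z • ψ z + a z • dZbar ψ z) + (pdzbar b z • φ z + b z • dZbar φ z) :=
    (pdzbar_add (d (ha.smul hψ)) (d (hb.smul hφ))).trans
      (congrArg₂ _ (pdzbar_smul (d ha) (d hψ)) (pdzbar_smul (d hb) (d hφ)))
  rw [e1, e2]
  simp [lorentz_add_left, lorentz_smul_left, p1, p2, p3, q1, q2, q3]

theorem comb_right (h1 : IsJetOrthogonal ψ A U) (h2 : IsJetOrthogonal ψ B U) (a b : ℂ → ℂ) :
    IsJetOrthogonal ψ (fun z => a z • A z + b z • B z) U := by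
  intro z hz
  obtain ⟨p1, p2, p3⟩ := h1 z hz
  obtain ⟨q1, q2, q3⟩ := h2 z hz
  simp [lorentz_add_right, lorentz_smul_right, p1, p2, p3, q1, q2, q3]

theorem congr (hU : IsOpen U) (h : IsJetOrthogonal ψ A U) (hψ : Set.EqOn φ ψ U)
    (hA : Set.EqOn B A U) : IsJetOrthogonal φ B U := by
  intro z hz
  rw [hψ hz, hA hz, show dZ φ z = dZ ψ z from pdz_congr_on hU hψ hz,
    show dZbar φ z = dZbar ψ z from pdzbar_congr_on hU hψ hz]
  exact h z hz

theorem mono {V : Set ℂ} (h : IsJetOrthogonal ψ A U) (hV : V ⊆ U) : IsJetOrthogonal ψ A V :=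
  fun z hz => h z (hV hz)

theorem of_punctured (hU : IsOpen U) {x : ℂ} (hψ : ContDiffOn ℝ ∞ ψ U) (hA : ContDiffOn ℝ ∞ A U)
    (h : IsJetOrthogonal ψ A (U \ {x})) : IsJetOrthogonal ψ A U := by
  intro z hz
  by_cases hzx : z = x
  · subst hzx
    have c := fun {f : ℂ → Fin (m + 1) → ℂ} (hf : ContDiffOn ℝ ∞ f U) =>
      hf.continuousOn.continuousAt (hU.mem_nhds hz)
    have hev : ∀ᶠ w in nhdsWithin z {z}ᶜ, w ∈ U \ {z} := by
      filter_upwards [self_mem_nhdsWithin, nhdsWithin_le_nhds (hU.mem_nhds hz)] with w h1 h2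
      exact ⟨h2, h1⟩
    refine ⟨?_, ?_, ?_⟩
    · exact eq_of_eventually_eq_punctured (f := fun w => lorentz (ψ w) (A w))
        (g := fun _ => (0 : ℂ)) (continuousAt_lorentz (c hψ) (c hA)) continuousAt_const
        (hev.mono fun w hw => (h w hw).1)
    · exact eq_of_eventually_eq_punctured (f := fun w => lorentz (dZ ψ w) (A w))
        (g := fun _ => (0 : ℂ)) (continuousAt_lorentz (c (contDiffOn_pdz hU hψ)) (c hA))
        continuousAt_const (hev.mono fun w hw => (h w hw).2.1)
    · exact eq_of_eventually_eq_punctured (f := fun w => lorentz (dZbar ψ w) (A w))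
        (g := fun _ => (0 : ℂ)) (continuousAt_lorentz (c (contDiffOn_pdzbar hU hψ)) (c hA))
        continuousAt_const (hev.mono fun w hw => (h w hw).2.2)
  · exact h z ⟨hz, hzx⟩

end IsJetOrthogonal

theorem IsLift.mono {m : ℕ} {Y : ℂ → Fin (m + 1) → ℂ} {Ω U : Set ℂ} (h : IsLift Y Ω)
    (hU : IsOpen U) (hUΩ : U ⊆ Ω) : IsLift Y U :=
  ⟨hU, h.smooth.mono hUΩ, fun z hz => h.real z (hUΩ hz), fun z hz => h.null z (hUΩ hz),
    fun z hz => h.conformal z (hUΩ hz), fun z hz => h.normalized z (hUΩ hz)⟩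

/-- Membership in the normal bundle is a closed condition. -/
theorem IsLift.mem_normalSpace_of_punctured {m : ℕ} {Y F : ℂ → Fin (m + 1) → ℂ} {Ω : Set ℂ}
    (h : IsLift Y Ω) (hF : ContDiffOn ℝ ∞ F Ω) {x : ℂ}
    (hmem : ∀ z ∈ Ω, z ≠ x → F z ∈ normalSpace Y z) {z : ℂ} (hz : z ∈ Ω) :
    F z ∈ normalSpace Y z := by
  by_cases hzx : z = x
  · subst hzx
    have c := fun {f : ℂ → Fin (m + 1) → ℂ} (hf : ContDiffOn ℝ ∞ f Ω) =>
      hf.continuousOn.continuousAt (h.isOpen.mem_nhds hz)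
    have hn := h.isNormalSection_normalPart hF
    have e : normalPart Y z (F z) = F z := by
      refine eq_of_eventually_eq_punctured (f := fun w => normalPart Y w (F w)) (c hn.smooth)
        (c hF) ?_
      filter_upwards [self_mem_nhdsWithin, nhdsWithin_le_nhds (h.isOpen.mem_nhds hz)] with w h1 h2
      exact IsLift.normalPart_of_mem (hmem w h2 h1)
    rw [← e]
    exact h.normalPart_mem hz _
  · exact hmem z hz hzx

section JetOrthogonalHopf

variable {m : ℕ} {Y : ℂ → Fin (m + 1) → ℂ} {Ω : Set ℂ}

namespace IsIsotropicWillmoreLift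

theorem isJetOrthogonal_hopf_hopf (h : IsIsotropicWillmoreLift Y Ω) :
    IsJetOrthogonal (hopf Y) (hopf Y) Ω := by
  intro z hz
  have mκ := h.normalSection_hopf.mem z hz
  refine ⟨h.isotropic z hz, ?_, ?_⟩
  · rw [← IsLift.lorentz_normalPart_left _ mκ]; exact h.lorentz_dZ_hopf_hopf hz
  · rw [← IsLift.lorentz_normalPart_left _ mκ]; exact h.lorentz_dZbar_hopf_hopf hz

theorem isJetOrthogonal_hopf_dZbar (h : IsIsotropicWillmoreLift Y Ω)
    (hq : ∀ w ∈ Ω, quartic Y w = 0) :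
    IsJetOrthogonal (hopf Y) (normalDZbar Y (hopf Y)) Ω := by
  intro z hz
  have mκ := h.normalSection_dZbar_hopf.mem z hz
  refine ⟨?_, ?_, ?_⟩
  · rw [lorentz_comm]; exact h.lorentz_dZbar_hopf_hopf hz
  · rw [← IsLift.lorentz_normalPart_left _ mκ]; exact hq z hz
  · rw [← IsLift.lorentz_normalPart_left _ mκ]; exact h.lorentz_dZbar_hopf_self hz

theorem isJetOrthogonal_dZbar_hopf (h : IsIsotropicWillmoreLift Y Ω)
    (hq : ∀ w ∈ Ω, quartic Y w = 0) :
    IsJetOrthogonal (normalDZbar Y (hopf Y)) (hopf Y) Ω := by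
  intro z hz
  have mκ := h.normalSection_hopf.mem z hz
  have e := h.dZbar_dZbar_hopf hz
  refine ⟨h.lorentz_dZbar_hopf_hopf hz, ?_, ?_⟩
  · rw [← IsLift.lorentz_normalPart_left _ mκ]; exact h.lorentz_dZ_dZbar_hopf_hopf hq hz
  · rw [← IsLift.lorentz_normalPart_left _ mκ]
    change lorentz (normalDZbar Y (normalDZbar Y (hopf Y)) z) _ = 0
    rw [e, lorentz_smul_left, h.isotropic z hz, mul_zero]

theorem isJetOrthogonal_dZbar_dZbar (h : IsIsotropicWillmoreLift Y Ω) :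
    IsJetOrthogonal (normalDZbar Y (hopf Y)) (normalDZbar Y (hopf Y)) Ω := by
  intro z hz
  have mκ := h.normalSection_dZbar_hopf.mem z hz
  have e := h.dZbar_dZbar_hopf hz
  refine ⟨h.lorentz_dZbar_hopf_self hz, ?_, ?_⟩
  · rw [← IsLift.lorentz_normalPart_left _ mκ]; exact h.lorentz_dZ_dZbar_hopf_dZbar_hopf hz
  · rw [← IsLift.lorentz_normalPart_left _ mκ]
    change lorentz (normalDZbar Y (normalDZbar Y (hopf Y)) z) _ = 0
    rw [e, lorentz_smul_left, lorentz_comm, h.lorentz_dZbar_hopf_hopf hz, mul_zero]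

end IsIsotropicWillmoreLift

end JetOrthogonalHopf

/-! ### Construction of the adapted frame -/

/-- Two smooth, pointwise independent normal sections spanning a plane that is orthogonal to
itself, to `κ`, and to the first derivatives of the two sections and of `κ`. In a normal bundle of
rank four such a plane is maximal isotropic, so that these orthogonality relations say that the
plane is parallel and contains `κ`, `D_z κ` and `D_z̄ κ`. -/
structure IsPreFrame {m : ℕ} (Y : ℂ → Fin (m + 1) → ℂ) (U : Set ℂ)
    (F : Fin 2 → ℂ → Fin (m + 1) → ℂ) : Prop where
  normal : ∀ i, IsNormalSection Y (F i) U
  independent : ∀ z ∈ U, ∀ a b : ℂ, a • F 0 z + b • F 1 z = 0 → a = 0 ∧ b = 0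
  jet : ∀ i j, IsJetOrthogonal (F i) (F j) U
  jet_hopf : ∀ i, IsJetOrthogonal (hopf Y) (F i) U

/-- Near a zero of order `n` of `κ ∧ D_z̄ κ`, two columns of the quotient of this bivector by
`(z - x)ⁿ` span the extension of the isotropic plane bundle spanned by `κ` and `D_z̄ κ`. -/
theorem IsIsotropicWillmoreLift.exists_preFrame {m : ℕ} {Y : ℂ → Fin (m + 1) → ℂ} {Ω : Set ℂ}
    (h : IsIsotropicWillmoreLift Y Ω) (hq : ∀ w ∈ Ω, quartic Y w = 0) {x : ℂ} (hx : x ∈ Ω)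
    {n : ℕ} {g : ℂ → Fin (m + 1) × Fin (m + 1) → ℂ} (hg : ContDiffOn ℝ ∞ g Ω)
    (hWg : ∀ w ∈ Ω, hopfWedge Y w = (w - x) ^ n • g w) (hgx : g x ≠ 0) :
    ∃ U : Set ℂ, IsOpen U ∧ x ∈ U ∧ U ⊆ Ω ∧ ∃ F, IsPreFrame Y U F := by
  obtain ⟨p, hp⟩ : ∃ p, g x p ≠ 0 := by
    by_contra! hne
    exact hgx (funext hne)
  have hgp := contDiffOn_pi.1 hg
  let U : Set ℂ := Ω ∩ (fun z => g z p) ⁻¹' {0}ᶜ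
  have hU : IsOpen U := (hgp p).continuousOn.isOpen_inter_preimage h.isOpen isOpen_compl_singleton
  have hUΩ : U ⊆ Ω := Set.inter_subset_left
  have hxU : x ∈ U := ⟨hx, hp⟩
  have hYU := h.toIsLift.mono hU hUΩ
  let F : Fin 2 → ℂ → Fin (m + 1) → ℂ := ![fun z => colMap p.1 (g z), fun z => colMap p.2 (g z)]
  -- Off `x` the columns of `g` are combinations of `κ` and `D_z̄ κ`.
  let V : Set ℂ := U \ {x}
  have hV : IsOpen V := hU.sdiff isClosed_singleton
  have hVΩ : V ⊆ Ω := Set.sdiff_subset.trans hUΩ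
  let c : ℂ → ℂ := fun z => ((z - x) ^ n)⁻¹
  have hc0 : ∀ z ∈ V, (z - x) ^ n ≠ 0 := fun z hz => pow_ne_zero n (sub_ne_zero.2 hz.2)
  have hcs : ContDiffOn ℝ ∞ c V := fun z hz =>
    ((contDiffAt_id.sub contDiffAt_const).pow n |>.inv (hc0 z hz)).contDiffWithinAt
  have sκ := h.normalSection_hopf.smooth
  have sκ' := h.normalSection_dZbar_hopf.smooth
  have hcol : ∀ b, Set.EqOn (fun z => colMap b (g z))
      (fun z => (c z * normalDZbar Y (hopf Y) z b) • hopf Y z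
        + (-(c z * hopf Y z b)) • normalDZbar Y (hopf Y) z) V := by
    intro b z hz
    have h1 : g z = c z • hopfWedge Y z := by
      rw [hWg z (hVΩ hz), smul_smul, inv_mul_cancel₀ (hc0 z hz), one_smul]
    simp only [h1, map_smul, colMap_hopfWedge]
    module
  have hca : ∀ b, ContDiffOn ℝ ∞ (fun z => c z * normalDZbar Y (hopf Y) z b) V := fun b =>
    hcs.mul ((contDiffOn_pi.1 sκ' b).mono hVΩ)
  have hcb : ∀ b, ContDiffOn ℝ ∞ (fun z => -(c z * hopf Y z b)) V := fun b =>
    (hcs.mul ((contDiffOn_pi.1 sκ b).mono hVΩ)).neg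
  have hcolS : ∀ b, ContDiffOn ℝ ∞ (fun z => colMap b (g z)) U := fun b =>
    contDiffOn_pi.2 fun a => (hgp (a, b)).mono hUΩ
  have jκκ := h.isJetOrthogonal_hopf_hopf.mono hVΩ
  have jκκ' := (h.isJetOrthogonal_hopf_dZbar hq).mono hVΩ
  have jκ'κ := (h.isJetOrthogonal_dZbar_hopf hq).mono hVΩ
  have jκ'κ' := h.isJetOrthogonal_dZbar_dZbar.mono hVΩ
  have jl : ∀ b {A : ℂ → Fin (m + 1) → ℂ}, IsJetOrthogonal (hopf Y) A V →
      IsJetOrthogonal (normalDZbar Y (hopf Y)) A V →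
      IsJetOrthogonal (fun z => colMap b (g z)) A V := fun b A h1 h2 =>
    (IsJetOrthogonal.comb_left hV h1 h2 (hca b) (hcb b) (sκ.mono hVΩ) (sκ'.mono hVΩ)).congr hV
      (hcol b) (fun _ _ => rfl)
  have jr : ∀ b {ψ : ℂ → Fin (m + 1) → ℂ}, IsJetOrthogonal ψ (hopf Y) V →
      IsJetOrthogonal ψ (normalDZbar Y (hopf Y)) V →
      IsJetOrthogonal ψ (fun z => colMap b (g z)) V := fun b ψ h1 h2 =>
    (IsJetOrthogonal.comb_right h1 h2 _ _).congr hV (fun _ _ => rfl) (hcol b)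
  have hnormal : ∀ b, IsNormalSection Y (fun z => colMap b (g z)) U := fun b =>
    ⟨hcolS b, fun z hz => hYU.mem_normalSpace_of_punctured (hcolS b) (x := x)
      (fun z hz hzx => by
        have e := hcol b ⟨hz, hzx⟩
        simp only at e
        rw [e]
        exact add_mem (Submodule.smul_mem _ _ (h.normalSection_hopf.mem z (hUΩ hz)))
          (Submodule.smul_mem _ _ (h.normalSection_dZbar_hopf.mem z (hUΩ hz)))) hz⟩
  have hjet : ∀ a b, IsJetOrthogonal (fun z => colMap a (g z)) (fun z => colMap b (g z)) U :=
    fun a b => IsJetOrthogonal.of_punctured hU (hcolS a) (hcolS b)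
      (jl a (jr b jκκ jκκ') (jr b jκ'κ jκ'κ'))
  have hjetκ : ∀ b, IsJetOrthogonal (hopf Y) (fun z => colMap b (g z)) U := fun b =>
    IsJetOrthogonal.of_punctured hU (sκ.mono hUΩ) (hcolS b) (jr b jκκ jκκ')
  -- The bivector `g` inherits antisymmetry from `κ ∧ D_z̄ κ`.
  have hanti : ∀ z ∈ U, ∀ a b, g z (a, b) = -g z (b, a) := by
    have hoff : ∀ z ∈ V, ∀ a b, g z (a, b) = -g z (b, a) := by
      intro z hz a b
      have h1 := congrFun (hWg z (hVΩ hz)) (a, b)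
      have h2 := congrFun (hWg z (hVΩ hz)) (b, a)
      simp only [hopfWedge, Pi.smul_apply, smul_eq_mul] at h1 h2
      refine mul_left_cancel₀ (hc0 z hz) ?_
      linear_combination -h1 - h2
    intro z hz a b
    by_cases hzx : z = x
    · subst hzx
      have cc := fun q => (hgp q).continuousOn.continuousAt (h.isOpen.mem_nhds hx)
      refine eq_of_eventually_eq_punctured (f := fun w => g w (a, b)) (g := fun w => -g w (b, a))
        (cc _) (cc _).neg ?_
      filter_upwards [self_mem_nhdsWithin, nhdsWithin_le_nhds (hU.mem_nhds hxU)] with w h1 h2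
      exact hoff w ⟨h2, h1⟩ a b
    · exact hoff z ⟨hz, hzx⟩ a b
  refine ⟨U, hU, hxU, hUΩ, F, ?_, ?_, ?_, ?_⟩
  · intro i
    fin_cases i
    exacts [hnormal _, hnormal _]
  · intro z hz a b hab
    have hz0 : g z (p.1, p.2) ≠ 0 := hz.2
    have hdiag : ∀ i, g z (i, i) = 0 := fun i => by
      have := hanti z hz i i
      linear_combination this / 2
    have h1 := congrFun hab p.1
    have h2 := congrFun hab p.2
    have h1' : a * g z (p.1, p.1) + b * g z (p.1, p.2) = 0 := h1
    have h2' : a * g z (p.2, p.1) + b * g z (p.2, p.2) = 0 := h2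
    rw [hdiag, mul_zero, zero_add] at h1'
    rw [hdiag, mul_zero, add_zero, hanti z hz] at h2'
    exact ⟨(mul_eq_zero.1 h2').resolve_right (neg_ne_zero.2 hz0),
      (mul_eq_zero.1 h1').resolve_right hz0⟩
  · intro i j
    fin_cases i <;> fin_cases j
    exacts [hjet _ _, hjet _ _, hjet _ _, hjet _ _]
  · intro i
    fin_cases i
    exacts [hjetκ _, hjetκ _]

/-- A normal section without zeros can be normalized. -/
theorem IsLift.exists_normalize {m : ℕ} {Y F : ℂ → Fin (m + 1) → ℂ} {U : Set ℂ} (h : IsLift Y U)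
    (hF : IsNormalSection Y F U) (hF0 : ∀ z ∈ U, F z ≠ 0) :
    ∃ c : ℂ → ℂ, ContDiffOn ℝ ∞ c U ∧ (∀ z ∈ U, c z ≠ 0) ∧
      ∀ z ∈ U, lorentz (c z • F z) (star (c z • F z)) = 1 := by
  have hs := contDiffOn_lorentz hF.smooth (contDiffOn_star hF.smooth)
  let r : ℂ → ℝ := fun z => (lorentz (F z) (star (F z))).re
  have hr : ∀ z ∈ U, 0 < r z ∧ lorentz (F z) (star (F z)) = r z := by
    intro z hz
    obtain ⟨s, hs, hs'⟩ := h.exists_pos_lorentz_star_self hz (hF.mem z hz) (hF0 z hz)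
    have : r z = s := by simp [r, hs']
    rw [this]
    exact ⟨hs, hs'⟩
  have hrs : ContDiffOn ℝ ∞ r U := Complex.reCLM.contDiff.comp_contDiffOn hs
  refine ⟨fun z => (((√(r z))⁻¹ : ℝ) : ℂ), ?_, fun z hz => ?_, fun z hz => ?_⟩
  · exact Complex.ofRealCLM.contDiff.comp_contDiffOn
      ((hrs.sqrt fun z hz => (hr z hz).1.ne').inv fun z hz =>
        (Real.sqrt_pos.2 (hr z hz).1).ne')
  · exact Complex.ofReal_ne_zero.2 (inv_ne_zero (Real.sqrt_pos.2 (hr z hz).1).ne')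
  · rw [star_smul, lorentz_smul_left, lorentz_smul_right, (hr z hz).2]
    simp only [RCLike.star_def, Complex.conj_ofReal]
    rw [← Complex.ofReal_mul, ← Complex.ofReal_mul, ← Complex.ofReal_one]
    congr 1
    have h1 := Real.mul_self_sqrt (hr z hz).1.le
    have h2 := (Real.sqrt_pos.2 (hr z hz).1).ne'
    field_simp
    linarith

/-- Gram–Schmidt orthonormalization of a pre-frame. -/
theorem IsPreFrame.exists_unitary {m : ℕ} {Y : ℂ → Fin (m + 1) → ℂ} {U : Set ℂ}
    {F : Fin 2 → ℂ → Fin (m + 1) → ℂ} (hF : IsPreFrame Y U F) (h : IsLift Y U) :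
    ∃ E : Fin 2 → ℂ → Fin (m + 1) → ℂ, IsPreFrame Y U E ∧
      ∀ z ∈ U, ∀ i j, lorentz (E i z) (star (E j z)) = if i = j then 1 else 0 := by
  have hU := h.isOpen
  have n0 := hF.normal 0
  have n1 := hF.normal 1
  obtain ⟨c, hc, hc0, hc1⟩ := h.exists_normalize n0 fun z hz h0 => by
    have := (hF.independent z hz 1 0 (by simp [h0])).1
    exact one_ne_zero this
  let E₀ : ℂ → Fin (m + 1) → ℂ := fun z => c z • F 0 z
  have sE₀ : ContDiffOn ℝ ∞ E₀ U := hc.smul n0.smooth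
  let d : ℂ → ℂ := fun z => lorentz (F 1 z) (star (E₀ z))
  have hd : ContDiffOn ℝ ∞ d U := contDiffOn_lorentz n1.smooth (contDiffOn_star sE₀)
  let G : ℂ → Fin (m + 1) → ℂ := fun z => F 1 z - d z • E₀ z
  have nG : IsNormalSection Y G U := ⟨n1.smooth.sub (hd.smul sE₀), fun z hz =>
    sub_mem (n1.mem z hz) (Submodule.smul_mem _ _ (Submodule.smul_mem _ _ (n0.mem z hz)))⟩
  obtain ⟨e, he, he0, he1⟩ := h.exists_normalize nG fun z hz h0 => by
    have := (hF.independent z hz (-(d z * c z)) 1 (by rw [← h0]; simp only [G, E₀]; module)).2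
    exact one_ne_zero this
  let E₁ : ℂ → Fin (m + 1) → ℂ := fun z => e z • G z
  -- Both sections are combinations of `F 0` and `F 1` with smooth coefficients.
  let a : Fin 2 → ℂ → ℂ := ![c, fun z => -(e z * d z * c z)]
  let b : Fin 2 → ℂ → ℂ := ![fun _ => 0, e]
  let E : Fin 2 → ℂ → Fin (m + 1) → ℂ := fun i z => a i z • F 0 z + b i z • F 1 z
  have hE0 : ∀ z, E 0 z = E₀ z := fun z => by simp [E, a, b, E₀]
  have hE1 : ∀ z, E 1 z = E₁ z := fun z => by
    simp only [E, a, b, E₁, G, E₀, Matrix.cons_val_one, Matrix.cons_val_fin_one]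
    module
  have ha : ∀ i, ContDiffOn ℝ ∞ (a i) U := by
    intro i
    fin_cases i
    exacts [hc, ((he.mul hd).mul hc).neg]
  have hb : ∀ i, ContDiffOn ℝ ∞ (b i) U := by
    intro i
    fin_cases i
    exacts [contDiffOn_const, he]
  refine ⟨E, ⟨?_, ?_, ?_, ?_⟩, ?_⟩
  · exact fun i => ⟨((ha i).smul n0.smooth).add ((hb i).smul n1.smooth), fun z hz =>
      add_mem (Submodule.smul_mem _ _ (n0.mem z hz)) (Submodule.smul_mem _ _ (n1.mem z hz))⟩
  · intro z hz s t hst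
    rw [hE0, hE1] at hst
    obtain ⟨h1, h2⟩ := hF.independent z hz (s * c z - t * e z * d z * c z) (t * e z) (by
      rw [← hst]; simp only [E₁, G, E₀]; module)
    have ht : t = 0 := (mul_eq_zero.1 h2).resolve_right (he0 z hz)
    rw [ht] at h1
    refine ⟨(mul_eq_zero.1 (?_ : s * c z = 0)).resolve_right (hc0 z hz), ht⟩
    linear_combination h1
  · intro i j
    have hr : ∀ k, IsJetOrthogonal (F k) (E j) U := fun k =>
      IsJetOrthogonal.comb_right (hF.jet k 0) (hF.jet k 1) _ _
    exact IsJetOrthogonal.comb_left hU (hr 0) (hr 1) (ha i) (hb i) n0.smooth n1.smooth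
  · exact fun i => IsJetOrthogonal.comb_right (hF.jet_hopf 0) (hF.jet_hopf 1) _ _
  · intro z hz
    have u00 : lorentz (E₀ z) (star (E₀ z)) = 1 := hc1 z hz
    have u11 : lorentz (E₁ z) (star (E₁ z)) = 1 := he1 z hz
    have u10 : lorentz (E₁ z) (star (E₀ z)) = 0 := by
      simp only [E₁, G, lorentz_smul_left, lorentz_sub_left, u00]
      simp [d]
    have u01 : lorentz (E₀ z) (star (E₁ z)) = 0 := by
      rw [← star_star (E₀ z), lorentz_star_star, lorentz_comm, u10, star_zero]
    intro i j
    fin_cases i <;> fin_cases j <;> simp [hE0, hE1, u00, u11, u10, u01]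

/-- A unitary pre-frame of a surface in `S⁶` is an adapted isotropic frame. -/
theorem IsPreFrame.isAdaptedIsotropicFrame {Y : ℂ → Fin 8 → ℂ} {U : Set ℂ}
    {E : Fin 2 → ℂ → Fin 8 → ℂ} (hE : IsPreFrame (m := 7) Y U E) (h : IsLift (m := 7) Y U)
    (huni : ∀ z ∈ U, ∀ i j, lorentz (m := 7) (E i z) (star (E j z)) = if i = j then 1 else 0) :
    IsAdaptedIsotropicFrame (m := 7) Y U E := by
  have hiso : ∀ z ∈ U, ∀ i j, lorentz (m := 7) (E i z) (E j z) = 0 := fun z hz i j =>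
    (hE.jet i j z hz).1
  have hsum := fun {z : ℂ} (hz : z ∈ U) {v : Fin 8 → ℂ} (hv : v ∈ normalSpace (m := 7) Y z) =>
    h.eq_sum_of_isotropic hz (e := fun i => E i z) (fun i => (hE.normal i).mem z hz)
      (hiso z hz) (huni z hz) hv
  have hmem : ∀ z ∈ U, ∀ v ∈ normalSpace (m := 7) Y z, (∀ i, lorentz (m := 7) v (E i z) = 0) →
      v ∈ Submodule.span ℂ (Set.range fun i => E i z) := by
    intro z hz v hv h0
    have := hsum hz hv
    rw [h0, h0, zero_smul, zero_smul, add_zero, add_zero] at this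
    exact mem_span_range_fin_two.2 ⟨_, _, this⟩
  have hmem' : ∀ z ∈ U, ∀ v ∈ normalSpace (m := 7) Y z,
      (∀ i, lorentz (m := 7) v (star (E i z)) = 0) →
      v ∈ Submodule.span ℂ (Set.range fun i => star (E i z)) := by
    intro z hz v hv h0
    have := hsum hz hv
    rw [h0, h0, zero_smul, zero_smul, zero_add, zero_add] at this
    exact mem_span_range_fin_two.2 ⟨_, _, this⟩
  have hstar : ∀ i, ContDiffOn ℝ ∞ (fun w => star (E i w)) U := fun i =>
    contDiffOn_star (hE.normal i).smooth
  have hstarmem := fun {z : ℂ} (hz : z ∈ U) i =>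
    h.star_mem_normalSpace hz ((hE.normal i).mem z hz)
  refine ⟨fun i => (hE.normal i).smooth, ?_, hiso, huni, ?_, ?_, ?_, ?_, ?_, ?_, ?_⟩
  · intro z hz
    refine le_antisymm (Submodule.span_le.2 ?_) fun v hv => ?_
    · rintro v (⟨i, rfl⟩ | ⟨i, rfl⟩)
      exacts [(hE.normal i).mem z hz, hstarmem hz i]
    · rw [hsum hz hv]
      have m1 := fun i => Submodule.subset_span (R := ℂ) (s := Set.range (fun i => E i z)
        ∪ Set.range (fun i => star (E i z))) (Or.inl ⟨i, rfl⟩)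
      have m2 := fun i => Submodule.subset_span (R := ℂ) (s := Set.range (fun i => E i z)
        ∪ Set.range (fun i => star (E i z))) (Or.inr ⟨i, rfl⟩)
      exact add_mem (add_mem (Submodule.smul_mem _ _ (m1 0)) (Submodule.smul_mem _ _ (m1 1)))
        (add_mem (Submodule.smul_mem _ _ (m2 0)) (Submodule.smul_mem _ _ (m2 1)))
  · exact fun z hz => hmem z hz _ (h.isNormalSection_hopf.mem z hz) fun i =>
      (hE.jet_hopf i z hz).1
  · exact fun z hz => hmem z hz _ (h.normalPart_mem hz _) fun i =>
      (IsLift.lorentz_normalPart_left _ ((hE.normal i).mem z hz)).trans (hE.jet_hopf i z hz).2.1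
  · exact fun z hz => hmem z hz _ (h.normalPart_mem hz _) fun i =>
      (IsLift.lorentz_normalPart_left _ ((hE.normal i).mem z hz)).trans (hE.jet_hopf i z hz).2.2
  · exact fun z hz i => hmem z hz _ (h.normalPart_mem hz _) fun j =>
      (IsLift.lorentz_normalPart_left _ ((hE.normal j).mem z hz)).trans (hE.jet i j z hz).2.1
  · exact fun z hz i => hmem z hz _ (h.normalPart_mem hz _) fun j =>
      (IsLift.lorentz_normalPart_left _ ((hE.normal j).mem z hz)).trans (hE.jet i j z hz).2.2
  · intro z hz i
    refine hmem' z hz _ (h.normalPart_mem hz _) fun j => ?_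
    rw [normalDZ, IsLift.lorentz_normalPart_left _ (hstarmem hz j),
      h.dZ_star hz (hE.normal i).smooth, lorentz_star_star, (hE.jet i j z hz).2.2, star_zero]
  · intro z hz i
    refine hmem' z hz _ (h.normalPart_mem hz _) fun j => ?_
    rw [normalDZbar, IsLift.lorentz_normalPart_left _ (hstarmem hz j),
      h.dZbar_star hz (hE.normal i).smooth, lorentz_star_star, (hE.jet i j z hz).2.1, star_zero]

/-! ### Total isotropy and fullness from an adapted frame -/

section FrameConsequences

/-- `F` is orthogonal to `Y`, `Y_z`, `E₁` and `E₂`. For a surface in `S⁶` with an adapted frame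
these four span a maximal isotropic subspace of `ℂ⁸`, so that `F` takes values in their span. -/
structure IsOsculating {m : ℕ} (Y : ℂ → Fin (m + 1) → ℂ) (U : Set ℂ)
    (E : Fin 2 → ℂ → Fin (m + 1) → ℂ) (F : ℂ → Fin (m + 1) → ℂ) : Prop where
  smooth : ContDiffOn ℝ ∞ F U
  self : ∀ z ∈ U, lorentz (F z) (Y z) = 0
  dZ_self : ∀ z ∈ U, lorentz (F z) (dZ Y z) = 0
  frame : ∀ z ∈ U, ∀ i, lorentz (F z) (E i z) = 0

namespace IsAdaptedIsotropicFrame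

variable {m : ℕ} {Y : ℂ → Fin (m + 1) → ℂ} {U : Set ℂ} {E : Fin 2 → ℂ → Fin (m + 1) → ℂ}

theorem isNormalSection (hE : IsAdaptedIsotropicFrame Y U E) (i : Fin 2) :
    IsNormalSection Y (E i) U :=
  ⟨hE.smooth i, fun z hz => by
    rw [← hE.span_eq z hz]
    exact Submodule.subset_span (Or.inl ⟨i, rfl⟩)⟩

/-- The bundle spanned by `Y`, `Y_z`, `E₁` and `E₂` is preserved by `∂/∂z`, because it contains `κ`
and the plane of `E₁` and `E₂` is parallel. -/
theorem isOsculating_dZ (hE : IsAdaptedIsotropicFrame Y U E) (h : IsLift Y U)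
    {F : ℂ → Fin (m + 1) → ℂ} (hF : IsOsculating Y U E F) : IsOsculating Y U E (dZ F) := by
  have hspan : ∀ z ∈ U, ∀ v ∈ Submodule.span ℂ (Set.range fun i => E i z),
      lorentz (F z) v = 0 := by
    intro z hz v hv
    rw [lorentz_comm]
    refine lorentz_eq_zero_of_mem_span (f := fun i => E i z) hv fun i => ?_
    rw [lorentz_comm]
    exact hF.frame z hz i
  refine ⟨h.contDiffOn_dZ hF.smooth, fun z hz => ?_, fun z hz => ?_, fun z hz i => ?_⟩
  · have e := h.lorentz_dZ_add hz hF.smooth h.smooth hF.self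
    rwa [hF.dZ_self z hz, add_zero] at e
  · have e := h.lorentz_dZ_add hz hF.smooth (h.contDiffOn_dZ h.smooth) hF.dZ_self
    rwa [h.dZ_dZ hz, lorentz_sub_right, lorentz_smul_right, hF.self z hz,
      hspan z hz _ (hE.hopf_mem z hz), mul_zero, sub_zero, add_zero] at e
  · have e := h.lorentz_dZ_add hz hF.smooth (hE.smooth i) (fun w hw => hF.frame w hw i)
    have hκ : lorentz (E i z) (hopf Y z) = 0 := by
      rw [lorentz_comm]
      exact lorentz_eq_zero_of_mem_span (f := fun i => E i z) (hE.hopf_mem z hz)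
        fun j => hE.isotropic z hz j i
    rwa [h.dZ_normalSection (hE.isNormalSection i) hz, hκ, mul_zero, zero_smul, sub_zero,
      lorentz_add_right, lorentz_smul_right, hF.self z hz, hspan z hz _ (hE.normalDZ_mem z hz i),
      mul_zero, add_zero, add_zero] at e

theorem isOsculating_iterate_dZ (hE : IsAdaptedIsotropicFrame Y U E) (h : IsLift Y U) (j : ℕ) :
    IsOsculating Y U E (dZ^[j + 1] Y) := by
  induction j with
  | zero =>
    refine ⟨h.contDiffOn_dZ h.smooth, fun z hz => h.lorentz_dZ_self hz,
      fun z hz => h.conformal z hz, fun z hz i => ?_⟩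
    rw [lorentz_comm]
    exact (mem_normalSpace_iff.1 ((hE.isNormalSection i).mem z hz)).2.1
  | succ j ih =>
    rw [Function.iterate_succ_apply']
    exact hE.isOsculating_dZ h ih

end IsAdaptedIsotropicFrame

variable {Y : ℂ → Fin 8 → ℂ} {U : Set ℂ} {E : Fin 2 → ℂ → Fin 8 → ℂ} {z : ℂ}

theorem IsAdaptedIsotropicFrame.eq_sum (hE : IsAdaptedIsotropicFrame (m := 7) Y U E)
    (h : IsLift (m := 7) Y U) (hz : z ∈ U) {v : Fin 8 → ℂ} (hv : v ∈ normalSpace (m := 7) Y z) :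
    v = lorentz (m := 7) v (star (E 0 z)) • E 0 z + lorentz (m := 7) v (star (E 1 z)) • E 1 z
      + (lorentz (m := 7) v (E 0 z) • star (E 0 z) + lorentz (m := 7) v (E 1 z) • star (E 1 z)) :=
  h.eq_sum_of_isotropic hz (e := fun i => E i z) (fun i => (hE.isNormalSection i).mem z hz)
    (hE.isotropic z hz) (hE.unitary z hz) hv

theorem IsOsculating.lorentz_eq_zero {F G : ℂ → Fin 8 → ℂ}
    (hF : IsOsculating (m := 7) Y U E F) (hG : IsOsculating (m := 7) Y U E G)
    (hE : IsAdaptedIsotropicFrame (m := 7) Y U E) (h : IsLift (m := 7) Y U) (hz : z ∈ U) :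
    lorentz (m := 7) (F z) (G z) = 0 := by
  have e := hE.eq_sum h hz (h.normalPart_mem hz (F z))
  have e0 : ∀ i, lorentz (m := 7) (normalPart (m := 7) Y z (F z)) (E i z) = 0 := fun i => by
    rw [IsLift.lorentz_normalPart_left _ ((hE.isNormalSection i).mem z hz)]
    exact hF.frame z hz i
  rw [e0, e0, zero_smul, zero_smul, add_zero, add_zero] at e
  have e1 : lorentz (m := 7) (normalPart (m := 7) Y z (F z)) (G z) = 0 := by
    rw [e, lorentz_add_left, lorentz_smul_left, lorentz_smul_left, lorentz_comm (E 0 z),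
      lorentz_comm (E 1 z), hG.frame z hz, hG.frame z hz]
    ring
  rw [normalPart, hF.self z hz, hF.dZ_self z hz] at e1
  simp only [lorentz_add_left, lorentz_sub_left, lorentz_smul_left, lorentz_comm (Y z) (G z),
    lorentz_comm (dZ Y z) (G z), hG.self z hz, hG.dZ_self z hz] at e1
  linear_combination e1

theorem IsAdaptedIsotropicFrame.lorentz_iterate_dZ (hE : IsAdaptedIsotropicFrame (m := 7) Y U E)
    (h : IsLift (m := 7) Y U) (hz : z ∈ U) {j k : ℕ} (hj : 0 < j) (hk : 0 < k) :
    lorentz (m := 7) (dZ^[j] Y z) (dZ^[k] Y z) = 0 := by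
  obtain ⟨j, rfl⟩ := Nat.exists_eq_add_one.2 hj
  obtain ⟨k, rfl⟩ := Nat.exists_eq_add_one.2 hk
  exact (hE.isOsculating_iterate_dZ h j).lorentz_eq_zero (hE.isOsculating_iterate_dZ h k) hE h hz

/-- A real vector orthogonal to the lift is orthogonal to `κ` and `D_z̄ κ`, hence to the whole
normal bundle at a point where these two are independent. -/
theorem IsAdaptedIsotropicFrame.eq_zero_of_lorentz_eq_zero
    (hE : IsAdaptedIsotropicFrame (m := 7) Y U E) (h : IsLift (m := 7) Y U) {v : Fin 8 → ℂ}
    (hv : star v = v) (hvY : ∀ w ∈ U, lorentz (m := 7) v (Y w) = 0) (hz : z ∈ U)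
    (hW : hopfWedge (m := 7) Y z ≠ 0) : v = 0 := by
  have d1 : ∀ {f : ℂ → Fin 8 → ℂ}, ContDiffOn ℝ ∞ f U → (∀ w ∈ U, lorentz (m := 7) v (f w) = 0) →
      ∀ w ∈ U, lorentz (m := 7) v (dZ f w) = 0 := fun hf h0 w hw => by
    have := h.lorentz_dZ_add hw (f := fun _ => v) contDiffOn_const hf h0
    rwa [show dZ (fun _ => v) w = 0 from pdz_const v w, lorentz_zero_left, zero_add] at this
  have d2 : ∀ {f : ℂ → Fin 8 → ℂ}, ContDiffOn ℝ ∞ f U → (∀ w ∈ U, lorentz (m := 7) v (f w) = 0) →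
      ∀ w ∈ U, lorentz (m := 7) v (dZbar f w) = 0 := fun hf h0 w hw => by
    have := h.lorentz_dZbar_add hw (f := fun _ => v) contDiffOn_const hf h0
    rwa [show dZbar (fun _ => v) w = 0 from pdzbar_const v w, lorentz_zero_left, zero_add] at this
  have vZ := d1 h.smooth hvY
  have vZb := d2 h.smooth hvY
  have vL := d1 (h.contDiffOn_dZbar h.smooth) vZb
  have vn : ∀ w ∈ U, v ∈ normalSpace (m := 7) Y w := fun w hw =>
    mem_normalSpace_iff.2 ⟨hvY w hw, vZ w hw, vZb w hw, vL w hw⟩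
  have vκ : ∀ w ∈ U, lorentz (m := 7) v (hopf (m := 7) Y w) = 0 := fun w hw => by
    rw [hopf, IsLift.lorentz_normalPart_right _ (vn w hw)]
    exact d1 (h.contDiffOn_dZ h.smooth) vZ w hw
  have vκ' : lorentz (m := 7) v (normalDZbar (m := 7) Y (hopf (m := 7) Y) z) = 0 := by
    rw [normalDZbar, IsLift.lorentz_normalPart_right _ (vn z hz)]
    exact d2 h.isNormalSection_hopf.smooth vκ z hz
  obtain ⟨a, b, hab⟩ := mem_span_range_fin_two.1 (hE.hopf_mem z hz)
  obtain ⟨c, d, hcd⟩ := mem_span_range_fin_two.1 (hE.normalDZbar_hopf_mem z hz)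
  have hdet : a * d - b * c ≠ 0 := fun h0 => hW <| by
    funext p
    simp only [hopfWedge, hab, hcd, Pi.add_apply, Pi.smul_apply, smul_eq_mul, Pi.zero_apply]
    linear_combination (E 0 z p.1 * E 1 z p.2 - E 1 z p.1 * E 0 z p.2) * h0
  have k1 := vκ z hz
  have k2 := vκ'
  rw [hab, lorentz_add_right, lorentz_smul_right, lorentz_smul_right] at k1
  rw [hcd, lorentz_add_right, lorentz_smul_right, lorentz_smul_right] at k2
  have z0 : lorentz (m := 7) v (E 0 z) = 0 :=
    (mul_eq_zero.1 (by linear_combination d * k1 - b * k2 :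
      (a * d - b * c) * lorentz (m := 7) v (E 0 z) = 0)).resolve_left hdet
  have z1 : lorentz (m := 7) v (E 1 z) = 0 :=
    (mul_eq_zero.1 (by linear_combination a * k2 - c * k1 :
      (a * d - b * c) * lorentz (m := 7) v (E 1 z) = 0)).resolve_left hdet
  have s : ∀ i, lorentz (m := 7) v (E i z) = 0 → lorentz (m := 7) v (star (E i z)) = 0 :=
    fun i hi => by
      rw [← hv, lorentz_star_star, hi, star_zero]
  have e := hE.eq_sum h hz (vn z hz)
  rw [z0, z1, s 0 z0, s 1 z1] at e
  simpa using e

end FrameConsequences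

/-! ### The canonical lift of a conformal immersion -/

section CanonicalLift

variable {m : ℕ}

/-- The real linear inclusion `ℝᵐ → ℂᵐ`. -/
def complexifyL (m : ℕ) : EuclideanSpace ℝ (Fin m) →L[ℝ] (Fin m → ℂ) :=
  ContinuousLinearMap.pi fun i => Complex.ofRealCLM ∘L EuclideanSpace.proj i

/-- The real linear inclusion `v ↦ (0, v)` of `ℝᵐ` into the complexified Lorentz space. -/
def spaceL (m : ℕ) : EuclideanSpace ℝ (Fin m) →L[ℝ] (Fin (m + 1) → ℂ) :=
  ContinuousLinearMap.pi (Fin.cons 0 fun i => Complex.ofRealCLM ∘L EuclideanSpace.proj i)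

theorem lorentz_spaceL (u v : EuclideanSpace ℝ (Fin m)) :
    lorentz (spaceL m u) (spaceL m v) = ((inner ℝ u v : ℝ) : ℂ) := by
  simp only [lorentz, spaceL, ContinuousLinearMap.coe_pi', Fin.cons_zero, Fin.cons_succ,
    PiLp.inner_apply, RCLike.inner_apply]
  simp [mul_comm]

theorem vecCons_one_complexify (f : ℂ → EuclideanSpace ℝ (Fin m)) (z : ℂ) :
    (Matrix.vecCons 1 (complexify f z) : Fin (m + 1) → ℂ) = Pi.single 0 1 + spaceL m (f z) := by
  funext i
  refine Fin.cases ?_ (fun i => ?_) i <;> simp [spaceL, complexify]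

theorem lorentz_single_spaceL (v : EuclideanSpace ℝ (Fin m)) :
    lorentz (Pi.single 0 1) (spaceL m v) = 0 := by
  simp [lorentz, spaceL]

theorem lorentz_single_single :
    lorentz (Pi.single 0 1 : Fin (m + 1) → ℂ) (Pi.single 0 1) = -1 := by
  simp [lorentz]

variable {f : ℂ → EuclideanSpace ℝ (Fin m)} {Ω : Set ℂ} {z : ℂ}

theorem inner_fderiv_of_norm_eq_one (hΩ : IsOpen Ω) (hf : ContDiffOn ℝ ∞ f Ω)
    (hs : ∀ z ∈ Ω, ‖f z‖ = 1) (hz : z ∈ Ω) (v : ℂ) : inner ℝ (f z) (fderiv ℝ f z v) = 0 := by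
  have hd : DifferentiableAt ℝ f z := (hf.contDiffAt (hΩ.mem_nhds hz)).differentiableAt (by simp)
  have h1 : fderiv ℝ (fun w => (inner ℝ (f w) (f w) : ℝ)) z v = 0 := by
    have : (fun w => (inner ℝ (f w) (f w) : ℝ)) =ᶠ[nhds z] fun _ => (1 : ℝ) := by
      filter_upwards [hΩ.mem_nhds hz] with w hw
      rw [real_inner_self_eq_norm_sq, hs w hw, one_pow]
    rw [this.fderiv_eq]
    simp
  rw [fderiv_inner_apply ℝ hd hd, real_inner_comm (f z)] at h1
  exact add_self_eq_zero.1 h1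

/-- The derivative data of a conformal immersion in the real basis `1, i` of `ℂ`. -/
theorem exists_inner_fderiv_of_conformalAt (hc : ConformalAt f z) :
    ∃ c : ℝ, 0 < c ∧ inner ℝ (fderiv ℝ f z 1) (fderiv ℝ f z 1) = c ∧
      inner ℝ (fderiv ℝ f z Complex.I) (fderiv ℝ f z Complex.I) = c ∧
      inner ℝ (fderiv ℝ f z 1) (fderiv ℝ f z Complex.I) = 0 := by
  obtain ⟨c, hc0, hc⟩ := conformalAt_iff'.1 hc
  exact ⟨c, hc0, by rw [hc]; simp, by rw [hc]; simp, by rw [hc]; simp [Complex.inner]⟩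

theorem dZ_complexify (hd : DifferentiableAt ℝ f z) (i : Fin m) :
    dZ (complexify f) z i
      = 1 / 2 * ((fderiv ℝ f z 1 i : ℂ) - Complex.I * fderiv ℝ f z Complex.I i) ∧
    dZbar (complexify f) z i
      = 1 / 2 * ((fderiv ℝ f z 1 i : ℂ) + Complex.I * fderiv ℝ f z Complex.I i) := by
  have h : HasFDerivAt (complexify f) (complexifyL m ∘L fderiv ℝ f z) z :=
    (complexifyL m).hasFDerivAt.comp z hd.hasFDerivAt
  rw [dZ, dZbar, h.fderiv]
  simp [complexifyL]

theorem conformalFactor_eq (hd : DifferentiableAt ℝ f z) :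
    conformalFactor f z = (inner ℝ (fderiv ℝ f z 1) (fderiv ℝ f z 1)
      + inner ℝ (fderiv ℝ f z Complex.I) (fderiv ℝ f z Complex.I)) / 2 := by
  have e : (2 * ∑ i : Fin m, dZ (complexify f) z i * dZbar (complexify f) z i)
      = (((inner ℝ (fderiv ℝ f z 1) (fderiv ℝ f z 1)
      + inner ℝ (fderiv ℝ f z Complex.I) (fderiv ℝ f z Complex.I)) / 2 : ℝ) : ℂ) := by
    simp only [PiLp.inner_apply, RCLike.inner_apply, ← Finset.sum_add_distrib, Finset.sum_div]
    push_cast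
    rw [Finset.mul_sum]
    refine Finset.sum_congr rfl fun i _ => ?_
    rw [(dZ_complexify hd i).1, (dZ_complexify hd i).2]
    simp only [conj_trivial]
    linear_combination (-(1 / 2 : ℂ)) * (fderiv ℝ f z Complex.I i : ℂ) ^ 2 * Complex.I_sq
  rw [conformalFactor, e, Complex.ofReal_re]

theorem conformalFactor_pos (hc : ConformalAt f z) : 0 < conformalFactor f z := by
  obtain ⟨c, hc0, h1, h2, -⟩ := exists_inner_fderiv_of_conformalAt hc
  rw [conformalFactor_eq hc.differentiableAt, h1, h2]
  linarith

theorem canonicalLift_eq (z : ℂ) : canonicalLift f z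
    = (((√(conformalFactor f z))⁻¹ : ℝ) : ℂ) • (Pi.single 0 1 + spaceL m (f z)) := by
  rw [canonicalLift, vecCons_one_complexify]

theorem canonicalLift_zero (z : ℂ) :
    canonicalLift f z 0 = (((√(conformalFactor f z))⁻¹ : ℝ) : ℂ) := by
  simp [canonicalLift]

theorem canonicalLift_zero_ne_zero (hc : ConformalAt f z) : canonicalLift f z 0 ≠ 0 := by
  rw [canonicalLift_zero]
  exact_mod_cast (inv_pos.2 (Real.sqrt_pos.2 (conformalFactor_pos hc))).ne'

/-- With `A = (1, y)` and `r = e^{-ω}`, the lift is `r A`, and `A` is null and orthogonal to its own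
derivatives, so that only `r² ⟨A_z, A_z⟩` and `r² ⟨A_z, A_z̄⟩` have to be computed. -/
theorem isLift_canonicalLift (hΩ : IsOpen Ω) (hf : ContDiffOn ℝ ∞ f Ω)
    (hc : ∀ z ∈ Ω, ConformalAt f z) (hs : ∀ z ∈ Ω, ‖f z‖ = 1) :
    IsLift (canonicalLift f) Ω := by
  set r : ℂ → ℂ := fun z => (((√(conformalFactor f z))⁻¹ : ℝ) : ℂ) with hr
  set A : ℂ → Fin (m + 1) → ℂ := fun z => Pi.single 0 1 + spaceL m (f z) with hA
  have hd : ∀ z ∈ Ω, DifferentiableAt ℝ f z := fun z hz => (hc z hz).differentiableAt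
  have hY : canonicalLift f = fun z => r z • A z := funext fun z => canonicalLift_eq z
  have sf : ContDiffOn ℝ ∞ (fderiv ℝ f) Ω := hf.fderiv_of_isOpen hΩ (by simp)
  have sr : ContDiffOn ℝ ∞ r Ω := by
    refine Complex.ofRealCLM.contDiff.comp_contDiffOn ?_
    refine ContDiffOn.inv ?_ fun z hz => (Real.sqrt_pos.2 (conformalFactor_pos (hc z hz))).ne'
    refine ContDiffOn.sqrt ?_ fun z hz => (conformalFactor_pos (hc z hz)).ne'
    have s1 := fun v : ℂ => sf.clm_apply (contDiffOn_const (c := v))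
    exact (((s1 1).inner ℝ (s1 1)).add ((s1 Complex.I).inner ℝ (s1 Complex.I))).div_const 2
      |>.congr fun z hz => conformalFactor_eq (hd z hz)
  have sA : ContDiffOn ℝ ∞ A Ω :=
    contDiffOn_const.add ((spaceL m).contDiff.comp_contDiffOn hf)
  have fA : ∀ z ∈ Ω, HasFDerivAt A (spaceL m ∘L fderiv ℝ f z) z := fun z hz =>
    ((spaceL m).hasFDerivAt.comp z (hd z hz).hasFDerivAt).const_add _
  have dA : ∀ z ∈ Ω, pdz A z = (1 / 2 : ℂ) • (spaceL m (fderiv ℝ f z 1)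
      - Complex.I • spaceL m (fderiv ℝ f z Complex.I)) := fun z hz => by
    rw [pdz, (fA z hz).fderiv]; rfl
  have dA' : ∀ z ∈ Ω, pdzbar A z = (1 / 2 : ℂ) • (spaceL m (fderiv ℝ f z 1)
      + Complex.I • spaceL m (fderiv ℝ f z Complex.I)) := fun z hz => by
    rw [pdzbar, (fA z hz).fderiv]; rfl
  have diff := fun {z : ℂ} (hz : z ∈ Ω) {E : Type} [NormedAddCommGroup E] [NormedSpace ℝ E]
    {g : ℂ → E} (hg : ContDiffOn ℝ ∞ g Ω) => (hg.contDiffAt (hΩ.mem_nhds hz)).differentiableAt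
      (by simp : (∞ : WithTop ℕ∞) ≠ 0)
  have eZ : ∀ z ∈ Ω, dZ (canonicalLift f) z = pdz r z • A z + r z • pdz A z := fun z hz => by
    rw [hY]; exact pdz_smul (diff hz sr) (diff hz sA)
  have eZb : ∀ z ∈ Ω, dZbar (canonicalLift f) z = pdzbar r z • A z + r z • pdzbar A z :=
    fun z hz => by rw [hY]; exact pdzbar_smul (diff hz sr) (diff hz sA)
  have c1 : ∀ v : EuclideanSpace ℝ (Fin m), lorentz (spaceL m v) (Pi.single 0 1) = 0 := fun v => by
    rw [lorentz_comm, lorentz_single_spaceL]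
  have AA : ∀ z ∈ Ω, lorentz (A z) (A z) = 0 := fun z hz => by
    simp only [hA, lorentz_add_left, lorentz_add_right, lorentz_single_single,
      lorentz_single_spaceL, c1, lorentz_spaceL, real_inner_self_eq_norm_sq, hs z hz]
    norm_num
  have AL : ∀ z ∈ Ω, ∀ v, lorentz (A z) (spaceL m (fderiv ℝ f z v)) = 0 := fun z hz v => by
    simp only [hA, lorentz_add_left, lorentz_single_spaceL, lorentz_spaceL,
      inner_fderiv_of_norm_eq_one hΩ hf hs hz]
    norm_num
  have LA : ∀ z ∈ Ω, ∀ v, lorentz (spaceL m (fderiv ℝ f z v)) (A z) = 0 := fun z hz v => by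
    rw [lorentz_comm, AL z hz]
  refine ⟨hΩ, ?_, fun z hz => ?_, fun z hz => ?_, fun z hz => ?_, fun z hz => ?_⟩
  · rw [hY]; exact sr.smul sA
  · funext i
    refine Fin.cases ?_ (fun i => ?_) i <;> simp [canonicalLift, complexify]
  · rw [hY]
    simp only [lorentz_smul_left, lorentz_smul_right, AA z hz, mul_zero]
  · obtain ⟨c, -, h1, h2, h3⟩ := exists_inner_fderiv_of_conformalAt (hc z hz)
    rw [eZ z hz, dA z hz]
    simp only [lorentz_add_left, lorentz_add_right, lorentz_sub_left, lorentz_sub_right,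
      lorentz_smul_left, lorentz_smul_right, AA z hz, AL z hz, LA z hz, lorentz_spaceL, h1, h2, h3,
      real_inner_comm (fderiv ℝ f z 1) (fderiv ℝ f z Complex.I)]
    push_cast
    linear_combination (r z ^ 2 * c / 4) * Complex.I_sq
  · obtain ⟨c, c0, h1, h2, h3⟩ := exists_inner_fderiv_of_conformalAt (hc z hz)
    have hrc : r z ^ 2 * c = 1 := by
      have e := conformalFactor_eq (hd z hz)
      rw [h1, h2, add_self_div_two] at e
      simp only [hr, e]
      rw [← Complex.ofReal_pow, inv_pow, Real.sq_sqrt c0.le, ← Complex.ofReal_mul,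
        inv_mul_cancel₀ c0.ne', Complex.ofReal_one]
    rw [eZ z hz, eZb z hz, dA z hz, dA' z hz]
    simp only [lorentz_add_left, lorentz_add_right, lorentz_sub_left,
      lorentz_smul_left, lorentz_smul_right, AA z hz, AL z hz, LA z hz, lorentz_spaceL, h1, h2, h3,
      real_inner_comm (fderiv ℝ f z 1) (fderiv ℝ f z Complex.I)]
    push_cast
    linear_combination (-(r z ^ 2 * c / 4)) * Complex.I_sq + hrc / 2

end CanonicalLift

/-! ### Complex coordinates of a Riemann surface -/

section Charts

variable {M : Type*} [TopologicalSpace M] [ChartedSpace ℂ M]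
  {e e' : OpenPartialHomeomorph M ℂ}

theorem contDiffOn_transition (he : e ∈ IsManifold.maximalAtlas 𝓘(ℂ) ω M)
    (he' : e' ∈ IsManifold.maximalAtlas 𝓘(ℂ) ω M) :
    ContDiffOn ℂ ω (fun w => e (e'.symm w)) (e'.symm.trans e).source := by
  rw [← contMDiffOn_iff_contDiffOn]
  refine (contMDiffOn_of_mem_maximalAtlas he).comp
    ((contMDiffOn_symm_of_mem_maximalAtlas he').mono fun w hw => ?_) fun w hw => ?_
  · rw [OpenPartialHomeomorph.trans_source] at hw; exact hw.1
  · rw [OpenPartialHomeomorph.trans_source] at hw; exact hw.2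

theorem mem_source_transition {M : Type*} [TopologicalSpace M]
    {e e' : OpenPartialHomeomorph M ℂ} {w : ℂ} :
    w ∈ (e'.symm.trans e).source ↔ w ∈ e'.target ∧ e'.symm w ∈ e.source := by
  rw [OpenPartialHomeomorph.trans_source]; rfl

/-- The transition map has a holomorphic inverse. -/
theorem deriv_transition_ne_zero (he : e ∈ IsManifold.maximalAtlas 𝓘(ℂ) ω M)
    (he' : e' ∈ IsManifold.maximalAtlas 𝓘(ℂ) ω M) {w : ℂ} (hw : w ∈ (e'.symm.trans e).source) :
    deriv (fun w => e (e'.symm w)) w ≠ 0 := by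
  have hd : ∀ {e e' : OpenPartialHomeomorph M ℂ}, e ∈ IsManifold.maximalAtlas 𝓘(ℂ) ω M →
      e' ∈ IsManifold.maximalAtlas 𝓘(ℂ) ω M → ∀ w ∈ (e'.symm.trans e).source,
      DifferentiableAt ℂ (fun w => e (e'.symm w)) w := fun {e e'} he he' w hw =>
    ((contDiffOn_transition he he').contDiffAt
      ((e'.symm.trans e).open_source.mem_nhds hw)).differentiableAt (by simp)
  obtain ⟨h1, h2⟩ := mem_source_transition.1 hw
  have hw' : e (e'.symm w) ∈ (e.symm.trans e').source :=
    mem_source_transition.2 ⟨e.map_source h2, by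
      rw [e.left_inv h2]; exact e'.map_target h1⟩
  have hcomp : (fun w => e' (e.symm (e (e'.symm w)))) =ᶠ[nhds w] id := by
    filter_upwards [(e'.symm.trans e).open_source.mem_nhds hw] with v hv
    obtain ⟨v1, v2⟩ := mem_source_transition.1 hv
    rw [e.left_inv v2, e'.right_inv v1, id]
  have h3 := ((hd he' he _ hw').hasDerivAt.comp w (hd he he' w hw).hasDerivAt).deriv
  have h4 : deriv ((fun w => e' (e.symm w)) ∘ fun w => e (e'.symm w)) w = 1 :=
    (Filter.EventuallyEq.deriv_eq hcomp).trans (deriv_id w)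
  intro h0
  rw [h4, h0, mul_zero] at h3
  exact one_ne_zero h3

variable {m : ℕ} {y : M → Metric.sphere (0 : EuclideanSpace ℝ (Fin m)) 1}

/-- A map which is smooth in the preferred coordinates is smooth in every complex coordinate. -/
theorem contDiffOn_comp_symm {E : Type*} [NormedAddCommGroup E] [NormedSpace ℝ E] {f : M → E}
    [IsManifold 𝓘(ℂ) ω M] (hf : ContMDiff 𝓘(ℝ, ℂ) 𝓘(ℝ, E) ∞ f)
    (he : e ∈ IsManifold.maximalAtlas 𝓘(ℂ) ω M) :
    ContDiffOn ℝ ∞ (fun w => f (e.symm w)) e.target := by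
  intro z hz
  set p := e.symm z
  have hc : chartAt ℂ p ∈ IsManifold.maximalAtlas 𝓘(ℂ) ω M :=
    IsManifold.chart_mem_maximalAtlas p
  have hz' : z ∈ (e.symm.trans (chartAt ℂ p)).source :=
    mem_source_transition.2 ⟨hz, mem_chart_source ℂ p⟩
  have h1 : ContDiffAt ℝ ∞ (fun w => chartAt ℂ p (e.symm w)) z :=
    (((contDiffOn_transition hc he).contDiffAt
      ((e.symm.trans (chartAt ℂ p)).open_source.mem_nhds hz')).restrict_scalars ℝ).of_le le_top
  have h2 : ContDiffAt ℝ ∞ (fun w => f ((chartAt ℂ p).symm w)) (chartAt ℂ p p) := by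
    have := (contMDiffAt_iff.1 (hf p)).2
    simpa [Function.comp_def, contDiffWithinAt_univ, chartAt_self_eq] using this
  refine ((h2.comp z h1).congr_of_eventuallyEq ?_).contDiffWithinAt
  filter_upwards [(e.symm.trans (chartAt ℂ p)).open_source.mem_nhds hz'] with w hw
  rw [Function.comp_apply, (chartAt ℂ p).left_inv (mem_source_transition.1 hw).2]

theorem IsConformalImmersion.isLift [IsManifold 𝓘(ℂ) ω M]
    (hy : IsConformalImmersion y)
    (he : e ∈ IsManifold.maximalAtlas 𝓘(ℂ) ω M) : IsLift (liftIn y e) e.target :=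
  isLift_canonicalLift e.open_target (contDiffOn_comp_symm hy.1 he) (hy.2 e he)
    fun z _ => norm_eq_of_mem_sphere (y (e.symm z))

theorem IsConformalImmersion.liftIn_zero_ne_zero (hy : IsConformalImmersion y)
    (he : e ∈ IsManifold.maximalAtlas 𝓘(ℂ) ω M) {z : ℂ} (hz : z ∈ e.target) :
    liftIn y e z 0 ≠ 0 :=
  canonicalLift_zero_ne_zero (hy.2 e he z hz)

theorem liftIn_eq_smul {M : Type*} [TopologicalSpace M] {e : OpenPartialHomeomorph M ℂ}
    {y : M → Metric.sphere (0 : EuclideanSpace ℝ (Fin m)) 1} (z : ℂ) : liftIn y e z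
    = liftIn y e z 0 • (Pi.single 0 1 + spaceL m (y (e.symm z)) : Fin (m + 1) → ℂ) := by
  rw [liftIn, canonicalLift_zero, canonicalLift_eq]

/-- The lifts with respect to two complex coordinates are related by a coordinate change. -/
theorem IsConformalImmersion.isCoordinateChange [IsManifold 𝓘(ℂ) ω M]
    (hy : IsConformalImmersion y)
    (he : e ∈ IsManifold.maximalAtlas 𝓘(ℂ) ω M) (he' : e' ∈ IsManifold.maximalAtlas 𝓘(ℂ) ω M) :
    IsCoordinateChange (liftIn y e) e.target (liftIn y e') (e'.symm.trans e).source
      (fun w => e (e'.symm w)) (fun w => liftIn y e' w 0 / liftIn y e (e (e'.symm w)) 0) := by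
  have hsub : (e'.symm.trans e).source ⊆ e'.target := fun w hw => (mem_source_transition.1 hw).1
  have hmaps : Set.MapsTo (fun w => e (e'.symm w)) (e'.symm.trans e).source e.target :=
    fun w hw => e.map_source (mem_source_transition.1 hw).2
  have hL := hy.isLift he
  have hL' := hy.isLift he'
  have hφ := contDiffOn_transition he he'
  have n1 := fun {w : ℂ} (hw : w ∈ (e'.symm.trans e).source) =>
    hy.liftIn_zero_ne_zero he (hmaps hw)
  refine ⟨hL, hL'.mono (e'.symm.trans e).open_source hsub, hφ.differentiableOn (by simp), hmaps,
    fun w hw => deriv_transition_ne_zero he he' hw, ?_, fun w hw => ?_, fun w hw => ?_⟩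
  · have s1 : ContDiffOn ℝ ∞ (fun w => liftIn y e' w 0) (e'.symm.trans e).source :=
      (contDiffOn_pi.1 hL'.smooth 0).mono hsub
    have s2 : ContDiffOn ℝ ∞ (fun w => liftIn y e (e (e'.symm w)) 0) (e'.symm.trans e).source :=
      (contDiffOn_pi.1 hL.smooth 0).comp ((hφ.restrict_scalars ℝ).of_le le_top) hmaps
    simp only [div_eq_mul_inv]
    exact s1.mul (s2.inv fun w hw => n1 hw)
  · exact div_ne_zero (hy.liftIn_zero_ne_zero he' (hsub hw)) (n1 hw)
  · have h1 := liftIn_eq_smul (y := y) (e := e') w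
    have h2 := liftIn_eq_smul (y := y) (e := e) (e (e'.symm w))
    rw [e.left_inv (mem_source_transition.1 hw).2] at h2
    refine h1.trans ?_
    nth_rewrite 2 [h2]
    rw [smul_smul, div_mul_cancel₀ _ (n1 hw)]

theorem IsWillmore.isIsotropicWillmoreLift [IsManifold 𝓘(ℂ) ω M]
    (hy : IsWillmore y) (hiso : HasIsotropicHopf y)
    (he : e ∈ IsManifold.maximalAtlas 𝓘(ℂ) ω M) :
    IsIsotropicWillmoreLift (liftIn y e) e.target :=
  ⟨hy.1.isLift he, hiso e he, hy.2 e he⟩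

end Charts

/-! ### The quartic differential on the Riemann sphere -/

section Sphere

theorem chartZero_target : chartZero.target = Set.univ := by simp [chartZero]

theorem chartInfty_target : chartInfty.target = Set.univ := by
  simp [chartInfty, chartZero, sphereInvHomeo]

theorem chartZero_mem : chartZero ∈ IsManifold.maximalAtlas 𝓘(ℂ) ω (OnePoint ℂ) :=
  IsManifold.subset_maximalAtlas (Or.inl rfl)

theorem chartInfty_mem : chartInfty ∈ IsManifold.maximalAtlas 𝓘(ℂ) ω (OnePoint ℂ) :=
  IsManifold.subset_maximalAtlas (Or.inr rfl)

theorem chartZero_symm_apply (z : ℂ) : chartZero.symm z = (z : OnePoint ℂ) := by simp [chartZero]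

theorem chartInfty_chartZero_symm {z : ℂ} (hz : z ≠ 0) : chartInfty (chartZero.symm z) = z⁻¹ := by
  rw [chartZero_symm_apply]
  exact sphereTransition hz

theorem mem_source_chartZero_trans {z : ℂ} (hz : z ≠ 0) :
    z ∈ (chartZero.symm.trans chartInfty).source := by
  refine mem_source_transition.2 ⟨by simp [chartZero_target], ?_⟩
  rw [chartZero_symm_apply]
  simp [chartInfty, chartZero, sphereInvHomeo, sphereInv_coe, hz]

theorem mem_source_chartInfty_trans {z : ℂ} (hz : z ≠ 0) :
    z ∈ (chartInfty.symm.trans chartZero).source := by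
  refine mem_source_transition.2 ⟨by simp [chartInfty_target], ?_⟩
  change sphereInv (chartZero.symm z) ∈ chartZero.source
  rw [chartZero_symm_apply]
  simp [chartZero, sphereInv_coe, hz]

variable {m : ℕ} {y : OnePoint ℂ → Metric.sphere (0 : EuclideanSpace ℝ (Fin m)) 1}
  {e : OpenPartialHomeomorph (OnePoint ℂ) ℂ}

/-- A holomorphic quartic differential on the sphere vanishes: in the coordinate `z` it is an
entire function, and the transformation law under `z ↦ 1 / z` makes it decay at infinity. -/
theorem IsWillmore.quartic_chartZero_eq_zero (hy : IsWillmore y) (hiso : HasIsotropicHopf y)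
    (z : ℂ) : quartic (liftIn y chartZero) z = 0 := by
  have h0 := hy.isIsotropicWillmoreLift hiso chartZero_mem
  have h1 := hy.isIsotropicWillmoreLift hiso chartInfty_mem
  have hd : Differentiable ℂ (quartic (liftIn y chartZero)) := fun z => by
    have hz : z ∈ chartZero.target := by simp [chartZero_target]
    exact (hasDerivAt_of_pdzbar_eq_zero (h0.differentiableAt hz h0.contDiffOn_quartic)
      (h0.pdzbar_quartic hz)).differentiableAt
  have hlaw : ∀ z : ℂ, z ≠ 0 → quartic (liftIn y chartZero) z
      = (-(z ^ 2)⁻¹) ^ 4 * quartic (liftIn y chartInfty) z⁻¹ := fun z hz => by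
    have e := (hy.1.isCoordinateChange chartInfty_mem chartZero_mem).quartic_eq h1
      (mem_source_chartZero_trans hz)
    have hder : deriv (fun w => chartInfty (chartZero.symm w)) z = -(z ^ 2)⁻¹ := by
      rw [← deriv_inv]
      refine Filter.EventuallyEq.deriv_eq ?_
      filter_upwards [isOpen_ne.mem_nhds hz] with w hw
      exact chartInfty_chartZero_symm hw
    rw [hder] at e
    simpa only [chartInfty_chartZero_symm hz] using e
  have hinv : Filter.Tendsto (fun z : ℂ => z⁻¹) (Filter.cocompact ℂ) (nhds 0) := by
    rw [← Metric.cobounded_eq_cocompact]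
    exact Filter.tendsto_inv₀_cobounded
  have hq1 : ContinuousAt (quartic (liftIn y chartInfty)) 0 :=
    h1.contDiffOn_quartic.continuousOn.continuousAt
      (h1.isOpen.mem_nhds (by simp [chartInfty_target]))
  have hlim : Filter.Tendsto (quartic (liftIn y chartZero)) (Filter.cocompact ℂ) (nhds 0) := by
    have e1 : Filter.Tendsto (fun z : ℂ => (-(z⁻¹ ^ 2)) ^ 4 * quartic (liftIn y chartInfty) z⁻¹)
        (Filter.cocompact ℂ) (nhds ((-((0 : ℂ) ^ 2)) ^ 4 * quartic (liftIn y chartInfty) 0)) :=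
      (((hinv.pow 2).neg).pow 4).mul (hq1.tendsto.comp hinv)
    have e2 : (-((0 : ℂ) ^ 2)) ^ 4 * quartic (liftIn y chartInfty) 0 = 0 := by simp
    rw [e2] at e1
    refine e1.congr' ?_
    filter_upwards [(isCompact_singleton (x := (0 : ℂ))).compl_mem_cocompact] with z hz
    rw [hlaw z hz, inv_pow]
  exact hd.apply_eq_of_tendsto_cocompact z hlim

theorem IsWillmore.quartic_eq_zero (hy : IsWillmore y) (hiso : HasIsotropicHopf y)
    (he : e ∈ IsManifold.maximalAtlas 𝓘(ℂ) ω (OnePoint ℂ)) {w : ℂ} (hw : w ∈ e.target) :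
    quartic (liftIn y e) w = 0 := by
  have h0 := hy.isIsotropicWillmoreLift hiso chartZero_mem
  have h1 := hy.isIsotropicWillmoreLift hiso chartInfty_mem
  have hI : ∀ w : ℂ, quartic (liftIn y chartInfty) w = 0 := by
    have hne : ∀ w : ℂ, w ≠ 0 → quartic (liftIn y chartInfty) w = 0 := fun w hw => by
      have e := (hy.1.isCoordinateChange chartZero_mem chartInfty_mem).quartic_eq h0
        (mem_source_chartInfty_trans hw)
      rw [e, hy.quartic_chartZero_eq_zero hiso, mul_zero]
    intro w
    by_cases hw : w = 0
    · subst hw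
      exact eq_of_eventually_eq_punctured (g := fun _ => (0 : ℂ))
        (h1.contDiffOn_quartic.continuousOn.continuousAt
          (h1.isOpen.mem_nhds (by simp [chartInfty_target]))) continuousAt_const
        (by filter_upwards [self_mem_nhdsWithin] with v hv using hne v hv)
    · exact hne w hw
  have key : ∀ c ∈ IsManifold.maximalAtlas 𝓘(ℂ) ω (OnePoint ℂ), e.symm w ∈ c.source →
      (∀ v, quartic (liftIn y c) v = 0) → quartic (liftIn y e) w = 0 := fun c hc hwc h => by
    have e := (hy.1.isCoordinateChange hc he).quartic_eq (hy.isIsotropicWillmoreLift hiso hc)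
      (mem_source_transition.2 ⟨hw, hwc⟩)
    rw [e, h, mul_zero]
  rcases (chart_mem_atlas ℂ (e.symm w) : _ ∈ ({chartZero, chartInfty} : Set _)) with h | h
  · exact key chartZero chartZero_mem (h ▸ mem_chart_source ℂ _) (hy.quartic_chartZero_eq_zero hiso)
  · exact key chartInfty chartInfty_mem (Set.mem_singleton_iff.1 h ▸ mem_chart_source ℂ _) hI

end Sphere

/-! ### Generic independence of `κ` and `D_z̄ κ` -/

section Wedge

variable {m : ℕ}

theorem hopfWedge_ne_zero_of_linearIndependent {Y : ℂ → Fin (m + 1) → ℂ} {z : ℂ}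
    (h : LinearIndependent ℂ ![hopf Y z, normalDZbar Y (hopf Y) z]) : hopfWedge Y z ≠ 0 := by
  intro h0
  have h1 := LinearIndependent.pair_iff.1 h
  refine h.ne_zero 0 ?_
  funext i
  refine neg_eq_zero.1 ((h1 (normalDZbar Y (hopf Y) z i) (-hopf Y z i) ?_).2)
  funext j
  have := congrFun h0 (i, j)
  simp only [hopfWedge, Pi.zero_apply, Pi.add_apply, Pi.smul_apply, smul_eq_mul] at this ⊢
  linear_combination -this

variable {y : OnePoint ℂ → Metric.sphere (0 : EuclideanSpace ℝ (Fin m)) 1}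
  {e : OpenPartialHomeomorph (OnePoint ℂ) ℂ}

theorem IsConformalImmersion.hopfWedge_eq_zero_of_chart (hy : IsConformalImmersion y)
    {e e' : OpenPartialHomeomorph (OnePoint ℂ) ℂ}
    (he : e ∈ IsManifold.maximalAtlas 𝓘(ℂ) ω (OnePoint ℂ))
    (he' : e' ∈ IsManifold.maximalAtlas 𝓘(ℂ) ω (OnePoint ℂ)) {p : OnePoint ℂ} (hp : p ∈ e.source)
    (hp' : p ∈ e'.source) (h : hopfWedge (liftIn y e) (e p) = 0) :
    hopfWedge (liftIn y e') (e' p) = 0 := by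
  have hw : e' p ∈ (e'.symm.trans e).source :=
    mem_source_transition.2 ⟨e'.map_source hp', by rwa [e'.left_inv hp']⟩
  rw [(hy.isCoordinateChange he he').hopfWedge_eq_zero_iff hw]
  simpa only [e'.left_inv hp'] using h

/-- The order of vanishing of `κ ∧ D_z̄ κ` is finite everywhere unless it vanishes identically, as
the set of points of infinite order is both open and closed. -/
theorem IsWillmore.exists_order_hopfWedge (hy : IsWillmore y) (hiso : HasIsotropicHopf y)
    {e₀ : OpenPartialHomeomorph (OnePoint ℂ) ℂ}
    (he₀ : e₀ ∈ IsManifold.maximalAtlas 𝓘(ℂ) ω (OnePoint ℂ)) {z : ℂ} (hz : z ∈ e₀.target)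
    (hne : hopfWedge (liftIn y e₀) z ≠ 0)
    (he : e ∈ IsManifold.maximalAtlas 𝓘(ℂ) ω (OnePoint ℂ)) {x : ℂ} (hx : x ∈ e.target) :
    ∃ (n : ℕ) (g : ℂ → Fin (m + 1) × Fin (m + 1) → ℂ), ContDiffOn ℝ ∞ g e.target ∧
      (∀ w ∈ e.target, hopfWedge (liftIn y e) w = (w - x) ^ n • g w) ∧ g x ≠ 0 := by
  set V : OnePoint ℂ → Prop := fun p => ∀ c ∈ IsManifold.maximalAtlas 𝓘(ℂ) ω (OnePoint ℂ),
    p ∈ c.source → hopfWedge (liftIn y c) (c p) = 0 with hV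
  set B : Set (OnePoint ℂ) := {p | ∀ᶠ q in nhds p, V q} with hB
  have hVof : ∀ c ∈ IsManifold.maximalAtlas 𝓘(ℂ) ω (OnePoint ℂ), ∀ p ∈ c.source,
      hopfWedge (liftIn y c) (c p) = 0 → V p := fun c hc p hp h c' hc' hp' =>
    hy.1.hopfWedge_eq_zero_of_chart hc hc' hp hp' h
  have hBof : ∀ c ∈ IsManifold.maximalAtlas 𝓘(ℂ) ω (OnePoint ℂ), ∀ p ∈ c.source,
      (∀ᶠ w in nhds (c p), hopfWedge (liftIn y c) w = 0) → p ∈ B := fun c hc p hp h => by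
    filter_upwards [(c.continuousAt hp).eventually h, c.open_source.mem_nhds hp] with q hq hqc
    exact hVof c hc q hqc hq
  have hopen : IsOpen B := isOpen_setOfPred_eventually_nhds
  have hclosed : IsClosed B := by
    rw [← isOpen_compl_iff, isOpen_iff_mem_nhds]
    intro p hp
    have hc : chartAt ℂ p ∈ IsManifold.maximalAtlas 𝓘(ℂ) ω (OnePoint ℂ) :=
      IsManifold.chart_mem_maximalAtlas p
    set c := chartAt ℂ p
    have hpc : p ∈ c.source := mem_chart_source ℂ p
    rcases (hy.isIsotropicWillmoreLift hiso hc).eventually_hopfWedge_eq_zero_or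
      (c.map_source hpc) with h | ⟨n, g, hg, hWg, hgx⟩
    · exact absurd (hBof c hc p hpc h) hp
    · have hgne : ∀ᶠ w in nhds (c p), g w ≠ 0 :=
        (hg.continuousOn.continuousAt (c.open_target.mem_nhds (c.map_source hpc))).eventually_ne hgx
      filter_upwards [(c.continuousAt hpc).eventually hgne, c.open_source.mem_nhds hpc]
        with q hq hqc hqB
      by_cases hqp : q = p
      · exact hp (hqp ▸ hqB)
      · have h0 : hopfWedge (liftIn y c) (c q) = 0 := hqB.self_of_nhds c hc hqc
        rw [hWg _ (c.map_source hqc), smul_eq_zero] at h0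
        refine h0.elim (fun h => hqp (c.injOn hqc hpc ?_)) hq
        by_contra hne'
        exact pow_ne_zero n (sub_ne_zero.2 hne') h
  have hempty : B = ∅ := by
    rcases isClopen_iff.1 ⟨hclosed, hopen⟩ with h | h
    · exact h
    · have hmem : e₀.symm z ∈ B := h ▸ Set.mem_univ _
      have h0 := hmem.self_of_nhds e₀ he₀ (e₀.map_target hz)
      rw [e₀.right_inv hz] at h0
      exact absurd h0 hne
  refine ((hy.isIsotropicWillmoreLift hiso he).eventually_hopfWedge_eq_zero_or hx).resolve_left
    fun h => ?_
  have : e.symm x ∈ B := hBof e he _ (e.map_target hx) (by rwa [e.right_inv hx])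
  rw [hempty] at this
  exact this

end Wedge

/-! ### Adapted frames and fullness -/

section Global

variable {y : OnePoint ℂ → Metric.sphere (0 : EuclideanSpace ℝ (Fin 7)) 1}

theorem IsWillmore.exists_isAdaptedIsotropicFrame (hy : IsWillmore y) (hiso : HasIsotropicHopf y)
    {e₀ : OpenPartialHomeomorph (OnePoint ℂ) ℂ}
    (he₀ : e₀ ∈ IsManifold.maximalAtlas 𝓘(ℂ) ω (OnePoint ℂ)) {z : ℂ} (hz : z ∈ e₀.target)
    (hne : hopfWedge (liftIn y e₀) z ≠ 0) {e : OpenPartialHomeomorph (OnePoint ℂ) ℂ}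
    (he : e ∈ IsManifold.maximalAtlas 𝓘(ℂ) ω (OnePoint ℂ)) {x : ℂ} (hx : x ∈ e.target) :
    ∃ U : Set ℂ, IsOpen U ∧ x ∈ U ∧ U ⊆ e.target ∧ ∃ E : Fin 2 → ℂ → Fin 8 → ℂ,
      IsAdaptedIsotropicFrame (m := 7) (liftIn y e) U E := by
  have h := hy.isIsotropicWillmoreLift hiso he
  obtain ⟨n, g, hg, hWg, hgx⟩ := hy.exists_order_hopfWedge hiso he₀ hz hne he hx
  obtain ⟨U, hU, hxU, hUe, F, hF⟩ :=
    h.exists_preFrame (fun w hw => hy.quartic_eq_zero hiso he hw) hx hg hWg hgx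
  have hl := h.toIsLift.mono hU hUe
  obtain ⟨E, hE, huni⟩ := hF.exists_unitary hl
  exact ⟨U, hU, hxU, hUe, E, hE.isAdaptedIsotropicFrame hl huni⟩

/-- A set whose affine span is not the whole space lies in an affine hyperplane. -/
theorem exists_inner_eq_const_of_affineSpan_ne_top {ι V : Type*} [NormedAddCommGroup V]
    [InnerProductSpace ℝ V] [FiniteDimensional ℝ V] [Nonempty ι] {f : ι → V}
    (h : affineSpan ℝ (Set.range f) ≠ ⊤) : ∃ (a : V) (c : ℝ), a ≠ 0 ∧ ∀ p, inner ℝ a (f p) = c := by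
  obtain ⟨q⟩ := ‹Nonempty ι›
  have hq : f q ∈ affineSpan ℝ (Set.range f) := mem_affineSpan ℝ ⟨q, rfl⟩
  have hdir : (affineSpan ℝ (Set.range f)).direction ≠ ⊤ := fun h' =>
    h ((AffineSubspace.direction_eq_top_iff_of_nonempty ⟨_, hq⟩).1 h')
  obtain ⟨a, ha, ha0⟩ := Submodule.exists_mem_ne_zero_of_ne_bot
    fun h' => hdir ((Submodule.orthogonal_eq_bot_iff).1 h')
  refine ⟨a, inner ℝ a (f q), ha0, fun p => ?_⟩
  have hp : f p ∈ affineSpan ℝ (Set.range f) := mem_affineSpan ℝ ⟨p, rfl⟩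
  have := (Submodule.mem_orthogonal' _ _).1 ha _ (AffineSubspace.vsub_mem_direction hp hq)
  rwa [vsub_eq_sub, inner_sub_right, sub_eq_zero] at this

theorem isFull_of_isAdaptedIsotropicFrame (hy : IsConformalImmersion y)
    {e : OpenPartialHomeomorph (OnePoint ℂ) ℂ}
    (he : e ∈ IsManifold.maximalAtlas 𝓘(ℂ) ω (OnePoint ℂ)) {U : Set ℂ} (hU : IsOpen U)
    (hUe : U ⊆ e.target) {E : Fin 2 → ℂ → Fin 8 → ℂ}
    (hE : IsAdaptedIsotropicFrame (m := 7) (liftIn y e) U E) {z : ℂ} (hz : z ∈ U)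
    (hne : hopfWedge (liftIn y e) z ≠ 0) : IsFull y := by
  by_contra hfull
  obtain ⟨a, c, ha, hac⟩ := exists_inner_eq_const_of_affineSpan_ne_top hfull
  -- The hyperplane `⟨a, y⟩ = c` corresponds to the vector `(c, a)` orthogonal to the lift.
  set v : Fin 8 → ℂ := (c : ℂ) • Pi.single 0 1 + spaceL 7 a with hv
  have hstar : star v = v := by
    funext i
    refine Fin.cases ?_ (fun i => ?_) i <;> simp [hv, spaceL]
  have hvY : ∀ w ∈ U, lorentz (m := 7) v (liftIn y e w) = 0 := fun w _ => by
    rw [liftIn_eq_smul w, hv]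
    simp only [lorentz_smul_right, lorentz_add_left, lorentz_add_right, lorentz_smul_left,
      lorentz_single_single, lorentz_single_spaceL, lorentz_spaceL, hac,
      lorentz_comm (spaceL 7 a) (Pi.single 0 1)]
    ring
  have hv0 := hE.eq_zero_of_lorentz_eq_zero ((hy.isLift he).mono hU hUe) hstar hvY hz hne
  refine ha ?_
  ext i
  have := congrFun hv0 i.succ
  simpa [hv, spaceL] using this

end Global

end WillmoreSurface

end

theorem theorem2p1
    (y : OnePoint ℂ → Metric.sphere (0 : EuclideanSpace ℝ (Fin 7)) 1)
    (hy : WillmoreSurface.IsWillmore y)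
    (hiso : WillmoreSurface.HasIsotropicHopf y)
    (hS : ¬ WillmoreSurface.IsSWillmore y) :
    WillmoreSurface.IsTotallyIsotropic y ∧
    WillmoreSurface.IsFull y ∧
    ∀ e ∈ IsManifold.maximalAtlas 𝓘(ℂ) ω (OnePoint ℂ), ∀ x ∈ e.target,
      ∃ U : Set ℂ, IsOpen U ∧ x ∈ U ∧ U ⊆ e.target ∧
        ∃ E : Fin 2 → ℂ → Fin 8 → ℂ,
          WillmoreSurface.IsAdaptedIsotropicFrame (WillmoreSurface.liftIn y e) U E := by
  have hS' : ∃ e₀ ∈ IsManifold.maximalAtlas 𝓘(ℂ) ω (OnePoint ℂ), ∃ z₀ ∈ e₀.target,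
      WillmoreSurface.hopfWedge (WillmoreSurface.liftIn y e₀) z₀ ≠ 0 := by
    by_contra hcon
    refine hS ⟨hy, fun e he z hz hli => hcon ⟨e, he, z, hz, ?_⟩⟩
    exact WillmoreSurface.hopfWedge_ne_zero_of_linearIndependent hli
  obtain ⟨e₀, he₀, z₀, hz₀, hne⟩ := hS'
  have hframe := fun {e : OpenPartialHomeomorph (OnePoint ℂ) ℂ}
    (he : e ∈ IsManifold.maximalAtlas 𝓘(ℂ) ω (OnePoint ℂ)) {x : ℂ} (hx : x ∈ e.target) =>
    hy.exists_isAdaptedIsotropicFrame hiso he₀ hz₀ hne he hx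
  refine ⟨fun e he z hz j k hj hk => ?_, ?_, fun e he x hx => hframe he hx⟩
  · obtain ⟨U, hU, hzU, hUe, E, hE⟩ := hframe he hz
    exact hE.lorentz_iterate_dZ ((hy.1.isLift he).mono hU hUe) hzU hj hk
  · obtain ⟨U, hU, hzU, hUe, E, hE⟩ := hframe he₀ hz₀
    exact WillmoreSurface.isFull_of_isAdaptedIsotropicFrame hy.1 he₀ hU hUe hE hzU hne
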